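/- Let $M$ be a smooth manifold and let $T$ be a connected Abelian (finite-dimensional) Lie group of diffeomorphisms of $M$, i.e. a connected Abelian Lie group acting smoothly and effectively on $M$. Let $\mathfrak t$ be its Lie algebra, $\rho_v(x)=\frac{d}{d\tau}\big|_{\tau=0}\exp(\tau v)x$ the infinitesimal action of $v\in\mathfrak t$, $\Pi\in\Lambda^2\mathfrak t$, $\#_\Pi:\mathfrak t^*\to\mathfrak t$ the map with $\beta(\#_\Pi\alpha)=\Pi(\alpha,\beta)$, and $\pi:=\rho(\Pi)$ the induced bivector field on $M$ (an Abelian Poisson structure), with bracket $\{f,g\}=\pi(df,dg)$. Let $p:T^*M\to M$ be the projection, $\rho^*:T^*M\to\mathfrak t^*$, $\langle\rho^*\xi,v\rangle=\xi(\rho_v(p(\xi)))$, let $R_u:=\exp(\#_\Pi u)\in T$ for $u\in\mathfrak t^*$, and $B_\xi:=R_{\rho^*\xi/2}=\exp(\tfrac12\#_\Pi\rho^*\xi)$ for $\xi\in T^*M$. For $\xi,\zeta\in T^*M$ let $B_\xi^*\zeta:=\zeta\circ(T_{p(\zeta)}B_\xi)^{-1}\in T^*_{B_\xi p(\zeta)}M$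 be the covector $\zeta$ transported by the diffeomorphism $B_\xi$. Theorem. Give $T^*M$ the source and target maps $\mathsf s(\xi)=B_{-\xi}\,p(\xi)$ and $\mathsf t(\xi)=B_\xi\,p(\xi)$, the zero section as unit map, the inverse $\xi^{-1}=-\xi$ and, for $\mathsf s(\xi)=\mathsf t(\zeta)$, the product $$\xi\cdot\zeta=B^*_{\xi}\zeta+B^*_{-\zeta}\xi\in T^*_yM,\qquad y=B_\xi p(\zeta)=B_{-\zeta}p(\xi).$$ Let $\omega=-d\theta$, where $\theta$ is the Liouville form of $T^*M$ (so $\omega=\sum dq^i\wedge dp_i$, with bracket $\{q^i,p_j\}=\delta^i_j$). Then $\pi$ is a Poisson structure, and $(T^*M,\omega)$ is a symplectic groupoid integrating $(M,\pi)$. That is, $T^*M$ is a Lie groupoid over $M$; $\omega$ is a symplectic form and is multiplicative, $\mathrm{pr}_1^*\omega-\mathsf m^*\omega+\mathrm{pr}_2^*\omega=0$ on the manifold of composable pairs, where $\mathsf m$ is the product map; $\mathsf t$ is a Poisson map; and the fibres of $\mathsf s$ are connected. Moreover, let $\mathfrak t^*\ltimes_RM$ be the action groupoid, presented as the manifold $\mathfrak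 t^*\times M$ with $\mathsf s(u,x)=R_{-u/2}x$, $\mathsf t(u,x)=R_{u/2}x$, unit $x\mapsto(0,x)$, $(u,x)^{-1}=(-u,x)$ and $(u,x)\cdot(v,y)=(u+v,R_{-v/2}x)$ for composable pairs. Then $\mathfrak t^*\ltimes_RM$ is a Lie groupoid over $M$, and $q=(\rho^*,p):T^*M\to\mathfrak t^*\ltimes_RM$ is a homomorphism of Lie groupoids over the identity of $M$. -/

import Mathlib

open scoped Manifold ContDiff Topology
open Set

noncomputable section

namespace AbelianPoisson

/-! ### Differential forms on manifolds -/

section Forms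

variable {E : Type*} [NormedAddCommGroup E] [NormedSpace ℝ E]
  {H : Type*} [TopologicalSpace H] (I : ModelWithCorners ℝ E H)
  {X : Type*} [TopologicalSpace X] [ChartedSpace H X]

/-- A (not necessarily smooth) differential `k`-form on the manifold `X`. -/
abbrev DiffForm (k : ℕ) (X : Type*) [TopologicalSpace X] [ChartedSpace H X] :=
  (x : X) → TangentSpace I x [⋀^Fin k]→L[ℝ] ℝ

variable {I}

/-- The pullback of a form to the model vector space by the inverse of the preferred chart
at `x₀`; only its values on the target of the chart are meaningful. -/
def formInChart {k : ℕ} (Ω : DiffForm I k X) (x₀ : X) (y : E) : E [⋀^Fin k]→L[ℝ] ℝ :=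
  (Ω ((extChartAt I x₀).symm y)).compContinuousLinearMap
    (mfderivWithin 𝓘(ℝ, E) I (extChartAt I x₀).symm (range I) y)

/-- A form is smooth if all its local representations are. -/
def IsSmoothForm {k : ℕ} (Ω : DiffForm I k X) : Prop :=
  ∀ x₀ : X, ContDiffOn ℝ ∞ (formInChart Ω x₀) (extChartAt I x₀).target

/-- The exterior derivative of a form on a manifold, computed at `x` in the preferred chart
at `x`. -/
def mextDeriv {k : ℕ} (Ω : DiffForm I k X) : DiffForm I (k + 1) X := fun x =>
  (extDerivWithin (formInChart Ω x) (range I) (extChartAt I x x)).compContinuousLinearMap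
    (mfderiv I 𝓘(ℝ, E) (extChartAt I x) x)

/-- A symplectic form: a smooth closed nondegenerate `2`-form. -/
structure IsSymplecticForm (Ω : DiffForm I 2 X) : Prop where
  smooth : IsSmoothForm Ω
  closed : mextDeriv Ω = 0
  nondegenerate : ∀ (x : X) (v : TangentSpace I x),
    (∀ w : TangentSpace I x, Ω x ![v, w] = 0) → v = 0

/-- The differential of a real function, as a covector at `x`. -/
def differential (f : X → ℝ) (x : X) : TangentSpace I x →L[ℝ] ℝ :=
  mfderiv I 𝓘(ℝ, ℝ) f x

open Classical in
/-- The Hamiltonian vector field `X_h` of `h`, determined by `Ω(X_h, w) = dh(w)` for all `w`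
(when `Ω` is nondegenerate; it is `0` where there is no such vector). -/
def hamiltonianVectorField (Ω : DiffForm I 2 X) (h : X → ℝ) (x : X) : TangentSpace I x :=
  if hv : ∃ v : TangentSpace I x, ∀ w : TangentSpace I x, Ω x ![v, w] = differential h x w
  then hv.choose else 0

/-- The Poisson bracket `{f, g} = Ω(X_f, X_g)` of a symplectic form. -/
def symplecticBracket (Ω : DiffForm I 2 X) (f g : X → ℝ) (x : X) : ℝ :=
  Ω x ![hamiltonianVectorField Ω f x, hamiltonianVectorField Ω g x]

end Forms

/-! ### Bivectors and Poisson structures -/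

section Bivectors

variable {V : Type*} [AddCommGroup V] [Module ℝ V]

/-- The value `P(α, β)` of a bivector on two covectors, normalised by
`(v ∧ w)(α, β) = α(v) β(w) - α(w) β(v)`. -/
def bivectorPairing (P : ⋀[ℝ]^2 V) (α β : Module.Dual ℝ V) : ℝ :=
  exteriorPower.pairingDual ℝ V 2 (exteriorPower.ιMulti ℝ 2 ![α, β]) P

theorem bivectorPairing_wedge (v w : V) (α β : Module.Dual ℝ V) :
    bivectorPairing (exteriorPower.ιMulti ℝ 2 ![v, w]) α β = α v * β w - α w * β v := by
  simp [bivectorPairing, Matrix.det_fin_two, mul_comm]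

/-- The linear form `β ↦ P(α, β)`. -/
def bivectorContract (P : ⋀[ℝ]^2 V) (α : Module.Dual ℝ V) : Module.Dual ℝ (Module.Dual ℝ V) where
  toFun β := bivectorPairing P α β
  map_add' β γ := by
    have e : ∀ δ : Module.Dual ℝ V, Function.update ![α, β] 1 δ = ![α, δ] := fun δ => by
      ext i; fin_cases i <;> simp
    have h := (exteriorPower.ιMulti ℝ 2 (M := Module.Dual ℝ V)).map_update_add ![α, β] 1 β γ
    simp only [e] at h
    simp [bivectorPairing, h]
  map_smul' c β := by
    have e : ∀ δ : Module.Dual ℝ V, Function.update ![α, β] 1 δ = ![α, δ] := fun δ => by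
      ext i; fin_cases i <;> simp
    have h := (exteriorPower.ιMulti ℝ 2 (M := Module.Dual ℝ V)).map_update_smul ![α, β] 1 c β
    simp only [e] at h
    simp [bivectorPairing, h]

/-- The sharp map `#_P : V* → V` of a bivector on a finite-dimensional space, determined by
`β(#_P α) = P(α, β)`. -/
def sharp [FiniteDimensional ℝ V] (P : ⋀[ℝ]^2 V) (α : Module.Dual ℝ V) : V :=
  (Module.evalEquiv ℝ V).symm (bivectorContract P α)

theorem apply_sharp [FiniteDimensional ℝ V] (P : ⋀[ℝ]^2 V) (α β : Module.Dual ℝ V) :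
    β (sharp P α) = bivectorPairing P α β := by
  have h : β (sharp P α) = bivectorContract P α β := by simp [sharp]
  exact h

variable {E : Type*} [NormedAddCommGroup E] [NormedSpace ℝ E]
  {H : Type*} [TopologicalSpace H] (I : ModelWithCorners ℝ E H)
  {M : Type*} [TopologicalSpace M] [ChartedSpace H M]

/-- A (not necessarily smooth) bivector field. -/
abbrev BivectorField (M : Type*) [TopologicalSpace M] [ChartedSpace H M] :=
  (x : M) → ⋀[ℝ]^2 (TangentSpace I x)

variable {I}

/-- The bracket `{f, g} = π(df, dg)` of functions defined by a bivector field. -/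
def bivectorBracket (π : BivectorField I M) (f g : M → ℝ) (x : M) : ℝ :=
  bivectorPairing (π x) (differential (I := I) f x : TangentSpace I x →ₗ[ℝ] ℝ)
    (differential (I := I) g x : TangentSpace I x →ₗ[ℝ] ℝ)

/-- A Poisson structure: a smooth bivector field whose bracket on smooth functions satisfies the
Jacobi identity (bilinearity, antisymmetry and the Leibniz rule are automatic). -/
structure IsPoissonStructure (π : BivectorField I M) : Prop where
  smooth : ∀ f g : M → ℝ, ContMDiff I 𝓘(ℝ, ℝ) ∞ f → ContMDiff I 𝓘(ℝ, ℝ) ∞ g →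
    ContMDiff I 𝓘(ℝ, ℝ) ∞ (bivectorBracket π f g)
  jacobi : ∀ f g h : M → ℝ, ContMDiff I 𝓘(ℝ, ℝ) ∞ f → ContMDiff I 𝓘(ℝ, ℝ) ∞ g →
    ContMDiff I 𝓘(ℝ, ℝ) ∞ h → ∀ x : M,
    bivectorBracket π f (bivectorBracket π g h) x + bivectorBracket π g (bivectorBracket π h f) x +
      bivectorBracket π h (bivectorBracket π f g) x = 0

end Bivectors

/-! ### Lie groupoids and symplectic groupoids -/

section Groupoids

/-- The structure maps of a groupoid with arrows `X` and objects `M`. The product `mul ξ ζ` is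
meaningful only for composable pairs, `source ξ = target ζ`. -/
structure GroupoidMaps (X M : Type*) where
  source : X → M
  target : X → M
  unit : M → X
  inv : X → X
  mul : X → X → X

/-- The set of composable pairs. -/
def GroupoidMaps.composable {X M : Type*} (G : GroupoidMaps X M) : Set (X × X) :=
  {z | G.source z.1 = G.target z.2}

variable {E : Type*} [NormedAddCommGroup E] [NormedSpace ℝ E]
  {H : Type*} [TopologicalSpace H] (I : ModelWithCorners ℝ E H)
  {X : Type*} [TopologicalSpace X] [ChartedSpace H X]
  {E' : Type*} [NormedAddCommGroup E'] [NormedSpace ℝ E']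
  {H' : Type*} [TopologicalSpace H'] (J : ModelWithCorners ℝ E' H')
  {M : Type*} [TopologicalSpace M] [ChartedSpace H' M]

/-- A surjective submersion. -/
structure IsSurjectiveSubmersion (f : X → M) : Prop where
  smooth : ContMDiff I J ∞ f
  surjective : Function.Surjective f
  mfderiv_surjective : ∀ x : X, Function.Surjective (mfderiv I J f x)

/-- Lie groupoids. As source and target are submersions, the set of composable pairs is an
embedded submanifold of `X × X`, and smoothness of the product on it is smoothness on this
subset. -/
structure IsLieGroupoid (G : GroupoidMaps X M) : Prop where
  source_submersion : IsSurjectiveSubmersion I J G.source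
  target_submersion : IsSurjectiveSubmersion I J G.target
  smooth_unit : ContMDiff J I ∞ G.unit
  smooth_inv : ContMDiff I I ∞ G.inv
  smooth_mul : ContMDiffOn (I.prod I) I ∞ (fun z : X × X => G.mul z.1 z.2) G.composable
  source_unit : ∀ x : M, G.source (G.unit x) = x
  target_unit : ∀ x : M, G.target (G.unit x) = x
  source_inv : ∀ ξ : X, G.source (G.inv ξ) = G.target ξ
  target_inv : ∀ ξ : X, G.target (G.inv ξ) = G.source ξ
  source_mul : ∀ ξ ζ : X, G.source ξ = G.target ζ → G.source (G.mul ξ ζ) = G.source ζ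
  target_mul : ∀ ξ ζ : X, G.source ξ = G.target ζ → G.target (G.mul ξ ζ) = G.target ξ
  mul_assoc : ∀ ξ ζ η : X, G.source ξ = G.target ζ → G.source ζ = G.target η →
    G.mul (G.mul ξ ζ) η = G.mul ξ (G.mul ζ η)
  unit_mul : ∀ ξ : X, G.mul (G.unit (G.target ξ)) ξ = ξ
  mul_unit : ∀ ξ : X, G.mul ξ (G.unit (G.source ξ)) = ξ
  inv_mul : ∀ ξ : X, G.mul (G.inv ξ) ξ = G.unit (G.source ξ)
  mul_inv : ∀ ξ : X, G.mul ξ (G.inv ξ) = G.unit (G.target ξ)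

variable {I}

/-- A form `Ω` on the arrows is multiplicative if `pr₁^* Ω - m^* Ω + pr₂^* Ω = 0` on the
submanifold of composable pairs. The tangent vectors `(a, b)` of this submanifold at `(ξ, ζ)` are
those with `Ts(a) = Tt(b)`, both in the tangent space at the point `s(ξ) = t(ζ)`. -/
def IsMultiplicative {k : ℕ} (G : GroupoidMaps X M) (Ω : DiffForm I k X) : Prop :=
  ∀ ξ ζ : X, G.source ξ = G.target ζ →
    ∀ (a : Fin k → TangentSpace I ξ) (b : Fin k → TangentSpace I ζ),
      (∀ i, (mfderiv I J G.source ξ (a i) : E') = (mfderiv I J G.target ζ (b i) : E')) →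
      Ω ξ a
        - Ω (G.mul ξ ζ) (fun i =>
            mfderivWithin (I.prod I) I (fun z : X × X => G.mul z.1 z.2) G.composable (ξ, ζ)
              (a i, b i))
        + Ω ζ b = 0

/-- A symplectic groupoid: a Lie groupoid with a multiplicative symplectic form. -/
structure IsSymplecticGroupoid (G : GroupoidMaps X M) (Ω : DiffForm I 2 X) : Prop where
  isLieGroupoid : IsLieGroupoid I J G
  isSymplecticForm : IsSymplecticForm Ω
  multiplicative : IsMultiplicative J G Ω

variable {J}

/-- `f : (X, Ω) → (M, π)` is a Poisson map. -/
def IsPoissonMap (Ω : DiffForm I 2 X) (π : BivectorField J M) (f : X → M) : Prop :=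
  ∀ g h : M → ℝ, ContMDiff J 𝓘(ℝ, ℝ) ∞ g → ContMDiff J 𝓘(ℝ, ℝ) ∞ h → ∀ ξ : X,
    symplecticBracket Ω (g ∘ f) (h ∘ f) ξ = bivectorBracket π g h (f ξ)

/-- `(M, π)` is a Poisson manifold and the symplectic groupoid `(G, Ω)` integrates it: the target
map is Poisson and the source fibres are connected. -/
structure IsSymplecticGroupoidIntegrating (G : GroupoidMaps X M) (Ω : DiffForm I 2 X)
    (π : BivectorField J M) : Prop where
  isSymplecticGroupoid : IsSymplecticGroupoid J G Ω
  isPoissonStructure : IsPoissonStructure π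
  target_isPoissonMap : IsPoissonMap Ω π G.target
  source_connected : ∀ x : M, IsConnected (G.source ⁻¹' {x})

variable (I J)
variable {E₂ : Type*} [NormedAddCommGroup E₂] [NormedSpace ℝ E₂]
  {H₂ : Type*} [TopologicalSpace H₂] (I₂ : ModelWithCorners ℝ E₂ H₂)
  {X₂ : Type*} [TopologicalSpace X₂] [ChartedSpace H₂ X₂]
  {E₂' : Type*} [NormedAddCommGroup E₂'] [NormedSpace ℝ E₂']
  {H₂' : Type*} [TopologicalSpace H₂'] (J₂ : ModelWithCorners ℝ E₂' H₂')
  {M₂ : Type*} [TopologicalSpace M₂] [ChartedSpace H₂' M₂]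

/-- A homomorphism of Lie groupoids: a smooth map of arrows `q` which, with the smooth map of
objects `q₀`, is a functor. -/
structure IsLieGroupoidHom (G : GroupoidMaps X M) (G₂ : GroupoidMaps X₂ M₂)
    (q : X → X₂) (q₀ : M → M₂) : Prop where
  isLieGroupoid_dom : IsLieGroupoid I J G
  isLieGroupoid_cod : IsLieGroupoid I₂ J₂ G₂
  smooth : ContMDiff I I₂ ∞ q
  smooth_obj : ContMDiff J J₂ ∞ q₀
  map_source : ∀ ξ : X, G₂.source (q ξ) = q₀ (G.source ξ)
  map_target : ∀ ξ : X, G₂.target (q ξ) = q₀ (G.target ξ)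
  map_unit : ∀ x : M, q (G.unit x) = G₂.unit (q₀ x)
  map_inv : ∀ ξ : X, q (G.inv ξ) = G₂.inv (q ξ)
  map_mul : ∀ ξ ζ : X, G.source ξ = G.target ζ → q (G.mul ξ ζ) = G₂.mul (q ξ) (q ζ)

end Groupoids

/-! ### The cotangent bundle -/

section Cotangent

variable (E : Type*) [NormedAddCommGroup E] [NormedSpace ℝ E]
  (M : Type*) [TopologicalSpace M] [ChartedSpace E M]

/-- The cotangent space of `M` at `x`. -/
abbrev CotangentSpace (x : M) : Type _ := TangentSpace 𝓘(ℝ, E) x →L[ℝ] ℝ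

/-- The cotangent bundle of `M`; `ξ.1` is the base point `p(ξ)` of `ξ`, and `ξ.2` the covector. -/
abbrev CotangentBundle [IsManifold 𝓘(ℝ, E) 1 M] : Type _ :=
  Bundle.TotalSpace (E →L[ℝ] ℝ) (CotangentSpace E M)

/-- The model of the cotangent bundle as a manifold. -/
abbrev cotangentModel : ModelWithCorners ℝ (E × (E →L[ℝ] ℝ)) (ModelProd E (E →L[ℝ] ℝ)) :=
  𝓘(ℝ, E).prod 𝓘(ℝ, E →L[ℝ] ℝ)

variable {E M} [IsManifold 𝓘(ℝ, E) 1 M]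

/-- The Liouville form `θ_ξ(v) = ξ(Tp(v))`. -/
def liouvilleForm : DiffForm (cotangentModel E) 1 (CotangentBundle E M) := fun ξ =>
  ContinuousAlternatingMap.ofSubsingleton ℝ (TangentSpace (cotangentModel E) ξ) ℝ (0 : Fin 1)
    (ξ.2.comp (mfderiv (cotangentModel E) 𝓘(ℝ, E)
      (fun η : CotangentBundle E M => η.1) ξ))

/-- The canonical symplectic form `Ω = -dθ` (in canonical coordinates, `∑ dqⁱ ∧ dpᵢ`). -/
def canonicalForm : DiffForm (cotangentModel E) 2 (CotangentBundle E M) :=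
  -mextDeriv liouvilleForm

/-- The opposite covector. -/
def cotangentNeg (ξ : CotangentBundle E M) : CotangentBundle E M := ⟨ξ.1, -ξ.2⟩

open Classical in
/-- The sum of two covectors at the same base point (of no meaning if the base points differ). -/
def cotangentAdd (ξ ζ : CotangentBundle E M) : CotangentBundle E M :=
  if h : ζ.1 = ξ.1 then ⟨ξ.1, ξ.2 + h ▸ ζ.2⟩ else ξ

end Cotangent

/-! ### The groupoids of an Abelian Poisson structure -/

section Abelian

variable {F : Type*} [NormedAddCommGroup F] [NormedSpace ℝ F]
  {T : Type*} [TopologicalSpace T] [ChartedSpace F T]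

instance finiteDimensional_tangentSpace {x : T} [FiniteDimensional ℝ F] : FiniteDimensional ℝ (TangentSpace 𝓘(ℝ, F) x) :=
  inferInstanceAs (FiniteDimensional ℝ F)

open Classical in
/-- The exponential map of a Lie group: `exp v = γ(1)`, where `γ` is the integral curve of the
left-invariant vector field of `v` with `γ(0) = 1`. -/
def lieExp [Group T] (v : GroupLieAlgebra 𝓘(ℝ, F) T) : T :=
  if h : ∃ γ : ℝ → T, γ 0 = 1 ∧
      IsMIntegralCurve (I := 𝓘(ℝ, F)) γ (mulInvariantVectorField v)
  then h.choose 1 else 1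

variable {E : Type*} [NormedAddCommGroup E] [NormedSpace ℝ E]
  {M : Type*} [TopologicalSpace M] [ChartedSpace E M]

/-- The infinitesimal action at `x`: `ρ_v(x)` is the derivative at `1`, in the direction `v`, of
`g ↦ g x`. The target `T_{1 x} M` is the same as `T_x M`. -/
def infinitesimalAction [Group T] [MulAction T M] (x : M) :
    GroupLieAlgebra 𝓘(ℝ, F) T →L[ℝ] TangentSpace 𝓘(ℝ, E) x :=
  one_smul T x ▸ mfderiv 𝓘(ℝ, F) 𝓘(ℝ, E) (fun g : T => g • x) 1

/-- The bivector field `π = ρ(Π)`. -/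
def abelianBivector [Group T] [MulAction T M]
    (P : ⋀[ℝ]^2 (GroupLieAlgebra 𝓘(ℝ, F) T)) : BivectorField 𝓘(ℝ, E) M := fun x =>
  exteriorPower.map 2
    (infinitesimalAction (F := F) (T := T) (E := E) x).toLinearMap P

/-- The map `R : 𝔱* → T`, `R_u = exp(#_Π u)`. The Lie algebra `𝔱 = T_1 T` is, as a vector space,
the model space `F` of `T`, so that `𝔱*` is the normed space `F →L[ℝ] ℝ`. -/
def coalgebraAction [FiniteDimensional ℝ F] [Group T] (P : ⋀[ℝ]^2 (GroupLieAlgebra 𝓘(ℝ, F) T))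
    (u : F →L[ℝ] ℝ) : T :=
  lieExp (sharp P (u : F →ₗ[ℝ] ℝ))

/-- The action groupoid `𝔱* ⋉_R M`, presented symmetrically on `𝔱* × M`. -/
def actionGroupoid [FiniteDimensional ℝ F] [Group T] [MulAction T M]
    (P : ⋀[ℝ]^2 (GroupLieAlgebra 𝓘(ℝ, F) T)) : GroupoidMaps ((F →L[ℝ] ℝ) × M) M where
  source z := coalgebraAction P (-((1 / 2 : ℝ) • z.1)) • z.2
  target z := coalgebraAction P ((1 / 2 : ℝ) • z.1) • z.2
  unit x := (0, x)
  inv z := (-z.1, z.2)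
  mul z w := (z.1 + w.1, coalgebraAction P (-((1 / 2 : ℝ) • w.1)) • z.2)

variable [IsManifold 𝓘(ℝ, E) 1 M]

/-- The momentum map `ρ* : T*M → 𝔱*`, `⟨ρ*(ξ), v⟩ = ξ(ρ_v(p(ξ)))`. -/
def momentum (T : Type*) [TopologicalSpace T] [ChartedSpace F T] [Group T] [MulAction T M]
    (ξ : CotangentBundle E M) : F →L[ℝ] ℝ :=
  ξ.2.comp (infinitesimalAction (F := F) (T := T) ξ.1)

/-- The map `q = (ρ*, p) : T*M → 𝔱* × M`. -/
def momentumProj (T : Type*) [TopologicalSpace T] [ChartedSpace F T] [Group T] [MulAction T M]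
    (ξ : CotangentBundle E M) : (F →L[ℝ] ℝ) × M :=
  (momentum T ξ, ξ.1)

/-- `B_ξ = exp (½ #_Π ρ*ξ)`. -/
def halfFlow [FiniteDimensional ℝ F] [Group T] [MulAction T M]
    (P : ⋀[ℝ]^2 (GroupLieAlgebra 𝓘(ℝ, F) T)) (ξ : CotangentBundle E M) : T :=
  coalgebraAction P ((1 / 2 : ℝ) • momentum T ξ)

/-- The transport `g^* η` of a covector `η ∈ T*_y M` to the point `g y` by the diffeomorphism `g`,
that is, `η` composed with the inverse of `T_y g`, which is the derivative of `g⁻¹` at `g y`. -/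
def covectorTransport [Group T] [MulAction T M] (g : T) (η : CotangentBundle E M) :
    CotangentBundle E M :=
  ⟨g • η.1, (inv_smul_smul g η.1 ▸ η.2 : CotangentSpace E M (g⁻¹ • (g • η.1))).comp
    (mfderiv 𝓘(ℝ, E) 𝓘(ℝ, E) (fun y : M => g⁻¹ • y) (g • η.1))⟩

/-- The groupoid structure maps on `T*M`. -/
def cotangentGroupoid [FiniteDimensional ℝ F] [Group T] [MulAction T M]
    (P : ⋀[ℝ]^2 (GroupLieAlgebra 𝓘(ℝ, F) T)) : GroupoidMaps (CotangentBundle E M) M where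
  source ξ := halfFlow P (cotangentNeg ξ) • ξ.1
  target ξ := halfFlow P ξ • ξ.1
  unit x := ⟨x, 0⟩
  inv ξ := cotangentNeg ξ
  mul ξ ζ := cotangentAdd (covectorTransport (halfFlow P ξ) ζ)
    (covectorTransport (halfFlow P (cotangentNeg ζ)) ξ)

end Abelian

end AbelianPoisson

end

open AbelianPoisson

/-!
The idea is to describe the groupoid `T*M` by the maps `A_c(ξ) = R_{cρ*ξ}^* ξ` of `T*M` to itself
(`momentumFlow`). As `T` is commutative, the momentum map `ρ*` is invariant under `T`
(`momentum_covectorTransport`), so that `A_c A_d = A_{c+d}` and every `A_c` is a diffeomorphism. The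
source and target maps are `p ∘ A_{-1/2}` and `p ∘ A_{1/2}`; hence they are surjective submersions,
and the source fibres are diffeomorphic to the cotangent spaces. Putting `ξ = A_{1/2} ξ'` and
`ζ = A_{-1/2} ζ'`, a composable pair is a pair of covectors `ξ', ζ'` at the same point, and
`ξ · ζ = R_{(ρ*ξ' - ρ*ζ')/2}^* (ξ' + ζ')` (`mul_momentumFlow`). The groupoid axioms, and those of
`𝔱* ⋉ M`, reduce to the facts that `ρ*(ξ · ζ) = ρ*ξ + ρ*ζ` and that `u ↦ R_u` is a smooth
homomorphism; the latter holds because `exp` is one for a commutative group (`lieExp_add`,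
`contMDiff_lieExp`).

The symplectic statements rest on one formula, for a family `w ↦ R_{r(w)}^* σ(w)` of covectors:
the Liouville form is invariant under `T`, so its pullback by this family is `σ^*θ + Π(dr, ρ*σ)`
(`liouvillePullback_covectorTransport`), and taking exterior derivatives gives the pullback of `ω`
(`canonicalForm_covectorTransport`). In particular `A_c^* ω = ω + 2c (ρ*)^* Π`, where `Π` is viewed
as a constant `2`-form on `𝔱*` (`modelSymplectic_momentumFlow`). For the product, `ω` is additive
in covectors at the same point and the remaining terms in `Π` cancel by antisymmetry
(`modelSymplectic_multiplicative`).

For the target map `t = p ∘ A_{1/2}`, the image `Y` under `A_{1/2}` of the Hamiltonian vector of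
`h ∘ t` satisfies `ω(Y, ·) - Π(dρ*(Y), dρ*(·)) = dh ∘ Tp`. The infinitesimal generators of the
action of `R` on `T*M` are the Hamiltonian vectors of the components of `ρ*`
(`modelSymplectic_coalgebraVelocity`); comparing `Y` with them gives
`dg(Tp Y) = Π(dg ∘ ρ, dh ∘ ρ) = {g, h}` (`apply_fst_of_forall_modelSymplectic`).

Finally, pulling functions back along `v ↦ exp(v) x` turns the bracket of `π = ρ(Π)` into that of
the constant bivector `Π` on the vector space `𝔱` (`orbitPullback_bivectorBracket`), where the
Jacobi identity is the symmetry of second derivatives (`fderiv_sharpCLM_jacobi`).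
-/

namespace AbelianPoisson

open Bundle

set_option linter.unusedSectionVars false

/-! ### Bivectors on a vector space -/

section BivectorAlgebra

variable {V W : Type*} [AddCommGroup V] [Module ℝ V] [AddCommGroup W] [Module ℝ W]

theorem bivectorPairing_swap (P : ⋀[ℝ]^2 V) (α β : Module.Dual ℝ V) :
    bivectorPairing P α β = -bivectorPairing P β α := by
  have h := (exteriorPower.ιMulti ℝ 2 (M := Module.Dual ℝ V)).map_swap ![β, α]
    (i := 0) (j := 1) (by simp)
  have e : (![β, α] ∘ Equiv.swap (0 : Fin 2) 1) = ![α, β] := by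
    ext i; fin_cases i <;> simp
  rw [e] at h
  simp [bivectorPairing, h]

theorem bivectorPairing_map (f : V →ₗ[ℝ] W) (P : ⋀[ℝ]^2 V) (α β : Module.Dual ℝ W) :
    bivectorPairing (exteriorPower.map 2 f P) α β =
      bivectorPairing P (α ∘ₗ f) (β ∘ₗ f) := by
  have h : (exteriorPower.pairingDual ℝ W 2 (exteriorPower.ιMulti ℝ 2 ![α, β])) ∘ₗ
      exteriorPower.map 2 f =
      exteriorPower.pairingDual ℝ V 2 (exteriorPower.ιMulti ℝ 2 ![α ∘ₗ f, β ∘ₗ f]) := by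
    ext v
    simp [Matrix.det_fin_two]
  exact LinearMap.congr_fun h P

end BivectorAlgebra

section SharpMap

variable {F : Type*} [NormedAddCommGroup F] [NormedSpace ℝ F] [FiniteDimensional ℝ F]

/-- The sharp map `#_P` of a bivector, as a continuous linear map on the normed dual. -/
noncomputable def sharpCLM (P : ⋀[ℝ]^2 F) : (F →L[ℝ] ℝ) →L[ℝ] F :=
  LinearMap.toContinuousLinearMap
    { toFun := fun u => sharp P (u : F →ₗ[ℝ] ℝ)
      map_add' := fun u v => by
        refine (Module.evalEquiv ℝ F).injective (LinearMap.ext fun β => ?_)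
        change β _ = β _
        rw [map_add, apply_sharp, apply_sharp, apply_sharp, bivectorPairing_swap,
          bivectorPairing_swap P u, bivectorPairing_swap P v]
        have := (bivectorContract P β).map_add (u : F →ₗ[ℝ] ℝ) (v : F →ₗ[ℝ] ℝ)
        change bivectorPairing P β _ = bivectorPairing P β _ + bivectorPairing P β _ at this
        rw [ContinuousLinearMap.toLinearMap_add, this, neg_add]
      map_smul' := fun c u => by
        refine (Module.evalEquiv ℝ F).injective (LinearMap.ext fun β => ?_)
        change β _ = β _
        rw [map_smul, apply_sharp, RingHom.id_apply, apply_sharp, bivectorPairing_swap,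
          bivectorPairing_swap P u]
        have := (bivectorContract P β).map_smul c (u : F →ₗ[ℝ] ℝ)
        change bivectorPairing P β _ = c • bivectorPairing P β _ at this
        rw [ContinuousLinearMap.toLinearMap_smul, this, smul_neg] }

theorem apply_sharpCLM (P : ⋀[ℝ]^2 F) (u v : F →L[ℝ] ℝ) :
    v (sharpCLM P u) = bivectorPairing P u v :=
  apply_sharp P (u : F →ₗ[ℝ] ℝ) (v : F →ₗ[ℝ] ℝ)

theorem apply_sharpCLM_swap (P : ⋀[ℝ]^2 F) (u v : F →L[ℝ] ℝ) :
    v (sharpCLM P u) = -u (sharpCLM P v) := by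
  rw [apply_sharpCLM, apply_sharpCLM, bivectorPairing_swap]

end SharpMap

/-! ### The exponential map of a commutative Lie group -/

section IntegralCurves
variable {E : Type*} [NormedAddCommGroup E] [NormedSpace ℝ E]
  {M : Type*} [TopologicalSpace M] [ChartedSpace E M] [IsManifold 𝓘(ℝ, E) ∞ M]

/-- Integral curves of smooth vector fields are smooth. -/
theorem contMDiff_of_isMIntegralCurve {v : (x : M) → TangentSpace 𝓘(ℝ, E) x}
    (hv : ContMDiff 𝓘(ℝ, E) 𝓘(ℝ, E).tangent ∞ (fun x => (⟨x, v x⟩ : TangentBundle 𝓘(ℝ, E) M)))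
    {γ : ℝ → M} (hγ : IsMIntegralCurve γ v) : ContMDiff 𝓘(ℝ, ℝ) 𝓘(ℝ, E) ∞ γ := by
  -- Bootstrapping: if `γ` is `C^n`, then so is its derivative `t ↦ v (γ t)`.
  have key : ∀ n : ℕ, ContMDiff 𝓘(ℝ, ℝ) 𝓘(ℝ, E) n γ := by
    intro n
    induction n with
    | zero => exact contMDiff_zero_iff.2 hγ.continuous
    | succ n ih =>
      intro t₀
      rw [contMDiffAt_iff_target]
      refine ⟨hγ.continuous.continuousAt, ?_⟩
      rw [contMDiffAt_iff_contDiffAt]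
      have h2 : ContMDiffAt 𝓘(ℝ, ℝ) 𝓘(ℝ, E).tangent n
          (fun t => (⟨γ t, v (γ t)⟩ : TangentBundle 𝓘(ℝ, E) M)) t₀ :=
        ((hv.of_le (by exact_mod_cast le_top)).comp ih) t₀
      have h3 := (Bundle.contMDiffAt_totalSpace.1 h2).2
      rw [contMDiffAt_iff_contDiffAt] at h3
      have h1 := (hγ.isMIntegralCurveAt t₀).eventually_hasDerivAt
      have h4 : ContDiffAt ℝ ((n : WithTop ℕ∞) + 1) (extChartAt 𝓘(ℝ, E) (γ t₀) ∘ γ) t₀ := by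
        rw [contDiffAt_succ_iff_hasFDerivAt]
        exact ⟨fun t => ContinuousLinearMap.toSpanSingleton ℝ
          (tangentCoordChange 𝓘(ℝ, E) (γ t) (γ t₀) (γ t) (v (γ t))),
          Filter.eventually_iff_exists_mem.1 (h1.mono fun t ht => ht.hasFDerivAt),
          (ContinuousLinearMap.toSpanSingletonCLE (𝕜 := ℝ) (E := E)).contDiff.contDiffAt.comp t₀ h3⟩
      exact_mod_cast h4
  exact contMDiff_infty.2 key

end IntegralCurves

section Exponential

variable {F : Type*} [NormedAddCommGroup F] [NormedSpace ℝ F]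
  {T : Type*} [TopologicalSpace T] [ChartedSpace F T] [CommGroup T] [LieGroup 𝓘(ℝ, F) ∞ T]

/-- Invariant vector fields on a smooth Lie group are smooth: they are the values of the tangent
map of the multiplication on the pairs `(0_g, v)`. -/
theorem contMDiff_infty_mulInvariantVectorField (v : GroupLieAlgebra 𝓘(ℝ, F) T) :
    ContMDiff 𝓘(ℝ, F) 𝓘(ℝ, F).tangent ∞
      (fun g : T => (⟨g, mulInvariantVectorField v g⟩ : TangentBundle 𝓘(ℝ, F) T)) := by
  have h1 : ContMDiff 𝓘(ℝ, F) 𝓘(ℝ, F).tangent ∞ (fun g : T => TotalSpace.mk' F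
      (E := TangentSpace 𝓘(ℝ, F)) g 0) := contMDiff_zeroSection _ _
  have h2 : ContMDiff 𝓘(ℝ, F) 𝓘(ℝ, F).tangent ∞ (fun _ : T => TotalSpace.mk' F
      (E := (TangentSpace 𝓘(ℝ, F) : T → Type _)) 1 v) := contMDiff_const
  have h3 := ((contMDiff_mul 𝓘(ℝ, F) (∞) (G := T)).contMDiff_tangentMap (m := ∞) (by simp)).comp
    (contMDiff_equivTangentBundleProd_symm.comp (h1.prodMk h2))
  have hd : MDifferentiable (𝓘(ℝ, F).prod 𝓘(ℝ, F)) 𝓘(ℝ, F) (fun p : T × T => p.1 * p.2) :=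
    (contMDiff_mul 𝓘(ℝ, F) (∞) (G := T)).mdifferentiable (by simp)
  refine h3.congr fun g => TotalSpace.ext (mul_one g).symm (heq_of_eq ?_)
  refine Eq.trans ?_ (mfderiv_prod_eq_add_apply (I := 𝓘(ℝ, F)) (I' := 𝓘(ℝ, F))
    (hd (g, 1)) (v := ((0 : F), (v : F)))).symm
  exact ((congrArg (fun z : F => z + (show F from mulInvariantVectorField (I := 𝓘(ℝ, F)) v g))
    (map_zero _)).trans
    (zero_add _)).symm

theorem mfderiv_mul_left_mulInvariantVectorField (v : GroupLieAlgebra 𝓘(ℝ, F) T) (g h : T) :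
    mfderiv 𝓘(ℝ, F) 𝓘(ℝ, F) (fun x : T => g * x) h (mulInvariantVectorField v h) =
      mulInvariantVectorField v (g * h) := by
  have hd : ∀ g : T, MDifferentiable 𝓘(ℝ, F) 𝓘(ℝ, F) (fun x : T => g * x) := fun g =>
    (contMDiff_mul_left (I := 𝓘(ℝ, F)) (n := ∞)).mdifferentiable (by simp)
  have h2 : (fun x : T => (g * h) * x) = (fun x : T => g * x) ∘ (fun x : T => h * x) := by
    ext x; simp [mul_assoc]
  have h1 := mfderiv_comp_apply_of_eq (x := (1 : T)) (hd g h) (hd h 1) (mul_one h) v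
  rw [← h2] at h1
  exact h1.symm

variable [CompleteSpace F] [T2Space T]

theorem exists_isMIntegralCurve_mulInvariantVectorField (v : GroupLieAlgebra 𝓘(ℝ, F) T) :
    ∃ γ : ℝ → T, γ 0 = 1 ∧ IsMIntegralCurve (I := 𝓘(ℝ, F)) γ (mulInvariantVectorField v) := by
  have hv := (contMDiff_infty_mulInvariantVectorField (T := T) v).of_le
    (show (1 : WithTop ℕ∞) ≤ ∞ by exact_mod_cast le_top)
  obtain ⟨γ, h0, hγ⟩ := exists_isMIntegralCurveAt_of_contMDiffAt_boundaryless 0 (hv (1 : T))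
  obtain ⟨ε, hε, hγ⟩ := isMIntegralCurveAt_iff'.1 hγ
  -- Left translates of one short integral curve give integral curves of uniform length.
  refine exists_isMIntegralCurve_of_isMIntegralCurveOn hv hε (fun g => ⟨fun t => g * γ t,
    by simp [h0], fun t ht => ?_⟩) 1
  rw [Real.ball_eq_Ioo, zero_sub, zero_add] at hγ
  have hd : MDifferentiable 𝓘(ℝ, F) 𝓘(ℝ, F) (fun x : T => g * x) :=
    (contMDiff_mul_left (I := 𝓘(ℝ, F)) (n := ∞)).mdifferentiable (by simp)
  have h := (hd (γ t)).hasMFDerivAt.comp_hasMFDerivWithinAt t (hγ t ht)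
  refine h.congr_mfderiv (ContinuousLinearMap.ext fun (s : ℝ) => ?_)
  exact (map_smul _ s _).trans
    (congrArg (fun z : F => s • z) (mfderiv_mul_left_mulInvariantVectorField v g (γ t)))

/-- The integral curve of an invariant vector field through `1` is `t ↦ exp (t v)`. -/
theorem eq_lieExp_of_isMIntegralCurve {v : GroupLieAlgebra 𝓘(ℝ, F) T} {γ : ℝ → T} (h0 : γ 0 = 1)
    (hγ : IsMIntegralCurve (I := 𝓘(ℝ, F)) γ (mulInvariantVectorField v)) (t : ℝ) :
    γ t = lieExp (t • v) := by
  have hv := fun v : GroupLieAlgebra 𝓘(ℝ, F) T =>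
    (contMDiff_infty_mulInvariantVectorField (T := T) v).of_le
    (show (1 : WithTop ℕ∞) ≤ ∞ by exact_mod_cast le_top)
  have hγ' := hγ.comp_mul t
  have e : (t • mulInvariantVectorField v : (g : T) → TangentSpace 𝓘(ℝ, F) g) =
      mulInvariantVectorField (t • v) := by
    ext g
    exact (map_smul (mfderiv 𝓘(ℝ, F) 𝓘(ℝ, F) (fun x : T => g * x) 1) t v).symm
  rw [e] at hγ'
  have hex : ∃ γ : ℝ → T, γ 0 = 1 ∧
      IsMIntegralCurve (I := 𝓘(ℝ, F)) γ (mulInvariantVectorField (t • v)) :=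
    ⟨γ ∘ (· * t), by simpa using h0, hγ'⟩
  rw [lieExp, dif_pos hex, ← isMIntegralCurve_Ioo_eq_of_contMDiff_boundaryless (t₀ := 0) (hv _) hγ'
    hex.choose_spec.2 (by simp [h0, hex.choose_spec.1])]
  simp

theorem isMIntegralCurve_lieExp (v : GroupLieAlgebra 𝓘(ℝ, F) T) :
    IsMIntegralCurve (I := 𝓘(ℝ, F)) (fun t : ℝ => (lieExp (t • v) : T))
      (mulInvariantVectorField v) := by
  obtain ⟨γ, h0, hγ⟩ := exists_isMIntegralCurve_mulInvariantVectorField (T := T) v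
  rwa [funext (eq_lieExp_of_isMIntegralCurve h0 hγ)] at hγ

theorem lieExp_zero : lieExp (0 : GroupLieAlgebra 𝓘(ℝ, F) T) = (1 : T) := by
  obtain ⟨γ, h0, hγ⟩ := exists_isMIntegralCurve_mulInvariantVectorField (T := T)
    (0 : GroupLieAlgebra 𝓘(ℝ, F) T)
  have := eq_lieExp_of_isMIntegralCurve h0 hγ 0
  rw [smul_zero, h0] at this
  exact this.symm

/-- In a commutative group the product of the integral curves of `v` and `w` is an integral curve
of `v + w`. -/
theorem lieExp_add (v w : GroupLieAlgebra 𝓘(ℝ, F) T) :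
    (lieExp (v + w) : T) = lieExp v * lieExp w := by
  have hd : MDifferentiable (𝓘(ℝ, F).prod 𝓘(ℝ, F)) 𝓘(ℝ, F) (fun p : T × T => p.1 * p.2) :=
    (contMDiff_mul 𝓘(ℝ, F) (∞) (G := T)).mdifferentiable (by simp)
  have h : IsMIntegralCurve (I := 𝓘(ℝ, F)) (fun t : ℝ => (lieExp (t • v) * lieExp (t • w) : T))
      (mulInvariantVectorField (v + w)) := by
    intro t
    set a : T := lieExp (t • v)
    set b : T := lieExp (t • w)
    have h1 := (hd (a, b)).hasMFDerivAt.comp t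
      ((isMIntegralCurve_lieExp v t).prodMk (isMIntegralCurve_lieExp w t))
    refine h1.congr_mfderiv (ContinuousLinearMap.ext fun (s : ℝ) => ?_)
    let p : F × F := (mulInvariantVectorField (I := 𝓘(ℝ, F)) v a, mulInvariantVectorField w b)
    have h2 := mfderiv_prod_eq_add_apply (I := 𝓘(ℝ, F)) (I' := 𝓘(ℝ, F)) (hd (a, b)) (v := p)
    have h3 := mfderiv_mul_left_mulInvariantVectorField w a b
    have h4 := mfderiv_mul_left_mulInvariantVectorField v b a
    have h5 : (fun z : T => z * b) = fun z => b * z := by ext z; exact mul_comm _ _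
    rw [mul_comm b a, ← h5] at h4
    have h6 : mulInvariantVectorField (I := 𝓘(ℝ, F)) (v + w) (a * b) =
        mulInvariantVectorField v (a * b) + mulInvariantVectorField w (a * b) := map_add _ _ _
    refine (map_smul (mfderiv (𝓘(ℝ, F).prod 𝓘(ℝ, F)) 𝓘(ℝ, F) (fun p : T × T => p.1 * p.2) (a, b))
      s p).trans (congrArg (fun z : F => s • z) ?_)
    exact h2.trans ((congrArg₂ (fun x y : F => x + y) h4 h3).trans h6.symm)
  have := eq_lieExp_of_isMIntegralCurve (by simp [lieExp_zero]) h 1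
  simpa using this.symm

theorem lieExp_sum {ι : Type*} (s : Finset ι) (v : ι → GroupLieAlgebra 𝓘(ℝ, F) T) :
    (lieExp (∑ i ∈ s, v i) : T) = ∏ i ∈ s, lieExp (v i) := by
  classical
  induction s using Finset.induction_on with
  | empty => simpa using lieExp_zero
  | insert i s hi ih => rw [Finset.sum_insert hi, Finset.prod_insert hi, lieExp_add, ih]

end Exponential

section ExponentialSmooth

variable {F : Type*} [NormedAddCommGroup F] [NormedSpace ℝ F] [FiniteDimensional ℝ F]
  {T : Type*} [TopologicalSpace T] [ChartedSpace F T] [CommGroup T] [LieGroup 𝓘(ℝ, F) ∞ T]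
  [T2Space T]

variable (F T) in
/-- In a basis `(e_i)` the exponential map of a commutative group is the product of the smooth
one-parameter subgroups `t ↦ exp (t e_i)`, so that it is smooth. -/
theorem contMDiff_lieExp : ContMDiff 𝓘(ℝ, F) 𝓘(ℝ, F) ∞
    (fun v : F => (lieExp (v : GroupLieAlgebra 𝓘(ℝ, F) T) : T)) := by
  have := FiniteDimensional.complete ℝ F
  let b := Module.finBasis ℝ F
  have h : (fun v : F => (lieExp (v : GroupLieAlgebra 𝓘(ℝ, F) T) : T)) =
      fun v => ∏ i, (lieExp (b.repr v i • b i : GroupLieAlgebra 𝓘(ℝ, F) T) : T) := by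
    ext v
    conv_lhs => rw [← b.sum_repr v]
    exact lieExp_sum (T := T) _ _
  rw [h]
  refine contMDiff_finsetProd fun i _ => ?_
  have h1 := contMDiff_of_isMIntegralCurve (contMDiff_infty_mulInvariantVectorField (T := T) (b i))
    (isMIntegralCurve_lieExp (T := T) (b i))
  have h2 : ContMDiff 𝓘(ℝ, F) 𝓘(ℝ, ℝ) ∞ (fun v : F => b.repr v i) :=
    (LinearMap.toContinuousLinearMap (b.coord i)).contMDiff
  exact h1.comp h2

theorem mfderiv_lieExp_zero (v : F) : mfderiv 𝓘(ℝ, F) 𝓘(ℝ, F)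
    (fun v : F => (lieExp (v : GroupLieAlgebra 𝓘(ℝ, F) T) : T)) 0 v = v := by
  have := FiniteDimensional.complete ℝ F
  have hd : MDifferentiable 𝓘(ℝ, F) 𝓘(ℝ, F)
      (fun v : F => (lieExp (v : GroupLieAlgebra 𝓘(ℝ, F) T) : T)) :=
    (contMDiff_lieExp F T).mdifferentiable (by simp)
  have h1 := isMIntegralCurve_lieExp (T := T) v 0
  have h2 : HasMFDerivAt 𝓘(ℝ, ℝ) 𝓘(ℝ, F) (fun t : ℝ => t • v) 0
      ((1 : ℝ →L[ℝ] ℝ).smulRight v) :=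
    ((1 : ℝ →L[ℝ] ℝ).smulRight v).hasMFDerivAt
  have h3 := (hd ((0 : ℝ) • v)).hasMFDerivAt.comp (0 : ℝ) h2
  have h4 := hasMFDerivAt_unique h3 h1
  have h5 := congrArg (fun A : ℝ →L[ℝ] F => A 1) h4
  let f : F → F →L[ℝ] F := fun w => mfderiv 𝓘(ℝ, F) 𝓘(ℝ, F)
    (fun v : F => (lieExp (v : GroupLieAlgebra 𝓘(ℝ, F) T) : T)) w
  let g : T → F := fun x => mulInvariantVectorField (I := 𝓘(ℝ, F)) v x
  have h6 : f ((0 : ℝ) • v) ((1 : ℝ) • v) =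
    (1 : ℝ) • g (lieExp ((0 : ℝ) • v : GroupLieAlgebra 𝓘(ℝ, F) T)) := h5
  have e0 : (lieExp (0 : GroupLieAlgebra 𝓘(ℝ, F) T) : T) = 1 := lieExp_zero
  have e1 : (fun x : T => 1 * x) = id := by ext x; simp
  have e2 : g 1 = v := by
    change mfderiv 𝓘(ℝ, F) 𝓘(ℝ, F) (fun x : T => 1 * x) 1 v = v
    rw [e1, mfderiv_id]
    rfl
  rw [one_smul, one_smul, zero_smul] at h6
  refine h6.trans (Eq.trans ?_ e2)
  exact congrArg g e0

end ExponentialSmooth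

section CoalgebraAction

variable {F : Type*} [NormedAddCommGroup F] [NormedSpace ℝ F] [FiniteDimensional ℝ F]
  {T : Type*} [TopologicalSpace T] [ChartedSpace F T] [CommGroup T] [LieGroup 𝓘(ℝ, F) ∞ T]
  [T2Space T] (P : ⋀[ℝ]^2 (GroupLieAlgebra 𝓘(ℝ, F) T))

theorem coalgebraAction_zero : coalgebraAction P 0 = 1 := by
  have := FiniteDimensional.complete ℝ F
  exact (congrArg lieExp (map_zero (sharpCLM (F := F) P))).trans lieExp_zero

theorem coalgebraAction_add (u v : F →L[ℝ] ℝ) :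
    coalgebraAction P (u + v) = coalgebraAction P u * coalgebraAction P v := by
  have := FiniteDimensional.complete ℝ F
  exact (congrArg lieExp (map_add (sharpCLM (F := F) P) u v)).trans (lieExp_add _ _)

theorem contMDiff_coalgebraAction :
    ContMDiff 𝓘(ℝ, F →L[ℝ] ℝ) 𝓘(ℝ, F) ∞ (coalgebraAction P) :=
  (contMDiff_lieExp F T).comp (sharpCLM (F := F) P).contMDiff

theorem mfderiv_coalgebraAction_zero (u : F →L[ℝ] ℝ) :
    mfderiv 𝓘(ℝ, F →L[ℝ] ℝ) 𝓘(ℝ, F) (coalgebraAction P) 0 u = sharpCLM (F := F) P u := by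
  have h := mfderiv_comp_apply_of_eq (x := (0 : F →L[ℝ] ℝ)) (y := (0 : F))
    (((contMDiff_lieExp F T).mdifferentiable (by simp)) 0)
    ((sharpCLM (F := F) P).contMDiff (n := 1) |>.mdifferentiable (by simp) 0)
    (map_zero _) u
  rw [(sharpCLM (F := F) P).mfderiv_eq] at h
  exact h.trans (mfderiv_lieExp_zero _)

end CoalgebraAction

/-! ### Coordinates on the cotangent bundle -/

section CotangentCoordinates

variable {E : Type*} [NormedAddCommGroup E] [NormedSpace ℝ E]
  {M : Type*} [TopologicalSpace M] [ChartedSpace E M] [IsManifold 𝓘(ℝ, E) ∞ M]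

/-- The coordinates of a covector in the trivialization of the cotangent bundle at `x₀`. -/
noncomputable def covectorCoord (x₀ : M) (ξ : CotangentBundle E M) : E →L[ℝ] ℝ :=
  ξ.2.comp ((trivializationAt E (TangentSpace 𝓘(ℝ, E)) x₀).symmL ℝ ξ.1)

theorem trivializationAt_cotangent_apply (x₀ : M) (ξ : CotangentBundle E M) :
    trivializationAt (E →L[ℝ] ℝ) (CotangentSpace E M) x₀ ξ = (ξ.1, covectorCoord x₀ ξ) := by
  refine Prod.ext rfl (ContinuousLinearMap.ext fun v => ?_)
  change (Trivial.trivialization M ℝ).continuousLinearMapAt ℝ ξ.1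
    (ξ.2 ((trivializationAt E (TangentSpace 𝓘(ℝ, E)) x₀).symmL ℝ ξ.1 v)) = _
  rw [Trivial.continuousLinearMapAt_trivialization]
  rfl

theorem contMDiffWithinAt_cotangentBundle_iff {EN : Type*} [NormedAddCommGroup EN]
    [NormedSpace ℝ EN] {HN : Type*} [TopologicalSpace HN] {J : ModelWithCorners ℝ EN HN}
    {N : Type*} [TopologicalSpace N] [ChartedSpace HN N] {f : N → CotangentBundle E M}
    {s : Set N} {n₀ : N} :
    ContMDiffWithinAt J (cotangentModel E) ∞ f s n₀ ↔
      ContMDiffWithinAt J 𝓘(ℝ, E) ∞ (fun n => (f n).1) s n₀ ∧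
      ContMDiffWithinAt J 𝓘(ℝ, E →L[ℝ] ℝ) ∞ (fun n => covectorCoord (f n₀).1 (f n)) s n₀ := by
  rw [contMDiffWithinAt_totalSpace]
  simp only [trivializationAt_cotangent_apply]

theorem extChartAt_cotangent_apply (ξ₀ ξ : CotangentBundle E M) :
    extChartAt (cotangentModel E) ξ₀ ξ = (extChartAt 𝓘(ℝ, E) ξ₀.1 ξ.1, covectorCoord ξ₀.1 ξ) := by
  rw [FiberBundle.extChartAt]
  simp [trivializationAt_cotangent_apply]

theorem mem_extChartAt_cotangent_source {ξ₀ ξ : CotangentBundle E M} :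
    ξ ∈ (extChartAt (cotangentModel E) ξ₀).source ↔ ξ.1 ∈ (extChartAt 𝓘(ℝ, E) ξ₀.1).source := by
  rw [FiberBundle.extChartAt, PartialEquiv.trans_source]
  simp
  exact id

theorem extChartAt_cotangent_target (ξ₀ : CotangentBundle E M) :
    (extChartAt (cotangentModel E) ξ₀).target = (extChartAt 𝓘(ℝ, E) ξ₀.1).target ×ˢ univ := by
  rw [FiberBundle.extChartAt_target]
  ext z
  simp
  exact (chartAt E ξ₀.1).map_target

theorem extChartAt_cotangent_symm_proj {ξ₀ : CotangentBundle E M} {z : E × (E →L[ℝ] ℝ)}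
    (hz : z.1 ∈ (extChartAt 𝓘(ℝ, E) ξ₀.1).target) :
    ((extChartAt (cotangentModel E) ξ₀).symm z).1 = (extChartAt 𝓘(ℝ, E) ξ₀.1).symm z.1 := by
  have h : z ∈ (extChartAt (cotangentModel E) ξ₀).target := by
    rw [extChartAt_cotangent_target]; exact ⟨hz, mem_univ _⟩
  have h1 := (extChartAt (cotangentModel E) ξ₀).right_inv h
  have h2 := (extChartAt (cotangentModel E) ξ₀).map_target h
  rw [extChartAt_cotangent_apply] at h1
  rw [mem_extChartAt_cotangent_source] at h2
  rw [← (extChartAt 𝓘(ℝ, E) ξ₀.1).left_inv h2, ← congrArg Prod.fst h1]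

theorem covectorCoord_extChartAt_symm {ξ₀ : CotangentBundle E M} {z : E × (E →L[ℝ] ℝ)}
    (hz : z.1 ∈ (extChartAt 𝓘(ℝ, E) ξ₀.1).target) :
    covectorCoord ξ₀.1 ((extChartAt (cotangentModel E) ξ₀).symm z) = z.2 := by
  have h : z ∈ (extChartAt (cotangentModel E) ξ₀).target := by
    rw [extChartAt_cotangent_target]; exact ⟨hz, mem_univ _⟩
  have h1 := (extChartAt (cotangentModel E) ξ₀).right_inv h
  rw [extChartAt_cotangent_apply] at h1
  exact congrArg Prod.snd h1

theorem covectorCoord_mfderiv_extChartAt {x₀ : M} {ξ : CotangentBundle E M}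
    (hξ : ξ.1 ∈ (extChartAt 𝓘(ℝ, E) x₀).source) (v : TangentSpace 𝓘(ℝ, E) ξ.1) :
    covectorCoord x₀ ξ (mfderiv 𝓘(ℝ, E) 𝓘(ℝ, E) (extChartAt 𝓘(ℝ, E) x₀) ξ.1 v) = ξ.2 v := by
  have hξ' : ξ.1 ∈ (chartAt E x₀).source := by simpa using hξ
  have h := mfderivWithin_extChartAt_symm_comp_mfderiv_extChartAt' (I := 𝓘(ℝ, E)) hξ
  rw [covectorCoord, TangentBundle.symmL_trivializationAt hξ']
  exact congrArg ξ.2 (congrArg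
    (fun A : TangentSpace 𝓘(ℝ, E) ξ.1 →L[ℝ] TangentSpace 𝓘(ℝ, E) ξ.1 => A v) h)

end CotangentCoordinates

/-! ### The canonical symplectic form -/

section CanonicalForm

variable {E : Type*} [NormedAddCommGroup E] [NormedSpace ℝ E]
  {M : Type*} [TopologicalSpace M] [ChartedSpace E M] [IsManifold 𝓘(ℝ, E) ∞ M]
  {W : Type*} [NormedAddCommGroup W] [NormedSpace ℝ W]

variable (E M) in
theorem contMDiff_cotangent_proj :
    ContMDiff (cotangentModel E) 𝓘(ℝ, E) ∞ (fun η : CotangentBundle E M => η.1) :=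
  contMDiff_proj (CotangentSpace E M)

/-- The pullback `c^*θ` of the Liouville form by a map `c` on a vector space. -/
noncomputable def liouvillePullback (c : W → CotangentBundle E M) (w : W) : W →L[ℝ] ℝ :=
  (c w).2.comp (mfderiv 𝓘(ℝ, W) 𝓘(ℝ, E) (fun w => (c w).1) w)

/-- In the coordinates `(q, p)` of the cotangent bundle at `x₀`, `c^*θ = p dq`. -/
theorem liouvillePullback_eq_coord {c : W → CotangentBundle E M} {w : W} (x₀ : M)
    (hc : MDifferentiableAt 𝓘(ℝ, W) 𝓘(ℝ, E) (fun w => (c w).1) w)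
    (hw : (c w).1 ∈ (extChartAt 𝓘(ℝ, E) x₀).source) :
    liouvillePullback c w = (covectorCoord x₀ (c w)).comp
      (fderiv ℝ (fun w => extChartAt 𝓘(ℝ, E) x₀ (c w).1) w) := by
  ext δ
  have h1 := mfderiv_comp_apply (I' := 𝓘(ℝ, E)) w (mdifferentiableAt_extChartAt (I := 𝓘(ℝ, E))
    (by simpa using hw : (c w).1 ∈ (chartAt E x₀).source)) hc δ
  have h2 := covectorCoord_mfderiv_extChartAt hw
    (mfderiv 𝓘(ℝ, W) 𝓘(ℝ, E) (fun w => (c w).1) w δ)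
  rw [← mfderiv_eq_fderiv]
  exact h2.symm.trans (congrArg (covectorCoord x₀ (c w)) h1.symm)

theorem liouvilleForm_mfderiv {c : W → CotangentBundle E M} {w : W}
    (hc : MDifferentiableAt 𝓘(ℝ, W) (cotangentModel E) c w) (δ : Fin 1 → W) :
    liouvilleForm (c w) (fun i => mfderiv 𝓘(ℝ, W) (cotangentModel E) c w (δ i)) =
      liouvillePullback c w (δ 0) := by
  have h1 := mfderiv_comp_apply (I' := cotangentModel E) w
    ((contMDiff_cotangent_proj E M).mdifferentiable (by simp) (c w)) hc (δ 0)
  exact congrArg (c w).2 h1.symm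

/-- The form `p dq` on the model space of the cotangent bundle. -/
noncomputable def modelLiouville (z : E × (E →L[ℝ] ℝ)) : (E × (E →L[ℝ] ℝ)) [⋀^Fin 1]→L[ℝ] ℝ :=
  ContinuousAlternatingMap.ofSubsingleton ℝ (E × (E →L[ℝ] ℝ)) ℝ (0 : Fin 1)
    (z.2.comp (ContinuousLinearMap.fst ℝ E (E →L[ℝ] ℝ)))

theorem formInChart_liouvilleForm (ξ₀ : CotangentBundle E M) {z : E × (E →L[ℝ] ℝ)}
    (hz : z ∈ (extChartAt (cotangentModel E) ξ₀).target) :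
    formInChart liouvilleForm ξ₀ z = modelLiouville z := by
  have hz' := hz
  rw [extChartAt_cotangent_target] at hz'
  have hz1 := hz'.1
  ext δ
  have hd : MDifferentiableAt 𝓘(ℝ, E × (E →L[ℝ] ℝ)) (cotangentModel E)
      (extChartAt (cotangentModel E) ξ₀).symm z := by
    have := mdifferentiableWithinAt_extChartAt_symm (I := cotangentModel E) hz
    rwa [ModelWithCorners.range_eq_univ, mdifferentiableWithinAt_univ] at this
  have hp : MDifferentiableAt 𝓘(ℝ, E × (E →L[ℝ] ℝ)) 𝓘(ℝ, E)
      (fun w => ((extChartAt (cotangentModel E) ξ₀).symm w).1) z :=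
    MDifferentiableAt.comp (I' := cotangentModel E) z
      ((contMDiff_cotangent_proj E M).mdifferentiable (by simp) _) hd
  have h1 : ((extChartAt (cotangentModel E) ξ₀).symm z).1 ∈ (extChartAt 𝓘(ℝ, E) ξ₀.1).source := by
    rw [extChartAt_cotangent_symm_proj hz1]
    exact (extChartAt 𝓘(ℝ, E) ξ₀.1).map_target hz1
  have h2 := liouvilleForm_mfderiv hd δ
  rw [liouvillePullback_eq_coord ξ₀.1 hp h1, covectorCoord_extChartAt_symm hz1] at h2
  have h3 : (fun w : E × (E →L[ℝ] ℝ) => extChartAt 𝓘(ℝ, E) ξ₀.1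
      ((extChartAt (cotangentModel E) ξ₀).symm w).1) =ᶠ[𝓝 z] Prod.fst := by
    filter_upwards [(continuous_fst.continuousAt).preimage_mem_nhds
      ((isOpen_extChartAt_target (I := 𝓘(ℝ, E)) ξ₀.1).mem_nhds hz1)] with w hw
    rw [extChartAt_cotangent_symm_proj hw, (extChartAt 𝓘(ℝ, E) ξ₀.1).right_inv hw]
  rw [h3.fderiv_eq, fderiv_fst] at h2
  refine Eq.trans ?_ h2
  rw [← mfderivWithin_univ, ← ModelWithCorners.range_eq_univ (cotangentModel E)]
  rfl

theorem differentiableAt_ofSubsingleton {V : Type*} [NormedAddCommGroup V] [NormedSpace ℝ V]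
    {f : W → V →L[ℝ] ℝ} {w : W} (hf : DifferentiableAt ℝ f w) :
    DifferentiableAt ℝ
      (fun w => ContinuousAlternatingMap.ofSubsingleton ℝ V ℝ (0 : Fin 1) (f w)) w :=
  (ContinuousAlternatingMap.ofSubsingletonLIE (𝕜 := ℝ) (E := V) (F := ℝ)
    (0 : Fin 1)).differentiable.differentiableAt.comp w hf

theorem extDeriv_modelLiouville (z : E × (E →L[ℝ] ℝ)) (a b : E × (E →L[ℝ] ℝ)) :
    extDeriv modelLiouville z ![a, b] = a.2 b.1 - b.2 a.1 := by
  have hd : DifferentiableAt ℝ (modelLiouville (E := E)) z :=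
    differentiableAt_ofSubsingleton (by fun_prop)
  have h1 : ∀ (v : E) , fderiv ℝ (fun z : E × (E →L[ℝ] ℝ) => z.2 v) z =
      (ContinuousLinearMap.apply ℝ ℝ v).comp (ContinuousLinearMap.snd ℝ E (E →L[ℝ] ℝ)) := fun v =>
    ((ContinuousLinearMap.apply ℝ ℝ v).comp (ContinuousLinearMap.snd ℝ E (E →L[ℝ] ℝ))).fderiv
  have h2 : ∀ v : Fin 1 → E × (E →L[ℝ] ℝ), (fun z => modelLiouville z v) =
    fun z : E × (E →L[ℝ] ℝ) => z.2 (v 0).1 := fun v => rfl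
  rw [extDeriv_apply hd, Fin.sum_univ_two]
  simp only [h2, h1]
  simp [Fin.removeNth]
  ring

/-- In the coordinates `(q, p)` centred at `ξ` the canonical form is `∑ dqⁱ ∧ dpᵢ`. -/
theorem canonicalForm_apply (ξ : CotangentBundle E M) (a b : E × (E →L[ℝ] ℝ)) :
    (canonicalForm ξ : (E × (E →L[ℝ] ℝ)) [⋀^Fin 2]→L[ℝ] ℝ) ![a, b] = b.2 a.1 - a.2 b.1 := by
  have h1 : formInChart liouvilleForm ξ =ᶠ[𝓝 (extChartAt (cotangentModel E) ξ ξ)]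
      modelLiouville := by
    filter_upwards [(isOpen_extChartAt_target (I := cotangentModel E) ξ).mem_nhds
      (mem_extChartAt_target ξ)] with z hz
    exact formInChart_liouvilleForm ξ hz
  have h2 : canonicalForm ξ = -(extDeriv modelLiouville (extChartAt (cotangentModel E) ξ ξ)) := by
    rw [canonicalForm, Pi.neg_apply, mextDeriv, mfderiv_extChartAt_self,
      ModelWithCorners.range_eq_univ, extDerivWithin_univ, h1.extDeriv_eq]
    rfl
  have h3 := extDeriv_modelLiouville (extChartAt (cotangentModel E) ξ ξ) a b
  rw [h2]
  refine (congrArg Neg.neg h3).trans ?_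
  ring

/-- The identity `c^*ω = -d(c^*θ)`. -/
theorem canonicalForm_mfderiv {c : W → CotangentBundle E M} {w₀ : W}
    (hc : ContMDiffAt 𝓘(ℝ, W) (cotangentModel E) ∞ c w₀) :
    DifferentiableAt ℝ (liouvillePullback c) w₀ ∧ ∀ δ₁ δ₂ : W,
    canonicalForm (c w₀) ![mfderiv 𝓘(ℝ, W) (cotangentModel E) c w₀ δ₁,
      mfderiv 𝓘(ℝ, W) (cotangentModel E) c w₀ δ₂] =
      fderiv ℝ (liouvillePullback c) w₀ δ₂ δ₁ - fderiv ℝ (liouvillePullback c) w₀ δ₁ δ₂ := by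
  set f : W → E × (E →L[ℝ] ℝ) := fun w => extChartAt (cotangentModel E) (c w₀) (c w) with hf
  have hfs : ContDiffAt ℝ ∞ f w₀ := contMDiffAt_iff_contDiffAt.1 (contMDiffAt_iff_target.1 hc).2
  have hf1 : ContDiffAt ℝ ∞ (fun w => (f w).1) w₀ := hfs.fst
  have hf2 : ContDiffAt ℝ ∞ (fun w => (f w).2) w₀ := hfs.snd
  have hdc : MDifferentiableAt 𝓘(ℝ, W) (cotangentModel E) c w₀ := hc.mdifferentiableAt (by simp)
  -- In the chart at `c w₀` the derivative of `c` is that of `f`, as the derivative of this chart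
  -- at its centre is the identity.
  have hcf : ∀ δ : W, mfderiv 𝓘(ℝ, W) (cotangentModel E) c w₀ δ = fderiv ℝ f w₀ δ := by
    intro δ
    have h1 := mfderiv_comp_apply (I' := cotangentModel E) w₀
      (mdifferentiableAt_extChartAt (I := cotangentModel E) (mem_chart_source _ (c w₀))) hdc δ
    rw [mfderiv_extChartAt_self] at h1
    rw [← mfderiv_eq_fderiv]
    exact h1.symm
  have hev : liouvillePullback c =ᶠ[𝓝 w₀]
      fun w => (f w).2.comp (fderiv ℝ (fun w => (f w).1) w) := by
    have h1 : ContMDiffAt 𝓘(ℝ, W) (cotangentModel E) 1 c w₀ := hc.of_le (by simp)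
    have h2 := (contMDiffAt_iff_contMDiffAt_nhds (by simp)).1 h1
    filter_upwards [h2, hdc.continuousAt.preimage_mem_nhds
      (extChartAt_source_mem_nhds (I := cotangentModel E) (c w₀))] with w hw1 hw2
    have hp : MDifferentiableAt 𝓘(ℝ, W) 𝓘(ℝ, E) (fun w => (c w).1) w :=
      MDifferentiableAt.comp (I' := cotangentModel E) w
        ((contMDiff_cotangent_proj E M).mdifferentiable (by simp) _)
        (hw1.mdifferentiableAt (by simp))
    rw [liouvillePullback_eq_coord (c w₀).1 hp (mem_extChartAt_cotangent_source.1 hw2)]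
    simp only [hf, extChartAt_cotangent_apply]
  have hD : ContDiffAt ℝ ∞ (fderiv ℝ (fun w => (f w).1)) w₀ := hf1.fderiv_right (by simp)
  have hd2 := hf2.differentiableAt (by simp)
  have hdD := hD.differentiableAt (by simp)
  refine ⟨(hd2.clm_comp hdD).congr_of_eventuallyEq hev, fun δ₁ δ₂ => ?_⟩
  have hsymm := hf1.isSymmSndFDerivAt (by simpa using ENat.LEInfty.out)
  have e1 : fderiv ℝ (fun w => (f w).1) w₀ = (ContinuousLinearMap.fst ℝ _ _).comp (fderiv ℝ f w₀) :=
    (hfs.differentiableAt (by simp)).hasFDerivAt.fst.fderiv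
  have e2 : fderiv ℝ (fun w => (f w).2) w₀ = (ContinuousLinearMap.snd ℝ _ _).comp (fderiv ℝ f w₀) :=
    (hfs.differentiableAt (by simp)).hasFDerivAt.snd.fderiv
  rw [hcf, hcf]
  refine (canonicalForm_apply (c w₀) (fderiv ℝ f w₀ δ₁) (fderiv ℝ f w₀ δ₂)).trans ?_
  rw [hev.fderiv_eq, fderiv_clm_comp hd2 hdD, e2]
  simp [hsymm.eq δ₁ δ₂, e1]

end CanonicalForm

section SymplecticForm

variable {E : Type*} [NormedAddCommGroup E] [NormedSpace ℝ E]
  {M : Type*} [TopologicalSpace M] [ChartedSpace E M] [IsManifold 𝓘(ℝ, E) ∞ M]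
  {W : Type*} [NormedAddCommGroup W] [NormedSpace ℝ W]

theorem contMDiffAt_extChartAt_cotangent_symm {ξ₀ : CotangentBundle E M} {z : E × (E →L[ℝ] ℝ)}
    (hz : z ∈ (extChartAt (cotangentModel E) ξ₀).target) :
    ContMDiffAt 𝓘(ℝ, E × (E →L[ℝ] ℝ)) (cotangentModel E) ∞
      (extChartAt (cotangentModel E) ξ₀).symm z :=
  (contMDiffOn_extChartAt_symm ξ₀).contMDiffAt ((isOpen_extChartAt_target ξ₀).mem_nhds hz)

/-- In the chart at `ξ₀` the Liouville form is `p dq` near every point of the target. -/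
theorem liouvillePullback_extChartAt_symm {ξ₀ : CotangentBundle E M} {z : E × (E →L[ℝ] ℝ)}
    (hz : z ∈ (extChartAt (cotangentModel E) ξ₀).target) :
    liouvillePullback (extChartAt (cotangentModel E) ξ₀).symm z =
      z.2.comp (ContinuousLinearMap.fst ℝ E (E →L[ℝ] ℝ)) := by
  refine ContinuousLinearMap.ext fun δ => ?_
  have hd := (contMDiffAt_extChartAt_cotangent_symm hz).mdifferentiableAt (by simp)
  have h1 := congrArg (fun A => A ![δ]) (formInChart_liouvilleForm ξ₀ hz)
  have h2 := liouvilleForm_mfderiv hd ![δ]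
  refine Eq.trans h2.symm (Eq.trans ?_ h1)
  rw [← mfderivWithin_univ, ← ModelWithCorners.range_eq_univ (cotangentModel E)]
  rfl

variable (E) in
/-- The form `∑ dqⁱ ∧ dpᵢ` on the model space of the cotangent bundle. -/
noncomputable def modelSymplectic : (E × (E →L[ℝ] ℝ)) [⋀^Fin 2]→L[ℝ] ℝ :=
  -extDeriv modelLiouville 0

theorem modelSymplectic_apply (a b : E × (E →L[ℝ] ℝ)) :
    modelSymplectic E ![a, b] = b.2 a.1 - a.2 b.1 := by
  rw [modelSymplectic, ContinuousAlternatingMap.neg_apply, extDeriv_modelLiouville]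
  ring

theorem formInChart_canonicalForm {ξ₀ : CotangentBundle E M} {z : E × (E →L[ℝ] ℝ)}
    (hz : z ∈ (extChartAt (cotangentModel E) ξ₀).target) :
    formInChart canonicalForm ξ₀ z = modelSymplectic E := by
  have hc := contMDiffAt_extChartAt_cotangent_symm hz
  have hev : liouvillePullback (extChartAt (cotangentModel E) ξ₀).symm =ᶠ[𝓝 z]
      fun z => z.2.comp (ContinuousLinearMap.fst ℝ E (E →L[ℝ] ℝ)) := by
    filter_upwards [(isOpen_extChartAt_target (I := cotangentModel E) ξ₀).mem_nhds hz] with w hw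
    exact liouvillePullback_extChartAt_symm hw
  have hD : ∀ a b : E × (E →L[ℝ] ℝ),
      fderiv ℝ (liouvillePullback (extChartAt (cotangentModel E) ξ₀).symm) z a b = a.2 b.1 := by
    intro a b
    rw [hev.fderiv_eq, fderiv_clm_comp differentiableAt_snd (differentiableAt_const _)]
    simp [fderiv_snd]
  ext v
  obtain ⟨a, b, rfl⟩ : ∃ a b, v = ![a, b] := ⟨v 0, v 1, by ext i <;> fin_cases i <;> rfl⟩
  rw [modelSymplectic_apply, ← hD a b, ← hD b a, ← (canonicalForm_mfderiv hc).2 a b,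
    ← mfderivWithin_univ, ← ModelWithCorners.range_eq_univ (cotangentModel E)]
  refine congrArg (canonicalForm ((extChartAt (cotangentModel E) ξ₀).symm z)) ?_
  ext i : 1
  fin_cases i <;> rfl

theorem isSymplecticForm_canonicalForm :
    IsSymplecticForm (canonicalForm : DiffForm (cotangentModel E) 2 (CotangentBundle E M)) where
  smooth ξ₀ := (contDiffOn_const (c := modelSymplectic E)).congr
    fun z hz => formInChart_canonicalForm hz
  closed := by
    funext ξ
    have hev : formInChart canonicalForm ξ =ᶠ[𝓝 (extChartAt (cotangentModel E) ξ ξ)]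
        fun _ => modelSymplectic E := by
      filter_upwards [(isOpen_extChartAt_target (I := cotangentModel E) ξ).mem_nhds
        (mem_extChartAt_target ξ)] with z hz
      exact formInChart_canonicalForm hz
    have h0 : ∀ z : E × (E →L[ℝ] ℝ),
        extDeriv (fun _ : E × (E →L[ℝ] ℝ) => modelSymplectic E) z = 0 := by
      intro z
      ext v
      simp [extDeriv, ContinuousAlternatingMap.alternatizeUncurryFin_apply]
    rw [mextDeriv, ModelWithCorners.range_eq_univ, extDerivWithin_univ, hev.extDeriv_eq, h0]
    rfl
  nondegenerate ξ v hv := by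
    have h : ∀ w : E × (E →L[ℝ] ℝ), w.2 (show E × (E →L[ℝ] ℝ) from v).1 -
        (show E × (E →L[ℝ] ℝ) from v).2 w.1 = 0 := fun w =>
      (canonicalForm_apply ξ v w).symm.trans (hv w)
    refine Prod.ext ?_ ?_
    · exact SeparatingDual.eq_zero_of_forall_dual_eq_zero (R := ℝ) fun p => by simpa using h (0, p)
    · refine ContinuousLinearMap.ext fun e => ?_
      have h1 : (show E × (E →L[ℝ] ℝ) from v).2 e = 0 := by simpa using h (e, 0)
      exact h1

theorem mfderiv_cotangent_proj (ξ : CotangentBundle E M) (a : E × (E →L[ℝ] ℝ)) :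
    mfderiv (cotangentModel E) 𝓘(ℝ, E) (fun η : CotangentBundle E M => η.1) ξ a = a.1 := by
  have h1 := mfderivWithin_range_extChartAt_symm (I := cotangentModel E) (x := ξ)
  have h2 := mfderivWithin_range_extChartAt_symm (I := 𝓘(ℝ, E)) (x := ξ.1)
  rw [ModelWithCorners.range_eq_univ, mfderivWithin_univ] at h1 h2
  have hz : extChartAt (cotangentModel E) ξ ξ ∈ (extChartAt (cotangentModel E) ξ).target :=
    mem_extChartAt_target ξ
  have hz1 : (extChartAt (cotangentModel E) ξ ξ).1 ∈ (extChartAt 𝓘(ℝ, E) ξ.1).target := by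
    rw [extChartAt_cotangent_target] at hz; exact hz.1
  have hc := (contMDiffAt_extChartAt_cotangent_symm hz).mdifferentiableAt (by simp)
  have h3 := mfderiv_comp_apply_of_eq (I' := cotangentModel E) (extChartAt (cotangentModel E) ξ ξ)
    ((contMDiff_cotangent_proj E M).mdifferentiable (by simp) ξ) hc
    (extChartAt_to_inv (I := cotangentModel E) ξ) a
  have hev : (fun η : CotangentBundle E M => η.1) ∘ (extChartAt (cotangentModel E) ξ).symm =ᶠ[
      𝓝 (extChartAt (cotangentModel E) ξ ξ)] (extChartAt 𝓘(ℝ, E) ξ.1).symm ∘ Prod.fst := by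
    filter_upwards [(continuous_fst.continuousAt).preimage_mem_nhds
      ((isOpen_extChartAt_target (I := 𝓘(ℝ, E)) ξ.1).mem_nhds hz1)] with w hw
    exact extChartAt_cotangent_symm_proj hw
  have h4 := mfderiv_comp_apply (I' := 𝓘(ℝ, E)) (extChartAt (cotangentModel E) ξ ξ)
    (f := (Prod.fst : E × (E →L[ℝ] ℝ) → E)) (g := (extChartAt 𝓘(ℝ, E) ξ.1).symm)
    (((contMDiffOn_extChartAt_symm (n := ∞) ξ.1).contMDiffAt
      ((isOpen_extChartAt_target ξ.1).mem_nhds hz1)).mdifferentiableAt (by simp))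
    (differentiableAt_fst.mdifferentiableAt) a
  rw [hev.mfderiv_eq, h1] at h3
  have h5 : (extChartAt (cotangentModel E) ξ ξ).1 = extChartAt 𝓘(ℝ, E) ξ.1 ξ.1 := by
    rw [extChartAt_cotangent_apply]
  rw [h5, h2, mfderiv_eq_fderiv, fderiv_fst] at h4
  exact h3.symm.trans h4

end SymplecticForm

/-! ### The action on covectors and the momentum map -/

section Action

variable {E : Type*} [NormedAddCommGroup E] [NormedSpace ℝ E]
  {F : Type*} [NormedAddCommGroup F] [NormedSpace ℝ F]
  {M : Type*} [TopologicalSpace M] [ChartedSpace E M] [IsManifold 𝓘(ℝ, E) ∞ M]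
  {T : Type*} [TopologicalSpace T] [ChartedSpace F T] [CommGroup T] [LieGroup 𝓘(ℝ, F) ∞ T]
  [MulAction T M] [ContMDiffSMul 𝓘(ℝ, F) 𝓘(ℝ, E) ∞ T M]

variable (E F T M) in
theorem contMDiff_action :
    ContMDiff (𝓘(ℝ, F).prod 𝓘(ℝ, E)) 𝓘(ℝ, E) ∞ (fun p : T × M => p.1 • p.2) :=
  ContMDiffSMul.contMDiff_smul

theorem contMDiff_action_left (E F : Type*) [NormedAddCommGroup E] [NormedSpace ℝ E]
    [NormedAddCommGroup F] [NormedSpace ℝ F] {M T : Type*} [TopologicalSpace M]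
    [ChartedSpace E M] [TopologicalSpace T] [ChartedSpace F T] [Group T] [MulAction T M]
    [ContMDiffSMul 𝓘(ℝ, F) 𝓘(ℝ, E) ∞ T M] (g : T) :
    ContMDiff 𝓘(ℝ, E) 𝓘(ℝ, E) ∞ (fun x : M => g • x) :=
  (ContMDiffSMul.contMDiff_smul (I := 𝓘(ℝ, F)) (I' := 𝓘(ℝ, E))).comp
    (contMDiff_const.prodMk contMDiff_id)

variable (E F T) in
theorem contMDiff_action_right (x : M) : ContMDiff 𝓘(ℝ, F) 𝓘(ℝ, E) ∞ (fun g : T => g • x) :=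
  (contMDiff_action E F M T).comp (contMDiff_id.prodMk contMDiff_const)

theorem infinitesimalAction_apply (x : M) (v : F) :
    infinitesimalAction (T := T) (E := E) x v =
      (mfderiv 𝓘(ℝ, F) 𝓘(ℝ, E) (fun g : T => g • x) 1 v : E) := by
  have h : ∀ (y : M) (e : y = x) (A : F →L[ℝ] TangentSpace 𝓘(ℝ, E) y),
      (e ▸ A : F →L[ℝ] TangentSpace 𝓘(ℝ, E) x) v = (A v : E) := by
    rintro y rfl A; rfl
  exact h _ (one_smul T x) _

variable (F) in
/-- The infinitesimal action of a commutative group is invariant under the group. -/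
theorem mfderiv_action_infinitesimalAction (g : T) (x : M) (v : F) :
    mfderiv 𝓘(ℝ, E) 𝓘(ℝ, E) (fun y : M => g • y) x (infinitesimalAction (T := T) (E := E) x v) =
      infinitesimalAction (T := T) (E := E) (g • x) v := by
  rw [infinitesimalAction_apply (g • x)]
  have h1 := mfderiv_comp_apply_of_eq (x := (1 : T)) (y := x)
    ((contMDiff_action_left E F g).mdifferentiable (by simp) x)
    ((contMDiff_action_right E F T x).mdifferentiable (by simp) 1) (one_smul T x) v
  have h2 := mfderiv_comp_apply (I' := 𝓘(ℝ, E)) (1 : T) (f := fun h : T => h • x)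
    (g := fun y : M => g • y)
    ((contMDiff_action_left E F g).mdifferentiable (by simp) _)
    ((contMDiff_action_right E F T x).mdifferentiable (by simp) 1) v
  have e : (fun y : M => g • y) ∘ (fun h : T => h • x) = fun h : T => h • (g • x) := by
    ext h; exact smul_comm g h x
  rw [e] at h1
  rw [h1]
  exact congrArg (mfderiv 𝓘(ℝ, E) 𝓘(ℝ, E) (fun y : M => g • y) x) (infinitesimalAction_apply x v)

variable (E M T) in
theorem contMDiff_infinitesimalAction (v : F) : ContMDiff 𝓘(ℝ, E) 𝓘(ℝ, E).tangent ∞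
    (fun x : M => (⟨x, infinitesimalAction (T := T) (E := E) x v⟩ : TangentBundle 𝓘(ℝ, E) M)) := by
  have h1 : ContMDiff 𝓘(ℝ, E) 𝓘(ℝ, E).tangent ∞ (fun x : M => TotalSpace.mk' E
      (E := TangentSpace 𝓘(ℝ, E)) x 0) := contMDiff_zeroSection _ _
  have h2 : ContMDiff 𝓘(ℝ, E) 𝓘(ℝ, F).tangent ∞ (fun _ : M => TotalSpace.mk' F
      (E := (TangentSpace 𝓘(ℝ, F) : T → Type _)) 1 v) := contMDiff_const
  have h3 := ((contMDiff_action E F M T).contMDiff_tangentMap (m := ∞) (by simp)).comp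
    (contMDiff_equivTangentBundleProd_symm.comp (h2.prodMk h1))
  refine h3.congr fun x => TotalSpace.ext (one_smul T x).symm (heq_of_eq ?_)
  refine (infinitesimalAction_apply x v).trans (Eq.trans ?_ (mfderiv_prod_eq_add_apply
    (I := 𝓘(ℝ, F)) (I' := 𝓘(ℝ, E)) ((contMDiff_action E F M T).mdifferentiable (by simp) (1, x))
    (v := ((v : F), (0 : E)))).symm)
  exact ((congrArg (fun z : E => (show E from mfderiv 𝓘(ℝ, F) 𝓘(ℝ, E) (fun g : T => g • x) 1 v) + z)
    (map_zero _)).trans (add_zero _)).symm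

/-- Covectors at the same base point which agree on all tangent vectors are equal. -/
theorem cotangent_ext {ξ ζ : CotangentBundle E M} (h : ξ.1 = ζ.1)
    (h' : ∀ v : E, (show E →L[ℝ] ℝ from ξ.2) v = (show E →L[ℝ] ℝ from ζ.2) v) : ξ = ζ := by
  obtain ⟨x, α⟩ := ξ
  obtain ⟨y, β⟩ := ζ
  obtain rfl : x = y := h
  exact congrArg _ (ContinuousLinearMap.ext h')

theorem momentum_apply (ξ : CotangentBundle E M) (v : F) :
    momentum T ξ v = ξ.2 (infinitesimalAction (T := T) (E := E) ξ.1 v) := rfl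

theorem contMDiff_cotangent_apply {v : (x : M) → TangentSpace 𝓘(ℝ, E) x}
    (hv : ContMDiff 𝓘(ℝ, E) 𝓘(ℝ, E).tangent ∞ (fun x => (⟨x, v x⟩ : TangentBundle 𝓘(ℝ, E) M))) :
    ContMDiff (cotangentModel E) 𝓘(ℝ, ℝ) ∞ (fun ξ : CotangentBundle E M => ξ.2 (v ξ.1)) := by
  have h1 : ContMDiff (cotangentModel E) (𝓘(ℝ, E).prod 𝓘(ℝ, ℝ)) ∞
      (fun ξ : CotangentBundle E M => TotalSpace.mk' ℝ (E := Trivial M ℝ) ξ.1 (ξ.2 (v ξ.1))) :=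
    ContMDiff.clm_bundle_apply (E₁ := TangentSpace 𝓘(ℝ, E)) (E₂ := Trivial M ℝ)
      (b := fun ξ : CotangentBundle E M => ξ.1)
      (ϕ := fun ξ : CotangentBundle E M => ξ.2) contMDiff_id
      (hv.comp (contMDiff_cotangent_proj E M))
  exact fun ξ => (contMDiffAt_totalSpace.1 (h1 ξ)).2

variable (E M) in
theorem contMDiff_momentum [FiniteDimensional ℝ F] :
    ContMDiff (cotangentModel E) 𝓘(ℝ, F →L[ℝ] ℝ) ∞
      (fun ξ : CotangentBundle E M => momentum (F := F) T ξ) := by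
  let b := Module.finBasis ℝ F
  have h : (fun ξ : CotangentBundle E M => momentum (F := F) T ξ) = fun ξ => ∑ i,
      ξ.2 (infinitesimalAction (T := T) (E := E) ξ.1 (b i)) •
        (LinearMap.toContinuousLinearMap (b.coord i) : F →L[ℝ] ℝ) := by
    funext ξ
    ext v
    conv_lhs => rw [← b.sum_repr v, map_sum]
    simp [mul_comm, momentum_apply]
  rw [h]
  refine contMDiff_finsetSum fun i _ => ?_
  exact (contMDiff_cotangent_apply (contMDiff_infinitesimalAction E M T (b i))).smul
    contMDiff_const

end Action

section Transport

variable {E : Type*} [NormedAddCommGroup E] [NormedSpace ℝ E]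
  {M : Type*} [TopologicalSpace M] [ChartedSpace E M] [IsManifold 𝓘(ℝ, E) ∞ M]
  {T : Type*} [TopologicalSpace T] [CommGroup T] [MulAction T M]

theorem mfderiv_inv_action_mfderiv_action (F : Type*) [NormedAddCommGroup F] [NormedSpace ℝ F]
    [ChartedSpace F T] [ContMDiffSMul 𝓘(ℝ, F) 𝓘(ℝ, E) ∞ T M]
    (g : T) (x : M) (v : E) :
    mfderiv 𝓘(ℝ, E) 𝓘(ℝ, E) (fun y : M => g⁻¹ • y) (g • x)
      (mfderiv 𝓘(ℝ, E) 𝓘(ℝ, E) (fun y : M => g • y) x v) = v := by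
  have h := mfderiv_comp_apply (I' := 𝓘(ℝ, E)) x (f := fun y : M => g • y)
    (g := fun y : M => g⁻¹ • y)
    ((contMDiff_action_left E F g⁻¹).mdifferentiable (by simp) _)
    ((contMDiff_action_left E F g).mdifferentiable (by simp) _) v
  have e : (fun y : M => g⁻¹ • y) ∘ (fun y : M => g • y) = id := by
    ext y; exact inv_smul_smul g y
  rw [e, mfderiv_id] at h
  exact h.symm

theorem mfderiv_action_mfderiv_inv_action (F : Type*) [NormedAddCommGroup F] [NormedSpace ℝ F]
    [ChartedSpace F T] [ContMDiffSMul 𝓘(ℝ, F) 𝓘(ℝ, E) ∞ T M]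
    (g : T) (x : M) (v : E) :
    mfderiv 𝓘(ℝ, E) 𝓘(ℝ, E) (fun y : M => g • y) x
      (mfderiv 𝓘(ℝ, E) 𝓘(ℝ, E) (fun y : M => g⁻¹ • y) (g • x) v) = v := by
  have h := mfderiv_comp_apply_of_eq (I' := 𝓘(ℝ, E)) (x := g • x) (y := x)
    (f := fun y : M => g⁻¹ • y) (g := fun y : M => g • y)
    ((contMDiff_action_left E F g).mdifferentiable (by simp) _)
    ((contMDiff_action_left E F g⁻¹).mdifferentiable (by simp) _) (inv_smul_smul g x) v
  have e : (fun y : M => g • y) ∘ (fun y : M => g⁻¹ • y) = id := by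
    ext y; exact smul_inv_smul g y
  rw [e, mfderiv_id] at h
  exact h.symm

theorem covectorTransport_apply (g : T) (η : CotangentBundle E M) (w : E) :
    (covectorTransport g η).2 w =
      η.2 (mfderiv 𝓘(ℝ, E) 𝓘(ℝ, E) (fun y : M => g⁻¹ • y) (g • η.1) w) := by
  have h : ∀ (y x : M) (e : y = x) (α : E →L[ℝ] ℝ) (z : E),
      (Eq.rec (motive := fun x _ => CotangentSpace E M (g⁻¹ • g • x)) α e :
        CotangentSpace E M (g⁻¹ • g • x)) z = α z := by
    rintro y x rfl α z; rfl
  exact h _ _ (inv_smul_smul g η.1) η.2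
    (mfderiv 𝓘(ℝ, E) 𝓘(ℝ, E) (fun y : M => g⁻¹ • y) (g • η.1) w)

/-- The defining property of the transport: `(g^* η)(Tg v) = η(v)`. -/
theorem covectorTransport_apply_mfderiv (F : Type*) [NormedAddCommGroup F] [NormedSpace ℝ F]
    [ChartedSpace F T] [ContMDiffSMul 𝓘(ℝ, F) 𝓘(ℝ, E) ∞ T M]
    (g : T) (η : CotangentBundle E M) (v : E) :
    (covectorTransport g η).2 (mfderiv 𝓘(ℝ, E) 𝓘(ℝ, E) (fun y : M => g • y) η.1 v) = η.2 v :=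
  (covectorTransport_apply g η _).trans
    (congrArg η.2 (mfderiv_inv_action_mfderiv_action F g η.1 v))

theorem eq_covectorTransport (F : Type*) [NormedAddCommGroup F] [NormedSpace ℝ F]
    [ChartedSpace F T] [ContMDiffSMul 𝓘(ℝ, F) 𝓘(ℝ, E) ∞ T M]
    {g : T} {η ζ : CotangentBundle E M} (h : ζ.1 = g • η.1)
    (h' : ∀ v : E, ζ.2 (mfderiv 𝓘(ℝ, E) 𝓘(ℝ, E) (fun y : M => g • y) η.1 v) = η.2 v) :
    ζ = covectorTransport g η := by
  refine cotangent_ext h fun w => ?_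
  have e := mfderiv_action_mfderiv_inv_action F g η.1 w
  refine (congrArg (show E →L[ℝ] ℝ from ζ.2) e).symm.trans ((h' _).trans ?_)
  exact (covectorTransport_apply g η w).symm

theorem covectorTransport_one (F : Type*) [NormedAddCommGroup F] [NormedSpace ℝ F]
    [ChartedSpace F T] [ContMDiffSMul 𝓘(ℝ, F) 𝓘(ℝ, E) ∞ T M]
    (η : CotangentBundle E M) :
    covectorTransport (1 : T) η = η := by
  refine (eq_covectorTransport F (one_smul T η.1).symm fun v => ?_).symm
  have e : (fun y : M => (1 : T) • y) = id := by ext y; exact one_smul T y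
  rw [e, mfderiv_id]
  rfl

theorem covectorTransport_mul (F : Type*) [NormedAddCommGroup F] [NormedSpace ℝ F]
    [ChartedSpace F T] [ContMDiffSMul 𝓘(ℝ, F) 𝓘(ℝ, E) ∞ T M]
    (g h : T) (η : CotangentBundle E M) :
    covectorTransport (g * h) η = covectorTransport g (covectorTransport h η) := by
  refine (eq_covectorTransport F (mul_smul g h η.1).symm fun v => ?_).symm
  have e : (fun y : M => (g * h) • y) = (fun y : M => g • y) ∘ fun y : M => h • y := by
    ext y; exact mul_smul g h y
  have h1 := mfderiv_comp_apply (I' := 𝓘(ℝ, E)) η.1 (f := fun y : M => h • y)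
    (g := fun y : M => g • y)
    ((contMDiff_action_left E F g).mdifferentiable (by simp) _)
    ((contMDiff_action_left E F h).mdifferentiable (by simp) _) v
  rw [e]
  refine (congrArg (show E →L[ℝ] ℝ from
    (covectorTransport g (covectorTransport h η)).2) h1).trans ?_
  exact (covectorTransport_apply_mfderiv F g (covectorTransport h η) _).trans
    (covectorTransport_apply_mfderiv F h η v)

end Transport

section Momentum

variable {E : Type*} [NormedAddCommGroup E] [NormedSpace ℝ E]
  {F : Type*} [NormedAddCommGroup F] [NormedSpace ℝ F]
  {M : Type*} [TopologicalSpace M] [ChartedSpace E M] [IsManifold 𝓘(ℝ, E) ∞ M]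
  {T : Type*} [TopologicalSpace T] [ChartedSpace F T] [CommGroup T] [LieGroup 𝓘(ℝ, F) ∞ T]
  [MulAction T M] [ContMDiffSMul 𝓘(ℝ, F) 𝓘(ℝ, E) ∞ T M]

/-- The momentum map is invariant under the group, which is commutative. -/
theorem momentum_covectorTransport (g : T) (η : CotangentBundle E M) :
    momentum (F := F) T (covectorTransport g η) = momentum T η := by
  ext v
  refine (congrArg (show E →L[ℝ] ℝ from (covectorTransport g η).2)
    (mfderiv_action_infinitesimalAction F g η.1 v).symm).trans ?_
  exact covectorTransport_apply_mfderiv F g η _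

theorem momentum_cotangentNeg (η : CotangentBundle E M) :
    momentum (F := F) T (cotangentNeg η) = -momentum T η := rfl

theorem covectorTransport_cotangentNeg (g : T) (η : CotangentBundle E M) :
    covectorTransport g (cotangentNeg η) = cotangentNeg (covectorTransport g η) := by
  refine cotangent_ext rfl fun w => (covectorTransport_apply g _ w).trans ?_
  exact congrArg Neg.neg (covectorTransport_apply g η w).symm

theorem cotangentAdd_proj (ξ ζ : CotangentBundle E M) : (cotangentAdd ξ ζ).1 = ξ.1 := by
  unfold cotangentAdd; split_ifs <;> rfl

theorem cotangentAdd_apply {ξ ζ : CotangentBundle E M} (h : ξ.1 = ζ.1) (v : E) :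
    (cotangentAdd ξ ζ).2 v = (ξ.2 v + ζ.2 v : ℝ) := by
  obtain ⟨x, α⟩ := ξ
  obtain ⟨y, β⟩ := ζ
  obtain rfl : x = y := h
  rw [cotangentAdd, dif_pos rfl]
  rfl

theorem momentum_cotangentAdd {ξ ζ : CotangentBundle E M} (h : ξ.1 = ζ.1) :
    momentum (F := F) T (cotangentAdd ξ ζ) = momentum T ξ + momentum T ζ := by
  obtain ⟨x, α⟩ := ξ
  obtain ⟨y, β⟩ := ζ
  obtain rfl : x = y := h
  rw [cotangentAdd, dif_pos rfl]
  rfl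

theorem covectorTransport_cotangentAdd (g : T) {ξ ζ : CotangentBundle E M} (h : ξ.1 = ζ.1) :
    covectorTransport g (cotangentAdd ξ ζ) =
      cotangentAdd (covectorTransport g ξ) (covectorTransport g ζ) := by
  have h' : (covectorTransport g ξ).1 = (covectorTransport g ζ).1 := congrArg (g • ·) h
  obtain ⟨x, α⟩ := ξ
  obtain ⟨y, β⟩ := ζ
  obtain rfl : x = y := h
  have e : cotangentAdd (⟨x, α⟩ : CotangentBundle E M) ⟨x, β⟩ = ⟨x, α + β⟩ := by
    rw [cotangentAdd, dif_pos rfl]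
  rw [e]
  refine cotangent_ext (cotangentAdd_proj (covectorTransport g ⟨x, α⟩) _).symm fun w => ?_
  refine (covectorTransport_apply g _ w).trans (Eq.trans ?_ (cotangentAdd_apply h' w).symm)
  exact congrArg₂ (· + ·) (covectorTransport_apply g ⟨x, α⟩ w).symm
    (covectorTransport_apply g ⟨x, β⟩ w).symm

theorem cotangentAdd_comm {ξ ζ : CotangentBundle E M} (h : ξ.1 = ζ.1) :
    cotangentAdd ξ ζ = cotangentAdd ζ ξ := by
  refine cotangent_ext (by simp [cotangentAdd_proj, h]) fun v => ?_
  exact (cotangentAdd_apply h v).trans ((add_comm _ _).trans (cotangentAdd_apply h.symm v).symm)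

theorem cotangentAdd_assoc {ξ ζ η : CotangentBundle E M} (h : ξ.1 = ζ.1) (h' : ζ.1 = η.1) :
    cotangentAdd (cotangentAdd ξ ζ) η = cotangentAdd ξ (cotangentAdd ζ η) := by
  obtain ⟨x, α⟩ := ξ
  obtain ⟨y, β⟩ := ζ
  obtain ⟨z, γ⟩ := η
  obtain rfl : x = y := h
  obtain rfl : x = z := h'
  have e : ∀ α β : CotangentSpace E M x,
      cotangentAdd (⟨x, α⟩ : CotangentBundle E M) ⟨x, β⟩ = ⟨x, α + β⟩ :=
    fun α β => by rw [cotangentAdd, dif_pos rfl]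
  rw [e, e, e, e, add_assoc]

theorem cotangentAdd_zero (ξ : CotangentBundle E M) {x : M} (h : x = ξ.1) :
    cotangentAdd ξ ⟨x, 0⟩ = ξ := by
  obtain ⟨y, β⟩ := ξ
  obtain rfl : x = y := h
  rw [cotangentAdd, dif_pos rfl]
  exact congrArg _ (add_zero β)

theorem cotangentAdd_cotangentNeg (ξ : CotangentBundle E M) :
    cotangentAdd ξ (cotangentNeg ξ) = ⟨ξ.1, 0⟩ := by
  obtain ⟨y, β⟩ := ξ
  rw [cotangentNeg, cotangentAdd, dif_pos rfl]
  exact congrArg _ (add_neg_cancel β)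

theorem covectorTransport_zero (g : T) (x : M) :
    covectorTransport g (⟨x, 0⟩ : CotangentBundle E M) = ⟨g • x, 0⟩ :=
  cotangent_ext rfl fun w => covectorTransport_apply g _ w

end Momentum

/-! ### Smoothness of the operations on covectors -/

section SmoothTransport

variable {E : Type*} [NormedAddCommGroup E] [NormedSpace ℝ E]
  {F : Type*} [NormedAddCommGroup F] [NormedSpace ℝ F]
  {M : Type*} [TopologicalSpace M] [ChartedSpace E M] [IsManifold 𝓘(ℝ, E) ∞ M]
  {T : Type*} [TopologicalSpace T] [ChartedSpace F T] [CommGroup T] [LieGroup 𝓘(ℝ, F) ∞ T]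
  [MulAction T M] [ContMDiffSMul 𝓘(ℝ, F) 𝓘(ℝ, E) ∞ T M]

theorem covectorCoord_continuousLinearMapAt {x₀ : M} {ξ : CotangentBundle E M}
    {x : M} (hx : x = ξ.1)
    (hξ : ξ.1 ∈ (chartAt E x₀).source) (v : E) :
    covectorCoord x₀ ξ
        ((trivializationAt E (TangentSpace 𝓘(ℝ, E)) x₀).continuousLinearMapAt ℝ x v) =
      ξ.2 v := by
  subst hx
  exact congrArg ξ.2 ((trivializationAt E (TangentSpace 𝓘(ℝ, E)) x₀).symmL_continuousLinearMapAt
    (R := ℝ) (b := ξ.1) (by simpa using hξ) v)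

variable (E F M T) in
/-- Covectors are transported smoothly by the group. -/
theorem contMDiff_covectorTransport :
    ContMDiff (𝓘(ℝ, F).prod (cotangentModel E)) (cotangentModel E) ∞
      (fun z : T × CotangentBundle E M => covectorTransport z.1 z.2) := by
  have hp : ContMDiff (𝓘(ℝ, F).prod (cotangentModel E)) 𝓘(ℝ, E) ∞
      (fun z : T × CotangentBundle E M => z.1 • z.2.1) :=
    (contMDiff_action E F M T).comp
      (contMDiff_fst.prodMk ((contMDiff_cotangent_proj E M).comp contMDiff_snd))
  intro z₀
  refine contMDiffWithinAt_cotangentBundle_iff.2 ⟨hp z₀, ?_⟩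
  have h1 : ContMDiffAt (𝓘(ℝ, F).prod (cotangentModel E)) 𝓘(ℝ, E →L[ℝ] E) ∞
      (inTangentCoordinates 𝓘(ℝ, E) 𝓘(ℝ, E) (fun z : T × CotangentBundle E M => z.1 • z.2.1)
        (fun z => z.1⁻¹ • (z.1 • z.2.1))
        (fun z => mfderiv 𝓘(ℝ, E) 𝓘(ℝ, E) (fun y : M => z.1⁻¹ • y) (z.1 • z.2.1)) z₀) z₀ := by
    refine ContMDiffAt.mfderiv (n := ∞) (fun (z : T × CotangentBundle E M) (y : M) => z.1⁻¹ • y)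
      (fun z => z.1 • z.2.1) ?_ (hp z₀) (by simp)
    exact ((contMDiff_action E F M T).comp
      (((contMDiff_inv 𝓘(ℝ, F) ∞).comp (contMDiff_fst.comp contMDiff_fst)).prodMk
        contMDiff_snd)).contMDiffAt
  have h2 : ContMDiffAt (𝓘(ℝ, F).prod (cotangentModel E)) 𝓘(ℝ, E →L[ℝ] ℝ) ∞
      (fun z : T × CotangentBundle E M => covectorCoord (z₀.1⁻¹ • (z₀.1 • z₀.2.1)) z.2) z₀ := by
    rw [inv_smul_smul]
    exact (contMDiffWithinAt_cotangentBundle_iff.1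
      (contMDiffWithinAt_snd (s := univ) (p := z₀))).2
  refine (h2.clm_comp h1).congr_of_eventuallyEq ?_
  have hs : ∀ᶠ z : T × CotangentBundle E M in 𝓝 z₀, z.2.1 ∈ (chartAt E z₀.2.1).source :=
    ((contMDiff_cotangent_proj E M).continuous.comp continuous_snd).continuousAt.eventually
      ((chartAt E z₀.2.1).open_source.mem_nhds (mem_chart_source E _))
  filter_upwards [hs] with z hz
  refine ContinuousLinearMap.ext fun v => ?_
  refine (covectorTransport_apply z.1 z.2 _).trans
    (covectorCoord_continuousLinearMapAt (inv_smul_smul z.1 z.2.1) ?_ _).symm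
  rwa [inv_smul_smul]

theorem ContMDiffWithinAt.cotangentAdd {EN : Type*} [NormedAddCommGroup EN]
    [NormedSpace ℝ EN] {HN : Type*} [TopologicalSpace HN] {J : ModelWithCorners ℝ EN HN}
    {N : Type*} [TopologicalSpace N] [ChartedSpace HN N] {f g : N → CotangentBundle E M}
    {s : Set N} {n₀ : N} (hf : ContMDiffWithinAt J (cotangentModel E) ∞ f s n₀)
    (hg : ContMDiffWithinAt J (cotangentModel E) ∞ g s n₀) (hn₀ : n₀ ∈ s)
    (h : ∀ n ∈ s, (f n).1 = (g n).1) :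
    ContMDiffWithinAt J (cotangentModel E) ∞ (fun n => cotangentAdd (f n) (g n)) s n₀ := by
  rw [contMDiffWithinAt_cotangentBundle_iff] at hf hg ⊢
  simp only [cotangentAdd_proj]
  rw [← h n₀ hn₀] at hg
  refine ⟨hf.1, (hf.2.add hg.2).congr_of_mem (fun n hn => ?_) hn₀⟩
  refine ContinuousLinearMap.ext fun v => ?_
  have hn := h n hn
  simp only [Pi.add_apply]
  generalize f n = ξ at *
  generalize g n = ζ at *
  obtain ⟨x, α⟩ := ξ
  obtain ⟨y, β⟩ := ζ
  obtain rfl : x = y := hn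
  have e : AbelianPoisson.cotangentAdd (⟨x, α⟩ : CotangentBundle E M) ⟨x, β⟩ = ⟨x, α + β⟩ := by
    rw [AbelianPoisson.cotangentAdd, dif_pos rfl]
  rw [e]
  rfl

variable (E M) in
theorem contMDiff_cotangentNeg : ContMDiff (cotangentModel E) (cotangentModel E) ∞
    (cotangentNeg : CotangentBundle E M → CotangentBundle E M) := by
  intro ξ
  have h := contMDiffWithinAt_cotangentBundle_iff.1
    (contMDiffWithinAt_id (I := cotangentModel E) (n := ∞) (s := univ) (x := ξ))
  exact contMDiffWithinAt_cotangentBundle_iff.2 ⟨h.1, h.2.neg⟩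

variable (E M) in
theorem contMDiff_cotangent_zero : ContMDiff 𝓘(ℝ, E) (cotangentModel E) ∞
    (fun x : M => (⟨x, 0⟩ : CotangentBundle E M)) := by
  intro x
  exact contMDiffWithinAt_cotangentBundle_iff.2 ⟨contMDiffWithinAt_id,
    contMDiffWithinAt_const (c := (0 : E →L[ℝ] ℝ))⟩

end SmoothTransport

/-! ### The groupoid structures -/

section Submersion

variable {E : Type*} [NormedAddCommGroup E] [NormedSpace ℝ E]
  {H : Type*} [TopologicalSpace H] {I : ModelWithCorners ℝ E H}
  {X : Type*} [TopologicalSpace X] [ChartedSpace H X]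
  {E' : Type*} [NormedAddCommGroup E'] [NormedSpace ℝ E']
  {H' : Type*} [TopologicalSpace H'] {J : ModelWithCorners ℝ E' H'}
  {M : Type*} [TopologicalSpace M] [ChartedSpace H' M]

theorem IsSurjectiveSubmersion.comp_of_inverse {f : X → M}
    (hf : IsSurjectiveSubmersion I J f) {A B : X → X} (hA : ContMDiff I I ∞ A)
    (hB : ContMDiff I I ∞ B) (hAB : ∀ ξ, A (B ξ) = ξ) (hBA : ∀ ξ, B (A ξ) = ξ) :
    IsSurjectiveSubmersion I J (f ∘ A) := by
  refine ⟨hf.smooth.comp hA, hf.surjective.comp fun ξ => ⟨B ξ, hAB ξ⟩, fun ξ v => ?_⟩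
  obtain ⟨w, hw⟩ := hf.mfderiv_surjective (A ξ) v
  have h := mfderiv_comp_apply_of_eq (I' := I) (x := A ξ) (y := ξ) (f := B) (g := A)
    (hA.mdifferentiable (by simp) _) (hB.mdifferentiable (by simp) _) (hBA ξ) w
  have e : A ∘ B = id := funext hAB
  rw [e, mfderiv_id] at h
  refine ⟨mfderiv I I B (A ξ) w, ?_⟩
  refine (mfderiv_comp_apply (I' := I) ξ (hf.smooth.mdifferentiable (by simp) _)
    (hA.mdifferentiable (by simp) _) _).trans ?_
  exact (congrArg (mfderiv I J f (A ξ)) h.symm).trans hw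

end Submersion

section Groupoids

variable {E : Type*} [NormedAddCommGroup E] [NormedSpace ℝ E]
  {F : Type*} [NormedAddCommGroup F] [NormedSpace ℝ F] [FiniteDimensional ℝ F]
  {M : Type*} [TopologicalSpace M] [ChartedSpace E M] [IsManifold 𝓘(ℝ, E) ∞ M]
  {T : Type*} [TopologicalSpace T] [ChartedSpace F T] [CommGroup T] [LieGroup 𝓘(ℝ, F) ∞ T]
  [T2Space T]
  [MulAction T M] [ContMDiffSMul 𝓘(ℝ, F) 𝓘(ℝ, E) ∞ T M]
  (P : ⋀[ℝ]^2 (GroupLieAlgebra 𝓘(ℝ, F) T))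

theorem coalgebraAction_smul_smul (u w : F →L[ℝ] ℝ) (x : M) :
    coalgebraAction P u • coalgebraAction P w • x = coalgebraAction P (u + w) • x := by
  rw [coalgebraAction_add, mul_smul]

theorem covectorTransport_coalgebraAction (u w : F →L[ℝ] ℝ) (ξ : CotangentBundle E M) :
    covectorTransport (coalgebraAction P u) (covectorTransport (coalgebraAction P w) ξ) =
      covectorTransport (coalgebraAction P (u + w)) ξ := by
  rw [coalgebraAction_add, covectorTransport_mul F]

theorem contMDiff_coalgebraAction_smul (c : ℝ) :
    ContMDiff 𝓘(ℝ, F →L[ℝ] ℝ) 𝓘(ℝ, F) ∞ (fun u => coalgebraAction P (c • u)) :=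
  (contMDiff_coalgebraAction P).comp (contDiff_const_smul c).contMDiff

/-- The map `A_c`, the transport of a covector `ξ` by `R_{cρ*ξ}`. These maps form a flow on `T*M`
whose time `±½` maps, followed by the projection to `M`, are the target and the source map. -/
noncomputable def momentumFlow (c : ℝ) (ξ : CotangentBundle E M) : CotangentBundle E M :=
  covectorTransport (coalgebraAction P (c • momentum T ξ)) ξ

theorem momentum_momentumFlow (c : ℝ) (ξ : CotangentBundle E M) :
    momentum (F := F) T (momentumFlow P c ξ) = momentum T ξ :=
  momentum_covectorTransport _ ξ

theorem momentumFlow_add (c d : ℝ) (ξ : CotangentBundle E M) :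
    momentumFlow P c (momentumFlow P d ξ) = momentumFlow P (c + d) ξ := by
  rw [momentumFlow, momentum_momentumFlow, momentumFlow, covectorTransport_coalgebraAction,
    ← add_smul, momentumFlow]

theorem momentumFlow_zero (ξ : CotangentBundle E M) : momentumFlow P 0 ξ = ξ := by
  rw [momentumFlow, zero_smul, coalgebraAction_zero, covectorTransport_one F]

theorem momentumFlow_neg_self (c : ℝ) (ξ : CotangentBundle E M) :
    momentumFlow P (-c) (momentumFlow P c ξ) = ξ := by
  rw [momentumFlow_add, neg_add_cancel, momentumFlow_zero]

theorem momentumFlow_self_neg (c : ℝ) (ξ : CotangentBundle E M) :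
    momentumFlow P c (momentumFlow P (-c) ξ) = ξ := by
  rw [momentumFlow_add, add_neg_cancel, momentumFlow_zero]

theorem contMDiff_momentumFlow (c : ℝ) : ContMDiff (cotangentModel E) (cotangentModel E) ∞
    (momentumFlow P c : CotangentBundle E M → CotangentBundle E M) :=
  (contMDiff_covectorTransport E F M T).comp
    (((contMDiff_coalgebraAction_smul P c).comp (contMDiff_momentum E M)).prodMk contMDiff_id)

theorem halfFlow_cotangentNeg (ξ : CotangentBundle E M) :
    halfFlow P (cotangentNeg ξ) = coalgebraAction P ((-(1 / 2) : ℝ) • momentum T ξ) := by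
  rw [halfFlow, momentum_cotangentNeg]
  congr 1
  module

theorem cotangentGroupoid_source_eq (ξ : CotangentBundle E M) :
    (cotangentGroupoid P).source ξ = (momentumFlow P (-(1 / 2)) ξ).1 :=
  congrArg (· • ξ.1) (halfFlow_cotangentNeg P ξ)

theorem cotangentGroupoid_target_eq (ξ : CotangentBundle E M) :
    (cotangentGroupoid P).target ξ = (momentumFlow P (1 / 2) ξ).1 := rfl

variable (E M) in
theorem isSurjectiveSubmersion_cotangent_proj :
    IsSurjectiveSubmersion (cotangentModel E) 𝓘(ℝ, E) (fun η : CotangentBundle E M => η.1) :=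
  ⟨contMDiff_cotangent_proj E M, fun x => ⟨⟨x, 0⟩, rfl⟩, fun ξ v =>
    ⟨((v : E), (0 : E →L[ℝ] ℝ)), mfderiv_cotangent_proj ξ _⟩⟩

theorem isSurjectiveSubmersion_momentumFlow (c : ℝ) :
    IsSurjectiveSubmersion (cotangentModel E) 𝓘(ℝ, E)
      (fun η : CotangentBundle E M => (momentumFlow P c η).1) :=
  (isSurjectiveSubmersion_cotangent_proj E M).comp_of_inverse (contMDiff_momentumFlow P c)
    (contMDiff_momentumFlow P (-c)) (momentumFlow_self_neg P c) (momentumFlow_neg_self P c)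

/-- For composable `ξ` and `ζ`, `p(ξ) = R_{(ρ*ξ + ρ*ζ)/2} p(ζ)`. -/
theorem proj_eq_of_composable {ξ ζ : CotangentBundle E M}
    (h : (cotangentGroupoid P).source ξ = (cotangentGroupoid P).target ζ) :
    ξ.1 = coalgebraAction P ((1 / 2 : ℝ) • (momentum T ξ + momentum T ζ)) • ζ.1 := by
  have h1 := congrArg (coalgebraAction P ((1 / 2 : ℝ) • momentum T ξ) • ·) h
  rw [cotangentGroupoid_source_eq] at h1
  change coalgebraAction P _ • coalgebraAction P _ • ξ.1 =
    coalgebraAction P _ • coalgebraAction P _ • ζ.1 at h1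
  rw [coalgebraAction_smul_smul, coalgebraAction_smul_smul,
    show (1 / 2 : ℝ) • momentum T ξ + (-(1 / 2) : ℝ) • momentum T ξ = 0 by module,
    coalgebraAction_zero, one_smul] at h1
  rw [h1, smul_add]

theorem cotangentGroupoid_mul_eq (ξ ζ : CotangentBundle E M) :
    (cotangentGroupoid P).mul ξ ζ = cotangentAdd
      (covectorTransport (coalgebraAction P ((1 / 2 : ℝ) • momentum T ξ)) ζ)
      (covectorTransport (coalgebraAction P ((-(1 / 2) : ℝ) • momentum T ζ)) ξ) := by
  rw [← halfFlow_cotangentNeg]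
  rfl

/-- The two summands of the product of a composable pair lie over the same point. -/
theorem mul_summands_proj {ξ ζ : CotangentBundle E M}
    (h : (cotangentGroupoid P).source ξ = (cotangentGroupoid P).target ζ) :
    (covectorTransport (coalgebraAction P ((1 / 2 : ℝ) • momentum T ξ)) ζ).1 =
      (covectorTransport (coalgebraAction P ((-(1 / 2) : ℝ) • momentum T ζ)) ξ).1 := by
  change coalgebraAction P _ • ζ.1 = coalgebraAction P _ • ξ.1
  rw [proj_eq_of_composable P h, coalgebraAction_smul_smul]
  congr 2
  module

theorem momentum_mul {ξ ζ : CotangentBundle E M}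
    (h : (cotangentGroupoid P).source ξ = (cotangentGroupoid P).target ζ) :
    momentum (F := F) T ((cotangentGroupoid P).mul ξ ζ) = momentum T ξ + momentum T ζ := by
  rw [cotangentGroupoid_mul_eq, momentum_cotangentAdd (mul_summands_proj P h),
    momentum_covectorTransport, momentum_covectorTransport, add_comm]

theorem proj_mul (ξ ζ : CotangentBundle E M) :
    ((cotangentGroupoid P).mul ξ ζ).1 = coalgebraAction P ((1 / 2 : ℝ) • momentum T ξ) • ζ.1 :=
  cotangentAdd_proj _ _

theorem cotangentGroupoid_source (ξ : CotangentBundle E M) : (cotangentGroupoid P).source ξ =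
    coalgebraAction P ((-(1 / 2) : ℝ) • momentum T ξ) • ξ.1 :=
  cotangentGroupoid_source_eq P ξ

theorem cotangentGroupoid_target (ξ : CotangentBundle E M) : (cotangentGroupoid P).target ξ =
    coalgebraAction P ((1 / 2 : ℝ) • momentum T ξ) • ξ.1 := rfl

theorem source_mul_cotangentGroupoid {ξ ζ : CotangentBundle E M}
    (h : (cotangentGroupoid P).source ξ = (cotangentGroupoid P).target ζ) :
    (cotangentGroupoid P).source ((cotangentGroupoid P).mul ξ ζ) =
      (cotangentGroupoid P).source ζ := by
  rw [cotangentGroupoid_source, momentum_mul P h, proj_mul, coalgebraAction_smul_smul,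
    cotangentGroupoid_source]
  congr 2
  module

theorem target_mul_cotangentGroupoid {ξ ζ : CotangentBundle E M}
    (h : (cotangentGroupoid P).source ξ = (cotangentGroupoid P).target ζ) :
    (cotangentGroupoid P).target ((cotangentGroupoid P).mul ξ ζ) =
      (cotangentGroupoid P).target ξ := by
  rw [cotangentGroupoid_target, momentum_mul P h, proj_mul, coalgebraAction_smul_smul,
    cotangentGroupoid_target, proj_eq_of_composable P h, coalgebraAction_smul_smul]
  congr 2
  module

theorem mul_assoc_cotangentGroupoid {ξ ζ η : CotangentBundle E M}
    (h : (cotangentGroupoid P).source ξ = (cotangentGroupoid P).target ζ)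
    (h' : (cotangentGroupoid P).source ζ = (cotangentGroupoid P).target η) :
    (cotangentGroupoid P).mul ((cotangentGroupoid P).mul ξ ζ) η =
      (cotangentGroupoid P).mul ξ ((cotangentGroupoid P).mul ζ η) := by
  have e1 := proj_eq_of_composable P h
  have e2 := proj_eq_of_composable P h'
  have p1 := mul_summands_proj P h
  have p2 := mul_summands_proj P h'
  have m1 := momentum_mul P h
  have m2 := momentum_mul P h'
  rw [cotangentGroupoid_mul_eq P ((cotangentGroupoid P).mul ξ ζ) η,
    cotangentGroupoid_mul_eq P ξ ((cotangentGroupoid P).mul ζ η), m1, m2,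
    cotangentGroupoid_mul_eq P ξ ζ, cotangentGroupoid_mul_eq P ζ η,
    covectorTransport_cotangentAdd _ p1, covectorTransport_cotangentAdd _ p2]
  simp only [covectorTransport_coalgebraAction]
  rw [← cotangentAdd_assoc]
  · have e {u w : F →L[ℝ] ℝ} (h : u = w) (x : CotangentBundle E M) :
        covectorTransport (coalgebraAction P u) x = covectorTransport (coalgebraAction P w) x := by
      rw [h]
    exact congrArg₂ cotangentAdd (congrArg₂ cotangentAdd (e (by module) η) (e (by module) ζ))
      (e (by module) ξ)
  · change coalgebraAction P _ • η.1 = coalgebraAction P _ • ζ.1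
    rw [e2, coalgebraAction_smul_smul]
    congr 2
    module
  · change coalgebraAction P _ • ζ.1 = coalgebraAction P _ • ξ.1
    rw [e1, coalgebraAction_smul_smul]
    congr 2
    module

theorem momentum_zero (x : M) :
    momentum (F := F) T (⟨x, 0⟩ : CotangentBundle E M) = 0 := rfl

theorem isLieGroupoid_cotangentGroupoid :
    IsLieGroupoid (cotangentModel E) 𝓘(ℝ, E)
      (cotangentGroupoid P : GroupoidMaps (CotangentBundle E M) M) where
  source_submersion := by
    have h : (cotangentGroupoid P : GroupoidMaps (CotangentBundle E M) M).source =
      fun ξ => (momentumFlow P (-(1 / 2)) ξ).1 := funext (cotangentGroupoid_source_eq P)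
    rw [h]
    exact isSurjectiveSubmersion_momentumFlow P _
  target_submersion := isSurjectiveSubmersion_momentumFlow P (1 / 2)
  smooth_unit := contMDiff_cotangent_zero E M
  smooth_inv := contMDiff_cotangentNeg E M
  smooth_mul := by
    have hm := contMDiff_momentum (F := F) (T := T) E M
    have h : ∀ c : ℝ, ContMDiff ((cotangentModel E).prod (cotangentModel E)) (cotangentModel E) ∞
        (fun z : CotangentBundle E M × CotangentBundle E M =>
          covectorTransport (coalgebraAction P (c • momentum T z.1)) z.2) := fun c =>
      (contMDiff_covectorTransport E F M T).comp
        (((contMDiff_coalgebraAction_smul P c).comp (hm.comp contMDiff_fst)).prodMk contMDiff_snd)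
    intro z hz
    refine (ContMDiffWithinAt.cotangentAdd (h (1 / 2) z).contMDiffWithinAt
      (((h (-(1 / 2))).comp (contMDiff_snd.prodMk contMDiff_fst)) z).contMDiffWithinAt hz
      fun w hw => mul_summands_proj P hw).congr (fun w _ => cotangentGroupoid_mul_eq P _ _)
      (cotangentGroupoid_mul_eq P _ _)
  source_unit x := by
    rw [cotangentGroupoid_source]
    change coalgebraAction P (_ • momentum (F := F) T (⟨x, 0⟩ : CotangentBundle E M)) • x = x
    rw [momentum_zero, smul_zero, coalgebraAction_zero, one_smul]
  target_unit x := by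
    change coalgebraAction P (_ • momentum (F := F) T (⟨x, 0⟩ : CotangentBundle E M)) • x = x
    rw [momentum_zero, smul_zero, coalgebraAction_zero, one_smul]
  source_inv ξ := by
    rw [cotangentGroupoid_source, cotangentGroupoid_target]
    change coalgebraAction P (_ • momentum (F := F) T (cotangentNeg ξ)) • ξ.1 = _
    rw [momentum_cotangentNeg]
    congr 2
    module
  target_inv ξ := by
    rw [cotangentGroupoid_source, cotangentGroupoid_target]
    change coalgebraAction P (_ • momentum (F := F) T (cotangentNeg ξ)) • ξ.1 = _
    rw [momentum_cotangentNeg]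
    congr 2
    module
  source_mul ξ ζ h := source_mul_cotangentGroupoid P h
  target_mul ξ ζ h := target_mul_cotangentGroupoid P h
  mul_assoc ξ ζ η h h' := mul_assoc_cotangentGroupoid P h h'
  unit_mul ξ := by
    rw [cotangentGroupoid_mul_eq]
    change cotangentAdd (covectorTransport (coalgebraAction P (_ • momentum (F := F) T
      (⟨_, 0⟩ : CotangentBundle E M))) ξ) (covectorTransport _ ⟨_, 0⟩) = ξ
    rw [momentum_zero, smul_zero, coalgebraAction_zero, covectorTransport_one F,
      covectorTransport_zero, cotangentAdd_zero]
    rw [cotangentGroupoid_target, coalgebraAction_smul_smul,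
      show (-(1 / 2) : ℝ) • momentum T ξ + (1 / 2 : ℝ) • momentum T ξ = 0 by module,
      coalgebraAction_zero, one_smul]
  mul_unit ξ := by
    rw [cotangentGroupoid_mul_eq]
    change cotangentAdd (covectorTransport _ ⟨_, 0⟩) (covectorTransport (coalgebraAction P
      (_ • momentum (F := F) T (⟨_, 0⟩ : CotangentBundle E M))) ξ) = ξ
    have e : coalgebraAction P ((1 / 2 : ℝ) • momentum T ξ) • (cotangentGroupoid P).source ξ =
        ξ.1 := by
      rw [cotangentGroupoid_source, coalgebraAction_smul_smul,
        show (1 / 2 : ℝ) • momentum T ξ + (-(1 / 2) : ℝ) • momentum T ξ = 0 by module,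
        coalgebraAction_zero, one_smul]
    rw [momentum_zero, smul_zero, coalgebraAction_zero, covectorTransport_one F,
      covectorTransport_zero, cotangentAdd_comm e, cotangentAdd_zero _ e]
  inv_mul ξ := by
    rw [cotangentGroupoid_mul_eq]
    change cotangentAdd (covectorTransport (coalgebraAction P (_ • momentum (F := F) T
      (cotangentNeg ξ))) ξ) (covectorTransport _ (cotangentNeg ξ)) = _
    rw [momentum_cotangentNeg, covectorTransport_cotangentNeg,
      show (1 / 2 : ℝ) • -momentum T ξ = (-(1 / 2) : ℝ) • momentum T ξ by module,
      cotangentAdd_cotangentNeg]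
    exact congrArg (fun x : M => (⟨x, 0⟩ : CotangentBundle E M))
      (cotangentGroupoid_source P ξ).symm
  mul_inv ξ := by
    rw [cotangentGroupoid_mul_eq]
    change cotangentAdd (covectorTransport _ (cotangentNeg ξ)) (covectorTransport
      (coalgebraAction P (_ • momentum (F := F) T (cotangentNeg ξ))) ξ) = _
    rw [momentum_cotangentNeg, covectorTransport_cotangentNeg,
      show (-(1 / 2) : ℝ) • -momentum T ξ = (1 / 2 : ℝ) • momentum T ξ by module,
      cotangentAdd_comm (ξ := cotangentNeg (covectorTransport _ ξ))
        (ζ := covectorTransport _ ξ) rfl, cotangentAdd_cotangentNeg]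
    rfl

/-- The source fibre over `x` is diffeomorphic to the vector space `T*_x M`. -/
theorem isConnected_source_fibre (x : M) :
    IsConnected ((cotangentGroupoid P : GroupoidMaps (CotangentBundle E M) M).source ⁻¹' {x}) := by
  have h : (cotangentGroupoid P : GroupoidMaps (CotangentBundle E M) M).source ⁻¹' {x} =
      range (fun α : E →L[ℝ] ℝ => momentumFlow P (1 / 2) (⟨x, α⟩ : CotangentBundle E M)) := by
    ext ξ
    simp only [mem_preimage, mem_singleton_iff, mem_range]
    rw [cotangentGroupoid_source_eq]
    constructor
    · rintro rfl
      exact ⟨(momentumFlow P (-(1 / 2)) ξ).2, momentumFlow_self_neg P _ _⟩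
    · rintro ⟨α, rfl⟩
      rw [momentumFlow_neg_self]
  rw [h, ← image_univ]
  have hu : IsConnected (univ : Set (E →L[ℝ] ℝ)) :=
    ⟨univ_nonempty, (convex_univ (𝕜 := ℝ)).isPreconnected⟩
  exact hu.image _ ((contMDiff_momentumFlow P (1 / 2)).continuous.comp
    (FiberBundle.continuous_totalSpaceMk (E →L[ℝ] ℝ) (CotangentSpace E M) x)).continuousOn

/-- The map `(u, x) ↦ (u, R_{cu} x)`. -/
noncomputable def coalgebraFlow (c : ℝ) (z : (F →L[ℝ] ℝ) × M) : (F →L[ℝ] ℝ) × M :=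
  (z.1, coalgebraAction P (c • z.1) • z.2)

theorem coalgebraFlow_neg_self (c : ℝ) (z : (F →L[ℝ] ℝ) × M) :
    coalgebraFlow P (-c) (coalgebraFlow P c z) = z := by
  refine Prod.ext rfl ?_
  change coalgebraAction P (-c • z.1) • coalgebraAction P (c • z.1) • z.2 = z.2
  rw [coalgebraAction_smul_smul, show -c • z.1 + c • z.1 = 0 by module, coalgebraAction_zero,
    one_smul]

theorem coalgebraFlow_self_neg (c : ℝ) (z : (F →L[ℝ] ℝ) × M) :
    coalgebraFlow P c (coalgebraFlow P (-c) z) = z := by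
  simpa using coalgebraFlow_neg_self P (-c) z

theorem contMDiff_coalgebraFlow (c : ℝ) :
    ContMDiff (𝓘(ℝ, F →L[ℝ] ℝ).prod 𝓘(ℝ, E)) (𝓘(ℝ, F →L[ℝ] ℝ).prod 𝓘(ℝ, E)) ∞
      (coalgebraFlow P c : (F →L[ℝ] ℝ) × M → (F →L[ℝ] ℝ) × M) :=
  contMDiff_fst.prodMk ((contMDiff_action E F M T).comp
    (((contMDiff_coalgebraAction_smul P c).comp contMDiff_fst).prodMk contMDiff_snd))

theorem isSurjectiveSubmersion_coalgebraFlow (c : ℝ) :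
    IsSurjectiveSubmersion (𝓘(ℝ, F →L[ℝ] ℝ).prod 𝓘(ℝ, E)) 𝓘(ℝ, E)
      (fun z : (F →L[ℝ] ℝ) × M => (coalgebraFlow P c z).2) := by
  have h : IsSurjectiveSubmersion (𝓘(ℝ, F →L[ℝ] ℝ).prod 𝓘(ℝ, E)) 𝓘(ℝ, E)
      (Prod.snd : (F →L[ℝ] ℝ) × M → M) :=
    ⟨contMDiff_snd, Prod.snd_surjective, fun z v => ⟨((0 : F →L[ℝ] ℝ), (v : E)), by
      rw [mfderiv_snd]; rfl⟩⟩
  exact h.comp_of_inverse (contMDiff_coalgebraFlow P c) (contMDiff_coalgebraFlow P (-c))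
    (coalgebraFlow_self_neg P c) (coalgebraFlow_neg_self P c)

theorem isLieGroupoid_actionGroupoid :
    IsLieGroupoid (𝓘(ℝ, F →L[ℝ] ℝ).prod 𝓘(ℝ, E)) 𝓘(ℝ, E)
      (actionGroupoid P : GroupoidMaps ((F →L[ℝ] ℝ) × M) M) := by
  have hR (u w : F →L[ℝ] ℝ) (x : M) : coalgebraAction P u • coalgebraAction P w • x =
      coalgebraAction P (u + w) • x := coalgebraAction_smul_smul P u w x
  have h0 (x : M) : coalgebraAction P 0 • x = x := by rw [coalgebraAction_zero, one_smul]
  have hc {u v : F →L[ℝ] ℝ} {x y : M} (h : coalgebraAction P (-((1 / 2 : ℝ) • u)) • x =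
      coalgebraAction P ((1 / 2 : ℝ) • v) • y) :
      x = coalgebraAction P ((1 / 2 : ℝ) • (u + v)) • y := by
    have h1 := congrArg (coalgebraAction P ((1 / 2 : ℝ) • u) • ·) h
    simp only [hR] at h1
    rw [add_neg_cancel, h0] at h1
    rw [h1, smul_add]
  exact {
    source_submersion := by
      have h : (actionGroupoid P : GroupoidMaps ((F →L[ℝ] ℝ) × M) M).source =
          fun z => (coalgebraFlow P (-(1 / 2)) z).2 := by
        funext z
        change coalgebraAction P _ • z.2 = coalgebraAction P _ • z.2
        congr 2
        module
      rw [h]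
      exact isSurjectiveSubmersion_coalgebraFlow P _
    target_submersion := isSurjectiveSubmersion_coalgebraFlow P (1 / 2)
    smooth_unit := contMDiff_const.prodMk contMDiff_id
    smooth_inv := contMDiff_fst.neg.prodMk contMDiff_snd
    smooth_mul := by
      have h1 : ContMDiff 𝓘(ℝ, F →L[ℝ] ℝ) 𝓘(ℝ, F) ∞
          (fun u => coalgebraAction P (-((1 / 2 : ℝ) • u))) :=
        (contMDiff_coalgebraAction P).comp (contDiff_const_smul (1 / 2 : ℝ)).neg.contMDiff
      exact (((contMDiff_fst.comp contMDiff_fst).add (contMDiff_fst.comp contMDiff_snd)).prodMk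
        ((contMDiff_action E F M T).comp ((h1.comp (contMDiff_fst.comp contMDiff_snd)).prodMk
          (contMDiff_snd.comp contMDiff_fst)))).contMDiffOn
    source_unit x := by
      change coalgebraAction P (-((1 / 2 : ℝ) • (0 : F →L[ℝ] ℝ))) • x = x
      rw [smul_zero, neg_zero, h0]
    target_unit x := by
      change coalgebraAction P ((1 / 2 : ℝ) • (0 : F →L[ℝ] ℝ)) • x = x
      rw [smul_zero, h0]
    source_inv z := by
      change coalgebraAction P (-((1 / 2 : ℝ) • -z.1)) • z.2 = coalgebraAction P _ • z.2
      congr 2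
      module
    target_inv z := by
      change coalgebraAction P ((1 / 2 : ℝ) • -z.1) • z.2 = coalgebraAction P _ • z.2
      congr 2
      module
    source_mul z w h := by
      change coalgebraAction P _ • coalgebraAction P _ • z.2 = coalgebraAction P _ • w.2
      rw [hc h, hR, hR]
      congr 2
      change -((1 / 2 : ℝ) • (z.1 + w.1)) + -((1 / 2 : ℝ) • w.1) + (1 / 2 : ℝ) • (z.1 + w.1) = _
      module
    target_mul z w h := by
      change coalgebraAction P _ • coalgebraAction P _ • z.2 = coalgebraAction P _ • z.2
      rw [hR]
      congr 2
      change (1 / 2 : ℝ) • (z.1 + w.1) + _ = _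
      module
    mul_assoc z w y h h' := by
      refine Prod.ext (add_assoc _ _ _) ?_
      change coalgebraAction P _ • coalgebraAction P _ • z.2 = coalgebraAction P _ • z.2
      rw [hR]
      congr 2
      change _ = -((1 / 2 : ℝ) • (w.1 + y.1))
      module
    unit_mul z := by
      refine Prod.ext (zero_add _) ?_
      change coalgebraAction P _ • coalgebraAction P _ • z.2 = z.2
      rw [hR, neg_add_cancel, h0]
    mul_unit z := by
      refine Prod.ext (add_zero _) ?_
      change coalgebraAction P (-((1 / 2 : ℝ) • (0 : F →L[ℝ] ℝ))) • z.2 = z.2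
      rw [smul_zero, neg_zero, h0]
    inv_mul z := by
      refine Prod.ext (neg_add_cancel _) ?_
      rfl
    mul_inv z := by
      refine Prod.ext (add_neg_cancel _) ?_
      change coalgebraAction P (-((1 / 2 : ℝ) • -z.1)) • z.2 = coalgebraAction P _ • z.2
      congr 2
      module }

/-- The momentum map and the projection of the cotangent bundle define a homomorphism from the
groupoid `T*M` to the action groupoid. -/
theorem isLieGroupoidHom_momentumProj :
    IsLieGroupoidHom (cotangentModel E) 𝓘(ℝ, E) (𝓘(ℝ, F →L[ℝ] ℝ).prod 𝓘(ℝ, E)) 𝓘(ℝ, E)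
      (cotangentGroupoid P : GroupoidMaps (CotangentBundle E M) M) (actionGroupoid P)
      (momentumProj T) id where
  isLieGroupoid_dom := isLieGroupoid_cotangentGroupoid P
  isLieGroupoid_cod := isLieGroupoid_actionGroupoid P
  smooth := (contMDiff_momentum E M).prodMk (contMDiff_cotangent_proj E M)
  smooth_obj := contMDiff_id
  map_source ξ := by
    change coalgebraAction P _ • ξ.1 = (cotangentGroupoid P).source ξ
    rw [cotangentGroupoid_source]
    congr 2
    exact (neg_smul _ _).symm
  map_target ξ := rfl
  map_unit x := rfl
  map_inv ξ := rfl
  map_mul ξ ζ h := by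
    refine Prod.ext (momentum_mul P h) ?_
    change ((cotangentGroupoid P).mul ξ ζ).1 =
      coalgebraAction P (-((1 / 2 : ℝ) • momentum T ζ)) • ξ.1
    rw [proj_mul, proj_eq_of_composable P h, coalgebraAction_smul_smul]
    congr 2
    module

end Groupoids

/-! ### Transport by a variable group element and the canonical form -/

section TransportForm

variable {E : Type*} [NormedAddCommGroup E] [NormedSpace ℝ E]
  {F : Type*} [NormedAddCommGroup F] [NormedSpace ℝ F] [FiniteDimensional ℝ F]
  {M : Type*} [TopologicalSpace M] [ChartedSpace E M] [IsManifold 𝓘(ℝ, E) ∞ M]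
  {T : Type*} [TopologicalSpace T] [ChartedSpace F T] [CommGroup T] [LieGroup 𝓘(ℝ, F) ∞ T]
  [T2Space T]
  [MulAction T M] [ContMDiffSMul 𝓘(ℝ, F) 𝓘(ℝ, E) ∞ T M]
  (P : ⋀[ℝ]^2 (GroupLieAlgebra 𝓘(ℝ, F) T))
  {W : Type*} [NormedAddCommGroup W] [NormedSpace ℝ W]

theorem mfderiv_coalgebraAction_of_eq_zero {u : F →L[ℝ] ℝ} (hu : u = 0) (v : F →L[ℝ] ℝ) :
    mfderiv 𝓘(ℝ, F →L[ℝ] ℝ) 𝓘(ℝ, F) (coalgebraAction P) u v = sharpCLM (F := F) P v := by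
  subst hu
  exact mfderiv_coalgebraAction_zero P v

/-- Where `r` vanishes, the derivative of `w ↦ R_{r(w)} x(w)` is the sum of that of `x` and of the
infinitesimal action of `#dr`. -/
theorem mfderiv_coalgebraAction_smul {r : W → F →L[ℝ] ℝ} {x : W → M} {w : W}
    (hr : DifferentiableAt ℝ r w) (hx : MDifferentiableAt 𝓘(ℝ, W) 𝓘(ℝ, E) x w) (h0 : r w = 0)
    (δ : W) :
    mfderiv 𝓘(ℝ, W) 𝓘(ℝ, E) (fun w => coalgebraAction P (r w) • x w) w δ =
      ((show E from infinitesimalAction (T := T) (E := E) (x w)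
          (sharpCLM (F := F) P (fderiv ℝ r w δ))) +
        (show E from mfderiv 𝓘(ℝ, W) 𝓘(ℝ, E) x w δ) : E) := by
  have hR : MDifferentiableAt 𝓘(ℝ, F →L[ℝ] ℝ) 𝓘(ℝ, F) (coalgebraAction P) (r w) :=
    (contMDiff_coalgebraAction P).mdifferentiable (by simp) _
  have hg : MDifferentiableAt 𝓘(ℝ, W) 𝓘(ℝ, F) (fun w => coalgebraAction P (r w)) w :=
    ((contMDiff_coalgebraAction P).mdifferentiable (by simp) _).comp w hr.mdifferentiableAt
  have hg1 : coalgebraAction P (r w) = 1 := by rw [h0, coalgebraAction_zero]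
  have h1 := mfderiv_comp_apply_of_eq (I' := 𝓘(ℝ, F).prod 𝓘(ℝ, E)) (x := w) (y := (1, x w))
    (f := fun w => (coalgebraAction P (r w), x w)) (g := fun p : T × M => p.1 • p.2)
    ((contMDiff_action E F M T).mdifferentiable (by simp) _) (hg.prodMk hx) (by rw [hg1]) δ
  have h2 := mfderiv_prod_eq_add_apply (I := 𝓘(ℝ, F)) (I' := 𝓘(ℝ, E)) (p := ((1 : T), x w))
    ((contMDiff_action E F M T).mdifferentiable (by simp) (1, x w))
    (v := ((show F from mfderiv 𝓘(ℝ, W) 𝓘(ℝ, F) (fun w => coalgebraAction P (r w)) w δ),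
      (show E from mfderiv 𝓘(ℝ, W) 𝓘(ℝ, E) x w δ)))
  have h3 := (mfderiv_comp_apply (I' := 𝓘(ℝ, F →L[ℝ] ℝ)) w (f := r) (g := coalgebraAction P)
    hR hr.mdifferentiableAt δ).trans (mfderiv_coalgebraAction_of_eq_zero P h0 _)
  rw [mfderiv_eq_fderiv] at h3
  have h5 : mfderiv 𝓘(ℝ, W) (𝓘(ℝ, F).prod 𝓘(ℝ, E)) (fun w => (coalgebraAction P (r w), x w)) w δ =
      ((show F from mfderiv 𝓘(ℝ, W) 𝓘(ℝ, F) (fun w => coalgebraAction P (r w)) w δ),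
        (show E from mfderiv 𝓘(ℝ, W) 𝓘(ℝ, E) x w δ)) := by
    rw [mfderiv_prodMk hg hx]; rfl
  have e : (fun y : M => (1 : T) • y) = id := by ext y; exact one_smul T y
  refine h1.trans ((congrArg _ h5).trans (h2.trans ?_))
  refine congrArg₂ (fun a b : E => a + b) ?_ ?_
  · refine Eq.trans ?_ (infinitesimalAction_apply (T := T) (E := E) (x w) _).symm
    exact congrArg (mfderiv 𝓘(ℝ, F) 𝓘(ℝ, E) (fun g : T => g • x w) 1) h3
  · change mfderiv 𝓘(ℝ, E) 𝓘(ℝ, E) (fun y : M => (1 : T) • y) (x w) _ = _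
    rw [e, mfderiv_id]
    rfl

theorem covectorTransport_apply_mfderiv_smul (F : Type*) [NormedAddCommGroup F] [NormedSpace ℝ F]
    [ChartedSpace F T] [ContMDiffSMul 𝓘(ℝ, F) 𝓘(ℝ, E) ∞ T M] (g : T) {η : CotangentBundle E M}
    {x : W → M} {w : W}
    (hx : MDifferentiableAt 𝓘(ℝ, W) 𝓘(ℝ, E) x w) (hw : x w = η.1) (δ : W) :
    (covectorTransport g η).2 (mfderiv 𝓘(ℝ, W) 𝓘(ℝ, E) (fun w => g • x w) w δ) =
      η.2 (mfderiv 𝓘(ℝ, W) 𝓘(ℝ, E) x w δ) := by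
  have h1 := mfderiv_comp_apply_of_eq (I' := 𝓘(ℝ, E)) (x := w) (y := η.1)
    (f := x) (g := fun y : M => g • y)
    ((contMDiff_action_left E F g).mdifferentiable (by simp) _) hx hw δ
  exact (congrArg (show E →L[ℝ] ℝ from (covectorTransport g η).2) h1).trans
    (covectorTransport_apply_mfderiv F g η _)

theorem liouvillePullback_apply (c : W → CotangentBundle E M) (w δ : W) :
    liouvillePullback c w δ = (c w).2 (mfderiv 𝓘(ℝ, W) 𝓘(ℝ, E) (fun w => (c w).1) w δ) := rfl

/-- The pullback of the Liouville form by `w ↦ R_{r(w)}^* σ(w)`: invariance of the Liouville form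
under the group leaves the term `Π(dr, ρ*σ)` coming from the variation of the group element. -/
theorem liouvillePullback_covectorTransport {r : W → F →L[ℝ] ℝ} {σ : W → CotangentBundle E M}
    {w : W} (hr : DifferentiableAt ℝ r w)
    (hσ : MDifferentiableAt 𝓘(ℝ, W) 𝓘(ℝ, E) (fun w => (σ w).1) w) :
    liouvillePullback (fun w => covectorTransport (coalgebraAction P (r w)) (σ w)) w =
      liouvillePullback σ w +
        (momentum T (σ w)).comp ((sharpCLM (F := F) P).comp (fderiv ℝ r w)) := by
  refine ContinuousLinearMap.ext fun δ => ?_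
  have hr' : DifferentiableAt ℝ (fun w' => r w' - r w) w := hr.sub_const _
  have hx : MDifferentiableAt 𝓘(ℝ, W) 𝓘(ℝ, E)
      (fun w' => coalgebraAction P (r w' - r w) • (σ w').1) w := by
    have h := (((contMDiff_coalgebraAction P).mdifferentiable (by simp) _).comp w
      hr'.mdifferentiableAt).prodMk hσ
    exact ((contMDiff_action E F M T).mdifferentiable (by simp) _).comp w h
  -- split off the constant transport by `R_{r(w)}`; the remaining exponent vanishes at `w`
  have e : (fun w' => coalgebraAction P (r w') • (σ w').1) =
      fun w' => coalgebraAction P (r w) • coalgebraAction P (r w' - r w) • (σ w').1 := by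
    funext w'
    rw [coalgebraAction_smul_smul, add_sub_cancel]
  have hw : coalgebraAction P (r w - r w) • (σ w).1 = (σ w).1 := by
    rw [sub_self, coalgebraAction_zero, one_smul]
  have h1 := covectorTransport_apply_mfderiv_smul F (coalgebraAction P (r w)) hx hw δ
  rw [← e] at h1
  have h2 := mfderiv_coalgebraAction_smul P (T := T) hr' hσ (sub_self _) δ
  rw [fderiv_sub_const] at h2
  rw [liouvillePullback_apply]
  refine h1.trans ((congrArg (show E →L[ℝ] ℝ from (σ w).2) h2).trans ?_)
  exact (map_add (show E →L[ℝ] ℝ from (σ w).2) _ _).trans (add_comm _ _)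

/-- The exterior derivative of `a + v(S dr)`: the second derivatives of `r` cancel. -/
theorem fderiv_add_comp_fderiv_sub_swap {G : Type*} [NormedAddCommGroup G] [NormedSpace ℝ G]
    {a : W → W →L[ℝ] ℝ} {v : W → F →L[ℝ] ℝ} {r : W → G} {w : W} (ha : DifferentiableAt ℝ a w)
    (hv : DifferentiableAt ℝ v w) (S : G →L[ℝ] F) (hr : ContDiffAt ℝ ∞ r w) (δ₁ δ₂ : W) :
    fderiv ℝ (fun w => a w + (v w).comp (S.comp (fderiv ℝ r w))) w δ₂ δ₁ -
        fderiv ℝ (fun w => a w + (v w).comp (S.comp (fderiv ℝ r w))) w δ₁ δ₂ =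
      fderiv ℝ a w δ₂ δ₁ - fderiv ℝ a w δ₁ δ₂ +
        (fderiv ℝ v w δ₂ (S (fderiv ℝ r w δ₁)) - fderiv ℝ v w δ₁ (S (fderiv ℝ r w δ₂))) := by
  have hdr : DifferentiableAt ℝ (fderiv ℝ r) w :=
    (hr.fderiv_right (m := ∞) (by simp)).differentiableAt (by simp)
  have hS : DifferentiableAt ℝ (fun w => S.comp (fderiv ℝ r w)) w :=
    (differentiableAt_const _).clm_comp hdr
  have hsymm : fderiv ℝ (fderiv ℝ r) w δ₁ δ₂ = fderiv ℝ (fderiv ℝ r) w δ₂ δ₁ :=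
    (hr.isSymmSndFDerivAt (by simpa using ENat.LEInfty.out)).eq δ₁ δ₂
  rw [fderiv_fun_add ha (hv.clm_comp hS), fderiv_clm_comp hv hS,
    fderiv_clm_comp (differentiableAt_const _) hdr]
  simp only [add_apply, ContinuousLinearMap.comp_apply,
    ContinuousLinearMap.compL_apply, ContinuousLinearMap.flip_apply, hsymm]
  simp
  ring

set_option maxHeartbeats 1000000 in
/-- The pullback of the canonical form by `w ↦ R_{r(w)}^* σ(w)` is `σ^*ω` plus the terms in `Π` that
involve one derivative of `r` and one of `ρ*σ`. -/
theorem canonicalForm_covectorTransport {r : W → F →L[ℝ] ℝ} {σ : W → CotangentBundle E M}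
    {w : W} (hr : ContDiffAt ℝ ∞ r w) (hσ : ContMDiffAt 𝓘(ℝ, W) (cotangentModel E) ∞ σ w)
    (δ₁ δ₂ : W) :
    canonicalForm (covectorTransport (coalgebraAction P (r w)) (σ w))
        ![mfderiv 𝓘(ℝ, W) (cotangentModel E)
            (fun w => covectorTransport (coalgebraAction P (r w)) (σ w)) w δ₁,
          mfderiv 𝓘(ℝ, W) (cotangentModel E)
            (fun w => covectorTransport (coalgebraAction P (r w)) (σ w)) w δ₂] =
      canonicalForm (σ w) ![mfderiv 𝓘(ℝ, W) (cotangentModel E) σ w δ₁,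
          mfderiv 𝓘(ℝ, W) (cotangentModel E) σ w δ₂] +
        (fderiv ℝ (fun w => momentum (F := F) T (σ w)) w δ₂
            (sharpCLM (F := F) P (fderiv ℝ r w δ₁)) -
          fderiv ℝ (fun w => momentum (F := F) T (σ w)) w δ₁
            (sharpCLM (F := F) P (fderiv ℝ r w δ₂))) := by
  have hΛ : ContMDiffAt 𝓘(ℝ, W) (cotangentModel E) ∞
      (fun w => covectorTransport (coalgebraAction P (r w)) (σ w)) w := by
    have h := ((contMDiff_coalgebraAction P) (r w)).comp w hr.contMDiffAt
    exact (contMDiff_covectorTransport E F M T _).comp w (h.prodMk hσ)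
  obtain ⟨d1, h1⟩ := canonicalForm_mfderiv hΛ
  obtain ⟨d2, h2⟩ := canonicalForm_mfderiv hσ
  refine (h1 δ₁ δ₂).trans (Eq.trans ?_ (congrArg (· + _) (h2 δ₁ δ₂)).symm)
  have hv : ContDiffAt ℝ ∞ (fun w => momentum (F := F) T (σ w)) w :=
    ((contMDiff_momentum E M _).comp w hσ).contDiffAt
  have he : liouvillePullback (fun w => covectorTransport (coalgebraAction P (r w)) (σ w)) =ᶠ[𝓝 w]
      fun w => liouvillePullback σ w +
        (momentum T (σ w)).comp ((sharpCLM (F := F) P).comp (fderiv ℝ r w)) := by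
    have e1 := (hr.of_le (m := 1) (by simp)).eventually (by simp)
    have hp : ContMDiffAt 𝓘(ℝ, W) 𝓘(ℝ, E) 1 (fun w => (σ w).1) w :=
      ((contMDiff_cotangent_proj E M _).comp w hσ).of_le (by simp)
    have e2 := (contMDiffAt_iff_contMDiffAt_nhds (by simp)).1 hp
    filter_upwards [e1, e2] with w' k1 k2
    refine liouvillePullback_covectorTransport P (k1.differentiableAt (by simp))
      (k2.mdifferentiableAt (by simp))
  rw [he.fderiv_eq]
  exact fderiv_add_comp_fderiv_sub_swap d2 (hv.differentiableAt (by simp)) _ hr δ₁ δ₂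

end TransportForm

/-! ### Derivatives as maps of the model spaces -/

section ModelDeriv

variable {E₁ : Type*} [NormedAddCommGroup E₁] [NormedSpace ℝ E₁]
  {H₁ : Type*} [TopologicalSpace H₁] {I₁ : ModelWithCorners ℝ E₁ H₁}
  {M₁ : Type*} [TopologicalSpace M₁] [ChartedSpace H₁ M₁]
  {E₂ : Type*} [NormedAddCommGroup E₂] [NormedSpace ℝ E₂]
  {H₂ : Type*} [TopologicalSpace H₂] {I₂ : ModelWithCorners ℝ E₂ H₂}
  {M₂ : Type*} [TopologicalSpace M₂] [ChartedSpace H₂ M₂]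
  {E₃ : Type*} [NormedAddCommGroup E₃] [NormedSpace ℝ E₃]
  {H₃ : Type*} [TopologicalSpace H₃] {I₃ : ModelWithCorners ℝ E₃ H₃}
  {M₃ : Type*} [TopologicalSpace M₃] [ChartedSpace H₃ M₃]

variable (I₁ I₂) in
/-- The derivative of `f` at `x` as a map of the model spaces, which are by definition the tangent
spaces; its type does not depend on `x`. -/
noncomputable def modelDeriv (f : M₁ → M₂) (x : M₁) : E₁ →L[ℝ] E₂ := mfderiv I₁ I₂ f x

theorem modelDeriv_comp {g : M₂ → M₃} {f : M₁ → M₂} {x : M₁} {y : M₂}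
    (hg : MDifferentiableAt I₂ I₃ g y) (hf : MDifferentiableAt I₁ I₂ f x) (h : f x = y) (v : E₁) :
    modelDeriv I₁ I₃ (fun z => g (f z)) x v = modelDeriv I₂ I₃ g y (modelDeriv I₁ I₂ f x v) :=
  mfderiv_comp_apply_of_eq (I' := I₂) x hg hf h v

theorem modelDeriv_id (x : M₁) (v : E₁) : modelDeriv I₁ I₁ (id : M₁ → M₁) x v = v := by
  rw [modelDeriv, mfderiv_id]
  rfl

theorem modelDeriv_congr {f g : M₁ → M₂} {x : M₁} (h : f =ᶠ[𝓝 x] g) :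
    modelDeriv I₁ I₂ f x = modelDeriv I₁ I₂ g x :=
  h.mfderiv_eq

theorem modelDeriv_eq_fderiv {f : E₁ → E₂} {x : E₁} :
    modelDeriv 𝓘(ℝ, E₁) 𝓘(ℝ, E₂) f x = fderiv ℝ f x :=
  mfderiv_eq_fderiv

end ModelDeriv

/-! ### Multiplicativity of the canonical form -/

section GroupoidDerivative

variable {E : Type*} [NormedAddCommGroup E] [NormedSpace ℝ E]
  {H : Type*} [TopologicalSpace H] {I : ModelWithCorners ℝ E H}
  {X : Type*} [TopologicalSpace X] [ChartedSpace H X]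
  {E' : Type*} [NormedAddCommGroup E'] [NormedSpace ℝ E']
  {H' : Type*} [TopologicalSpace H'] {J : ModelWithCorners ℝ E' H'}
  {M : Type*} [TopologicalSpace M] [ChartedSpace H' M]
  {W : Type*} [NormedAddCommGroup W] [NormedSpace ℝ W]

/-- The derivative of the product on the velocities of a family of composable pairs. -/
theorem IsLieGroupoid.mfderivWithin_mul {G : GroupoidMaps X M} (hG : IsLieGroupoid I J G)
    {c₁ c₂ : W → X} {w : W} (h₁ : MDifferentiableAt 𝓘(ℝ, W) I c₁ w)
    (h₂ : MDifferentiableAt 𝓘(ℝ, W) I c₂ w)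
    (hc : ∀ᶠ w in 𝓝 w, G.source (c₁ w) = G.target (c₂ w)) {ξ ζ : X} (hξ : c₁ w = ξ)
    (hζ : c₂ w = ζ) {a b : E} {δ : W} (ha : modelDeriv 𝓘(ℝ, W) I c₁ w δ = a)
    (hb : modelDeriv 𝓘(ℝ, W) I c₂ w δ = b) :
    (mfderivWithin (I.prod I) I (fun z : X × X => G.mul z.1 z.2) G.composable (ξ, ζ) (a, b) : E) =
      modelDeriv 𝓘(ℝ, W) I (fun w => G.mul (c₁ w) (c₂ w)) w δ := by
  subst hξ hζ ha hb
  obtain ⟨U, hU, hUo, hwU⟩ := eventually_nhds_iff.1 hc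
  have hm := ((hG.smooth_mul.mdifferentiableOn (by simp)) (c₁ w, c₂ w)
    (hU w hwU)).hasMFDerivWithinAt
  have hcc := (h₁.hasMFDerivAt.prodMk h₂.hasMFDerivAt).hasMFDerivWithinAt (s := U)
  have h := hm.comp w hcc (show U ⊆ (fun w => (c₁ w, c₂ w)) ⁻¹' G.composable from hU)
  have h' := (h.hasMFDerivAt (hUo.mem_nhds hwU)).mfderiv
  exact (congrArg (fun A : W →L[ℝ] E => A δ) h').symm

/-- Multiplicativity of a form which is given by the same expression `S` in all tangent spaces,
identified with the model space. -/
theorem isMultiplicative_of_forall_eq {k : ℕ} {G : GroupoidMaps X M} {Ω : DiffForm I k X}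
    {S : (Fin k → E) → ℝ} (hS : ∀ (ξ : X) (a : Fin k → E), Ω ξ a = S a)
    (h : ∀ ξ ζ : X, G.source ξ = G.target ζ → ∀ a b : Fin k → E,
      (∀ i, modelDeriv I J G.source ξ (a i) = modelDeriv I J G.target ζ (b i)) →
      S a - S (fun i => mfderivWithin (I.prod I) I (fun z : X × X => G.mul z.1 z.2) G.composable
        (ξ, ζ) (a i, b i)) + S b = 0) :
    IsMultiplicative J G Ω := fun ξ ζ hc a b hab =>
  (congrArg₂ (· + ·) (congrArg₂ (· - ·) (hS ξ a) (hS _ _)) (hS ζ b)).trans (h ξ ζ hc a b hab)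

end GroupoidDerivative

section ChartCovector

variable {E : Type*} [NormedAddCommGroup E] [NormedSpace ℝ E]
  {M : Type*} [TopologicalSpace M] [ChartedSpace E M] [IsManifold 𝓘(ℝ, E) ∞ M]

/-- In the chart of `T*M` centred at `ξ`, whose derivative at `ξ` is the identity of the model
space, the canonical form at `ξ` does not depend on `ξ`. -/
theorem canonicalForm_eq (ξ : CotangentBundle E M) (a : Fin 2 → E × (E →L[ℝ] ℝ)) :
    canonicalForm ξ a = modelSymplectic E a := by
  obtain ⟨v, w, rfl⟩ : ∃ v w, a = ![v, w] := ⟨a 0, a 1, by ext i <;> fin_cases i <;> rfl⟩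
  exact (canonicalForm_apply ξ v w).trans (modelSymplectic_apply v w).symm

theorem modelSymplectic_apply_fin (a : Fin 2 → E × (E →L[ℝ] ℝ)) :
    modelSymplectic E a = (a 1).2 (a 0).1 - (a 0).2 (a 1).1 := by
  rw [← modelSymplectic_apply]
  congr 1
  ext i <;> fin_cases i <;> rfl

/-- The covector with coordinates `(q, p)` in the chart at `x`; the charts of `T*M` at all covectors
over `x` coincide. -/
noncomputable def chartCovector (x : M) : E × (E →L[ℝ] ℝ) → CotangentBundle E M :=
  (extChartAt (cotangentModel E) (⟨x, 0⟩ : CotangentBundle E M)).symm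

theorem chartCovector_eq (x : M) (α : CotangentSpace E M x) :
    chartCovector x =
      (extChartAt (cotangentModel E) (⟨x, α⟩ : CotangentBundle E M)).symm := by
  rw [chartCovector, FiberBundle.extChartAt, FiberBundle.extChartAt]

theorem extChartAt_cotangent_self (x : M) (α : E →L[ℝ] ℝ) :
    extChartAt (cotangentModel E) (⟨x, α⟩ : CotangentBundle E M) ⟨x, α⟩ =
      (extChartAt 𝓘(ℝ, E) x x, α) := by
  rw [extChartAt_cotangent_apply]
  refine Prod.ext rfl (ContinuousLinearMap.ext fun v => ?_)
  have h := covectorCoord_mfderiv_extChartAt (x₀ := x) (ξ := (⟨x, α⟩ : CotangentBundle E M))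
    (mem_extChartAt_source (I := 𝓘(ℝ, E)) x) v
  have h2 := mfderiv_extChartAt_self (I := 𝓘(ℝ, E)) (x := x)
  rw [h2] at h
  exact h

theorem chartCovector_self (x : M) (α : E →L[ℝ] ℝ) :
    chartCovector x (extChartAt 𝓘(ℝ, E) x x, α) = (⟨x, α⟩ : CotangentBundle E M) := by
  rw [← extChartAt_cotangent_self, chartCovector_eq x α]
  exact extChartAt_to_inv (I := cotangentModel E) (⟨x, α⟩ : CotangentBundle E M)

theorem mfderiv_chartCovector (x : M) (α : E →L[ℝ] ℝ) (v : E × (E →L[ℝ] ℝ)) :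
    mfderiv 𝓘(ℝ, E × (E →L[ℝ] ℝ)) (cotangentModel E) (chartCovector x)
      (extChartAt 𝓘(ℝ, E) x x, α) v = v := by
  have h := mfderivWithin_range_extChartAt_symm (I := cotangentModel E)
    (x := (⟨x, α⟩ : CotangentBundle E M))
  rw [ModelWithCorners.range_eq_univ, mfderivWithin_univ] at h
  rw [chartCovector_eq x α, ← extChartAt_cotangent_self, h]
  rfl

theorem contMDiffAt_chartCovector {x : M} {z : E × (E →L[ℝ] ℝ)}
    (hz : z.1 ∈ (extChartAt 𝓘(ℝ, E) x).target) :
    ContMDiffAt 𝓘(ℝ, E × (E →L[ℝ] ℝ)) (cotangentModel E) ∞ (chartCovector x) z := by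
  refine contMDiffAt_extChartAt_cotangent_symm ?_
  rw [extChartAt_cotangent_target]
  exact ⟨hz, mem_univ _⟩

theorem chartCovector_proj {x : M} {z : E × (E →L[ℝ] ℝ)}
    (hz : z.1 ∈ (extChartAt 𝓘(ℝ, E) x).target) :
    (chartCovector x z).1 = (extChartAt 𝓘(ℝ, E) x).symm z.1 :=
  extChartAt_cotangent_symm_proj hz

theorem cotangentAdd_chartCovector {x : M} {q : E} (hq : q ∈ (extChartAt 𝓘(ℝ, E) x).target)
    (α β : E →L[ℝ] ℝ) :
    chartCovector x (q, α + β) =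
      cotangentAdd (chartCovector x (q, α)) (chartCovector x (q, β)) := by
  have hs : ∀ γ, (chartCovector x (q, γ)).1 ∈ (extChartAt 𝓘(ℝ, E) x).source := fun γ => by
    rw [chartCovector_proj hq]
    exact (extChartAt 𝓘(ℝ, E) x).map_target hq
  have hb : ∀ γ γ', (chartCovector x (q, γ)).1 = (chartCovector x (q, γ')).1 := fun γ γ' => by
    rw [chartCovector_proj hq, chartCovector_proj hq]
  have h : ∀ γ, covectorCoord x (chartCovector x (q, γ)) = γ := fun γ =>
    covectorCoord_extChartAt_symm (ξ₀ := (⟨x, 0⟩ : CotangentBundle E M)) hq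
  have hv : ∀ γ v, (chartCovector x (q, γ)).2 v = γ (mfderiv 𝓘(ℝ, E) 𝓘(ℝ, E)
      (extChartAt 𝓘(ℝ, E) x) (chartCovector x (q, γ)).1 v) := fun γ v => by
    rw [← covectorCoord_mfderiv_extChartAt (hs γ) v, h]
  refine cotangent_ext ((hb _ _).trans (cotangentAdd_proj _ _).symm) fun v => ?_
  refine Eq.trans ?_ (cotangentAdd_apply (hb _ _) v).symm
  refine (hv _ v).trans (Eq.trans ?_ (congrArg₂ (· + ·) (hv α v) (hv β v)).symm)
  rw [hb α (α + β), hb β (α + β)]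
  rfl

variable {W : Type*} [NormedAddCommGroup W] [NormedSpace ℝ W]

theorem contMDiffAt_chartCovector_comp {x : M} {α : E →L[ℝ] ℝ} (L : W →L[ℝ] E × (E →L[ℝ] ℝ))
    {w : W} (hL : L w = (extChartAt 𝓘(ℝ, E) x x, α)) :
    ContMDiffAt 𝓘(ℝ, W) (cotangentModel E) ∞ (fun w => chartCovector x (L w)) w := by
  have h : (L w).1 ∈ (extChartAt 𝓘(ℝ, E) x).target := by
    rw [hL]; exact mem_extChartAt_target x
  exact (contMDiffAt_chartCovector h).comp w L.contMDiff.contMDiffAt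

theorem modelDeriv_chartCovector_comp {x : M} {α : E →L[ℝ] ℝ} (L : W →L[ℝ] E × (E →L[ℝ] ℝ))
    {w : W} (hL : L w = (extChartAt 𝓘(ℝ, E) x x, α)) (δ : W) :
    modelDeriv 𝓘(ℝ, W) (cotangentModel E) (fun w => chartCovector x (L w)) w δ = L δ := by
  have h : (extChartAt 𝓘(ℝ, E) x x, α).1 ∈ (extChartAt 𝓘(ℝ, E) x).target :=
    mem_extChartAt_target x
  rw [modelDeriv_comp ((contMDiffAt_chartCovector h).mdifferentiableAt (by simp))
    L.differentiableAt.mdifferentiableAt hL δ, modelDeriv_eq_fderiv, L.fderiv]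
  exact mfderiv_chartCovector x α (L δ)

end ChartCovector

section Multiplicativity

variable {E : Type*} [NormedAddCommGroup E] [NormedSpace ℝ E]
  {F : Type*} [NormedAddCommGroup F] [NormedSpace ℝ F] [FiniteDimensional ℝ F]
  {M : Type*} [TopologicalSpace M] [ChartedSpace E M] [IsManifold 𝓘(ℝ, E) ∞ M]
  {T : Type*} [TopologicalSpace T] [ChartedSpace F T] [CommGroup T] [LieGroup 𝓘(ℝ, F) ∞ T]
  [T2Space T]
  [MulAction T M] [ContMDiffSMul 𝓘(ℝ, F) 𝓘(ℝ, E) ∞ T M]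
  (P : ⋀[ℝ]^2 (GroupLieAlgebra 𝓘(ℝ, F) T))
  {W : Type*} [NormedAddCommGroup W] [NormedSpace ℝ W]

theorem source_momentumFlow_half (ξ : CotangentBundle E M) :
    (cotangentGroupoid P).source (momentumFlow P (1 / 2) ξ) = ξ.1 := by
  rw [cotangentGroupoid_source_eq, momentumFlow_neg_self]

theorem target_momentumFlow_neg_half (ξ : CotangentBundle E M) :
    (cotangentGroupoid P).target (momentumFlow P (-(1 / 2)) ξ) = ξ.1 := by
  rw [cotangentGroupoid_target_eq, momentumFlow_self_neg]

/-- In terms of covectors at the common point `s(ξ) = t(ζ)` the product is the addition followed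
by a transport. -/
theorem mul_momentumFlow {ξ ζ : CotangentBundle E M} (h : ξ.1 = ζ.1) :
    (cotangentGroupoid P).mul (momentumFlow P (1 / 2) ξ) (momentumFlow P (-(1 / 2)) ζ) =
      covectorTransport (coalgebraAction P ((1 / 2 : ℝ) • (momentum T ξ - momentum T ζ)))
        (cotangentAdd ξ ζ) := by
  rw [cotangentGroupoid_mul_eq, momentum_momentumFlow, momentum_momentumFlow,
    momentumFlow, momentumFlow, covectorTransport_coalgebraAction,
    covectorTransport_coalgebraAction, cotangentAdd_comm h, covectorTransport_cotangentAdd _ h.symm]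
  have e {u w : F →L[ℝ] ℝ} (h : u = w) (x : CotangentBundle E M) :
      covectorTransport (coalgebraAction P u) x = covectorTransport (coalgebraAction P w) x := by
    rw [h]
  exact congrArg₂ cotangentAdd (e (by module) ζ) (e (by module) ξ)

/-- The mixed terms in `u` and `w` cancel by the antisymmetry of `Π`. -/
theorem apply_sharpCLM_half_sub (P : ⋀[ℝ]^2 F) (u₀ u₁ w₀ w₁ : F →L[ℝ] ℝ) :
    (u₁ + w₁) (sharpCLM P ((1 / 2 : ℝ) • (u₀ - w₀))) -
        (u₀ + w₀) (sharpCLM P ((1 / 2 : ℝ) • (u₁ - w₁))) =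
      u₁ (sharpCLM P u₀) - w₁ (sharpCLM P w₀) := by
  simp only [map_smul, map_sub, add_apply, smul_eq_mul]
  rw [apply_sharpCLM_swap P u₁ u₀, apply_sharpCLM_swap P w₁ u₀, apply_sharpCLM_swap P u₁ w₀,
    apply_sharpCLM_swap P w₁ w₀]
  ring

theorem modelSymplectic_covectorTransport {r : W → F →L[ℝ] ℝ} {σ : W → CotangentBundle E M}
    {w : W} (hr : ContDiffAt ℝ ∞ r w) (hσ : ContMDiffAt 𝓘(ℝ, W) (cotangentModel E) ∞ σ w)
    (δ : Fin 2 → W) :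
    modelSymplectic E (fun i => modelDeriv 𝓘(ℝ, W) (cotangentModel E)
        (fun w => covectorTransport (coalgebraAction P (r w)) (σ w)) w (δ i)) =
      modelSymplectic E (fun i => modelDeriv 𝓘(ℝ, W) (cotangentModel E) σ w (δ i)) +
        (fderiv ℝ (fun w => momentum (F := F) T (σ w)) w (δ 1)
            (sharpCLM (F := F) P (fderiv ℝ r w (δ 0))) -
          fderiv ℝ (fun w => momentum (F := F) T (σ w)) w (δ 0)
            (sharpCLM (F := F) P (fderiv ℝ r w (δ 1)))) := by
  have h := canonicalForm_covectorTransport P hr hσ (δ 0) (δ 1)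
  rw [modelSymplectic_apply_fin, modelSymplectic_apply_fin]
  refine Eq.trans ?_ (h.trans (congrArg (· + _) ?_))
  · exact (canonicalForm_apply _ _ _).symm
  · exact canonicalForm_apply _ _ _

/-- `A_c^* ω = ω + 2c (ρ*)^* Π`, on the velocities of a family `σ` of covectors. -/
theorem modelSymplectic_momentumFlow (c : ℝ) {σ : W → CotangentBundle E M} {w : W}
    (hσ : ContMDiffAt 𝓘(ℝ, W) (cotangentModel E) ∞ σ w) (δ : Fin 2 → W) :
    modelSymplectic E (fun i => modelDeriv 𝓘(ℝ, W) (cotangentModel E)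
        (fun w => momentumFlow P c (σ w)) w (δ i)) =
      modelSymplectic E (fun i => modelDeriv 𝓘(ℝ, W) (cotangentModel E) σ w (δ i)) +
        2 * c * fderiv ℝ (fun w => momentum (F := F) T (σ w)) w (δ 1)
            (sharpCLM (F := F) P (fderiv ℝ (fun w => momentum (F := F) T (σ w)) w (δ 0))) := by
  have hv : ContDiffAt ℝ ∞ (fun w => momentum (F := F) T (σ w)) w :=
    ((contMDiff_momentum E M _).comp w hσ).contDiffAt
  have hd : fderiv ℝ (fun w => c • momentum (F := F) T (σ w)) w =
      c • fderiv ℝ (fun w => momentum (F := F) T (σ w)) w :=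
    fderiv_const_smul (hv.differentiableAt (by simp)) c
  refine (modelSymplectic_covectorTransport P (r := fun w => c • momentum (F := F) T (σ w))
    ((contDiff_const_smul c).contDiffAt.comp w hv) hσ δ).trans (congrArg (_ + ·) ?_)
  rw [hd]
  simp only [FunLike.coe_smul, Pi.smul_apply, map_smul, smul_eq_mul]
  rw [apply_sharpCLM_swap (F := F) P (fderiv ℝ (fun w => momentum (F := F) T (σ w)) w (δ 1))]
  ring

theorem modelDeriv_momentumFlow_momentumFlow {c d : ℝ} (hcd : c + d = 0)
    {ξ ζ : CotangentBundle E M} (hζ : momentumFlow P d ξ = ζ) (v : E × (E →L[ℝ] ℝ)) :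
    modelDeriv (cotangentModel E) (cotangentModel E) (momentumFlow P c) ζ
      (modelDeriv (cotangentModel E) (cotangentModel E) (momentumFlow P d) ξ v) = v := by
  rw [← modelDeriv_comp ((contMDiff_momentumFlow P c).mdifferentiable (by simp) _)
    ((contMDiff_momentumFlow P d).mdifferentiable (by simp) _) hζ v]
  have e : (fun η : CotangentBundle E M => momentumFlow P c (momentumFlow P d η)) = id := by
    funext η
    rw [momentumFlow_add, hcd, momentumFlow_zero, id]
  rw [e, modelDeriv_id]

theorem modelDeriv_momentumFlow_proj (c : ℝ) (ξ : CotangentBundle E M) (v : E × (E →L[ℝ] ℝ)) :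
    modelDeriv (cotangentModel E) 𝓘(ℝ, E)
        (fun η : CotangentBundle E M => (momentumFlow P c η).1) ξ v =
      (modelDeriv (cotangentModel E) (cotangentModel E) (momentumFlow P c) ξ v).1 :=
  (modelDeriv_comp ((contMDiff_cotangent_proj E M).mdifferentiable (by simp) _)
    ((contMDiff_momentumFlow P c).mdifferentiable (by simp) _) rfl v).trans
    (mfderiv_cotangent_proj _ _)

theorem modelDeriv_momentumFlow_chartCovector (c : ℝ) {x : M} {α : E →L[ℝ] ℝ}
    (L : W →L[ℝ] E × (E →L[ℝ] ℝ)) {w : W} (hL : L w = (extChartAt 𝓘(ℝ, E) x x, α)) (δ : W) :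
    modelDeriv 𝓘(ℝ, W) (cotangentModel E) (fun w => momentumFlow P c (chartCovector x (L w))) w δ =
      modelDeriv (cotangentModel E) (cotangentModel E) (momentumFlow P c)
        (⟨x, α⟩ : CotangentBundle E M) (L δ) := by
  have hσ := (contMDiffAt_chartCovector_comp L hL).mdifferentiableAt (by simp)
  rw [modelDeriv_comp ((contMDiff_momentumFlow P c).mdifferentiable (by simp) _) hσ
    (y := (⟨x, α⟩ : CotangentBundle E M)) (by rw [hL, chartCovector_self]) δ,
    modelDeriv_chartCovector_comp L hL]

/-- The velocity of the product of a family of composable pairs, parametrized by two families of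
covectors at the same points. -/
theorem mfderivWithin_mul_momentumFlow {σ₁ σ₂ σ₃ : W → CotangentBundle E M} {w : W}
    (h₁ : MDifferentiableAt 𝓘(ℝ, W) (cotangentModel E) σ₁ w)
    (h₂ : MDifferentiableAt 𝓘(ℝ, W) (cotangentModel E) σ₂ w)
    (hbase : ∀ᶠ w in 𝓝 w, (σ₁ w).1 = (σ₂ w).1)
    (hadd : ∀ᶠ w in 𝓝 w, σ₃ w = cotangentAdd (σ₁ w) (σ₂ w))
    {ξ ζ : CotangentBundle E M} (hξ : momentumFlow P (1 / 2) (σ₁ w) = ξ)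
    (hζ : momentumFlow P (-(1 / 2)) (σ₂ w) = ζ) {a b : E × (E →L[ℝ] ℝ)} {δ : W}
    (ha : modelDeriv 𝓘(ℝ, W) (cotangentModel E) (fun w => momentumFlow P (1 / 2) (σ₁ w)) w δ = a)
    (hb : modelDeriv 𝓘(ℝ, W) (cotangentModel E)
      (fun w => momentumFlow P (-(1 / 2)) (σ₂ w)) w δ = b) :
    (mfderivWithin ((cotangentModel E).prod (cotangentModel E)) (cotangentModel E)
        (fun z : CotangentBundle E M × CotangentBundle E M => (cotangentGroupoid P).mul z.1 z.2)
        (cotangentGroupoid P).composable (ξ, ζ) (a, b) : E × (E →L[ℝ] ℝ)) =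
      modelDeriv 𝓘(ℝ, W) (cotangentModel E)
        (fun w => covectorTransport (coalgebraAction P ((1 / 2 : ℝ) •
          (momentum (F := F) T (σ₁ w) - momentum (F := F) T (σ₂ w)))) (σ₃ w)) w δ := by
  have hc : ∀ᶠ w in 𝓝 w, (cotangentGroupoid P).source (momentumFlow P (1 / 2) (σ₁ w)) =
      (cotangentGroupoid P).target (momentumFlow P (-(1 / 2)) (σ₂ w)) := by
    filter_upwards [hbase] with w hw
    rw [source_momentumFlow_half, target_momentumFlow_neg_half, hw]
  have d₁ : MDifferentiableAt 𝓘(ℝ, W) (cotangentModel E)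
      (fun w => momentumFlow P (1 / 2) (σ₁ w)) w :=
    ((contMDiff_momentumFlow P _).mdifferentiable (by simp) _).comp w h₁
  have d₂ : MDifferentiableAt 𝓘(ℝ, W) (cotangentModel E)
      (fun w => momentumFlow P (-(1 / 2)) (σ₂ w)) w :=
    ((contMDiff_momentumFlow P _).mdifferentiable (by simp) _).comp w h₂
  have hev : (fun w => (cotangentGroupoid P).mul (momentumFlow P (1 / 2) (σ₁ w))
      (momentumFlow P (-(1 / 2)) (σ₂ w))) =ᶠ[𝓝 w] fun w => covectorTransport (coalgebraAction P
        ((1 / 2 : ℝ) • (momentum (F := F) T (σ₁ w) - momentum (F := F) T (σ₂ w)))) (σ₃ w) := by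
    filter_upwards [hbase, hadd] with w hw hw'
    rw [mul_momentumFlow P hw, hw']
  rw [← modelDeriv_congr hev]
  exact (isLieGroupoid_cotangentGroupoid P).mfderivWithin_mul d₁ d₂ hc hξ hζ ha hb

/-- The canonical form on velocities of the product of two families of covectors: it is additive
up to the terms produced by the transports. -/
theorem modelSymplectic_mul_momentumFlow {σ₁ σ₂ σ₃ : W → CotangentBundle E M} {w : W}
    (h₁ : ContMDiffAt 𝓘(ℝ, W) (cotangentModel E) ∞ σ₁ w)
    (h₂ : ContMDiffAt 𝓘(ℝ, W) (cotangentModel E) ∞ σ₂ w)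
    (h₃ : ContMDiffAt 𝓘(ℝ, W) (cotangentModel E) ∞ σ₃ w)
    (hbase : ∀ᶠ w in 𝓝 w, (σ₁ w).1 = (σ₂ w).1)
    (hadd : ∀ᶠ w in 𝓝 w, σ₃ w = cotangentAdd (σ₁ w) (σ₂ w)) (δ : Fin 2 → W) :
    modelSymplectic E (fun i => modelDeriv 𝓘(ℝ, W) (cotangentModel E)
        (fun w => covectorTransport (coalgebraAction P ((1 / 2 : ℝ) •
          (momentum (F := F) T (σ₁ w) - momentum (F := F) T (σ₂ w)))) (σ₃ w)) w (δ i)) =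
      modelSymplectic E (fun i => modelDeriv 𝓘(ℝ, W) (cotangentModel E) σ₃ w (δ i)) +
        (fderiv ℝ (fun w => momentum (F := F) T (σ₁ w)) w (δ 1)
            (sharpCLM (F := F) P (fderiv ℝ (fun w => momentum (F := F) T (σ₁ w)) w (δ 0))) -
          fderiv ℝ (fun w => momentum (F := F) T (σ₂ w)) w (δ 1)
            (sharpCLM (F := F) P (fderiv ℝ (fun w => momentum (F := F) T (σ₂ w)) w (δ 0)))) := by
  have hV {σ : W → CotangentBundle E M} (hσ : ContMDiffAt 𝓘(ℝ, W) (cotangentModel E) ∞ σ w) :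
      ContDiffAt ℝ ∞ (fun w => momentum (F := F) T (σ w)) w :=
    ((contMDiff_momentum E M _).comp w hσ).contDiffAt
  have hd₁ := (hV h₁).differentiableAt (by simp)
  have hd₂ := (hV h₂).differentiableAt (by simp)
  have hD₃ : fderiv ℝ (fun w => momentum (F := F) T (σ₃ w)) w =
      fderiv ℝ (fun w => momentum (F := F) T (σ₁ w)) w +
        fderiv ℝ (fun w => momentum (F := F) T (σ₂ w)) w := by
    rw [← fderiv_fun_add hd₁ hd₂]
    refine Filter.EventuallyEq.fderiv_eq ?_
    filter_upwards [hbase, hadd] with w hw hw'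
    rw [← momentum_cotangentAdd hw, hw']
  have hDr : fderiv ℝ (fun w => (1 / 2 : ℝ) • (momentum (F := F) T (σ₁ w) -
      momentum (F := F) T (σ₂ w))) w = (1 / 2 : ℝ) •
      (fderiv ℝ (fun w => momentum (F := F) T (σ₁ w)) w -
        fderiv ℝ (fun w => momentum (F := F) T (σ₂ w)) w) := by
    rw [← fderiv_fun_sub hd₁ hd₂]
    exact fderiv_fun_const_smul (hd₁.fun_sub hd₂) _
  refine (modelSymplectic_covectorTransport P
    (r := fun w => (1 / 2 : ℝ) • (momentum (F := F) T (σ₁ w) - momentum (F := F) T (σ₂ w)))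
    ((contDiff_const_smul (1 / 2 : ℝ)).contDiffAt.comp w ((hV h₁).sub (hV h₂))) h₃ δ).trans ?_
  rw [hD₃, hDr]
  exact congrArg (_ + ·) (apply_sharpCLM_half_sub (F := F) P _ _ _ _)

/-- The canonical form is multiplicative. A composable pair is parametrized by two covectors
`α, β` at the point `s(ξ) = t(ζ)`, in a chart of `M`; as `ω` is additive in the covectors, only
the terms produced by the transports remain, and these cancel. -/
theorem modelSymplectic_multiplicative {x : M} {α β : E →L[ℝ] ℝ} {ξ ζ : CotangentBundle E M}
    (hξ : momentumFlow P (1 / 2) (⟨x, α⟩ : CotangentBundle E M) = ξ)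
    (hζ : momentumFlow P (-(1 / 2)) (⟨x, β⟩ : CotangentBundle E M) = ζ)
    {a b a' b' : Fin 2 → E × (E →L[ℝ] ℝ)} (hab : ∀ i, (a' i).1 = (b' i).1)
    (ha : ∀ i, modelDeriv (cotangentModel E) (cotangentModel E) (momentumFlow P (1 / 2))
      (⟨x, α⟩ : CotangentBundle E M) (a' i) = a i)
    (hb : ∀ i, modelDeriv (cotangentModel E) (cotangentModel E) (momentumFlow P (-(1 / 2)))
      (⟨x, β⟩ : CotangentBundle E M) (b' i) = b i) :
    modelSymplectic E a - modelSymplectic E (fun i => mfderivWithin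
        ((cotangentModel E).prod (cotangentModel E)) (cotangentModel E)
        (fun z : CotangentBundle E M × CotangentBundle E M => (cotangentGroupoid P).mul z.1 z.2)
        (cotangentGroupoid P).composable (ξ, ζ) (a i, b i)) + modelSymplectic E b = 0 := by
  -- the base point and the two covectors, as linear functions on the parameter space
  obtain ⟨L₁, hL₁⟩ : ∃ L : E × ((E →L[ℝ] ℝ) × (E →L[ℝ] ℝ)) →L[ℝ] E × (E →L[ℝ] ℝ),
      ∀ w, L w = (w.1, w.2.1) :=
    ⟨(ContinuousLinearMap.fst ℝ _ _).prod
      ((ContinuousLinearMap.fst ℝ _ _).comp (ContinuousLinearMap.snd ℝ _ _)), fun _ => rfl⟩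
  obtain ⟨L₂, hL₂⟩ : ∃ L : E × ((E →L[ℝ] ℝ) × (E →L[ℝ] ℝ)) →L[ℝ] E × (E →L[ℝ] ℝ),
      ∀ w, L w = (w.1, w.2.2) :=
    ⟨(ContinuousLinearMap.fst ℝ _ _).prod
      ((ContinuousLinearMap.snd ℝ _ _).comp (ContinuousLinearMap.snd ℝ _ _)), fun _ => rfl⟩
  obtain ⟨L₃, hL₃⟩ : ∃ L : E × ((E →L[ℝ] ℝ) × (E →L[ℝ] ℝ)) →L[ℝ] E × (E →L[ℝ] ℝ),
      ∀ w, L w = (w.1, w.2.1 + w.2.2) :=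
    ⟨(ContinuousLinearMap.fst ℝ _ _).prod
      ((ContinuousLinearMap.fst ℝ _ _).comp (ContinuousLinearMap.snd ℝ _ _) +
        (ContinuousLinearMap.snd ℝ _ _).comp (ContinuousLinearMap.snd ℝ _ _)), fun _ => rfl⟩
  obtain ⟨w₀, hw₀⟩ : ∃ w₀ : E × ((E →L[ℝ] ℝ) × (E →L[ℝ] ℝ)),
    w₀ = (extChartAt 𝓘(ℝ, E) x x, α, β) := ⟨_, rfl⟩
  obtain ⟨δ, hδ⟩ : ∃ δ : Fin 2 → E × ((E →L[ℝ] ℝ) × (E →L[ℝ] ℝ)),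
    ∀ i, δ i = ((a' i).1, (a' i).2, (b' i).2) := ⟨_, fun _ => rfl⟩
  have hw₁ : L₁ w₀ = (extChartAt 𝓘(ℝ, E) x x, α) := by rw [hL₁, hw₀]
  have hw₂ : L₂ w₀ = (extChartAt 𝓘(ℝ, E) x x, β) := by rw [hL₂, hw₀]
  have hw₃ : L₃ w₀ = (extChartAt 𝓘(ℝ, E) x x, α + β) := by rw [hL₃, hw₀]
  have hδ₁ (i) : L₁ (δ i) = a' i := by rw [hL₁, hδ]
  have hδ₂ (i) : L₂ (δ i) = b' i := by rw [hL₂, hδ, hab]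
  have hσ₁ := contMDiffAt_chartCovector_comp L₁ hw₁
  have hσ₂ := contMDiffAt_chartCovector_comp L₂ hw₂
  have hσ₃ := contMDiffAt_chartCovector_comp L₃ hw₃
  have hev : ∀ᶠ w in 𝓝 w₀, w.1 ∈ (extChartAt 𝓘(ℝ, E) x).target := by
    refine continuousAt_fst.eventually ((isOpen_extChartAt_target (I := 𝓘(ℝ, E)) x).mem_nhds ?_)
    rw [hw₀]
    exact mem_extChartAt_target x
  have hbase : ∀ᶠ w in 𝓝 w₀, (chartCovector x (L₁ w)).1 = (chartCovector x (L₂ w)).1 := by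
    filter_upwards [hev] with w hw
    rw [hL₁, hL₂, chartCovector_proj hw, chartCovector_proj hw]
  have hadd : ∀ᶠ w in 𝓝 w₀, chartCovector x (L₃ w) =
      cotangentAdd (chartCovector x (L₁ w)) (chartCovector x (L₂ w)) := by
    filter_upwards [hev] with w hw
    rw [hL₁, hL₂, hL₃, cotangentAdd_chartCovector hw]
  have ha' (i) : modelDeriv 𝓘(ℝ, E × ((E →L[ℝ] ℝ) × (E →L[ℝ] ℝ))) (cotangentModel E)
      (fun w => momentumFlow P (1 / 2) (chartCovector x (L₁ w))) w₀ (δ i) = a i := by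
    rw [modelDeriv_momentumFlow_chartCovector P _ _ hw₁, hδ₁, ha]
  have hb' (i) : modelDeriv 𝓘(ℝ, E × ((E →L[ℝ] ℝ) × (E →L[ℝ] ℝ))) (cotangentModel E)
      (fun w => momentumFlow P (-(1 / 2)) (chartCovector x (L₂ w))) w₀ (δ i) = b i := by
    rw [modelDeriv_momentumFlow_chartCovector P _ _ hw₂, hδ₂, hb]
  have e₁ := modelSymplectic_momentumFlow P (T := T) (1 / 2) hσ₁ δ
  have e₂ := modelSymplectic_momentumFlow P (T := T) (-(1 / 2)) hσ₂ δ
  have e₃ := modelSymplectic_mul_momentumFlow P (T := T) hσ₁ hσ₂ hσ₃ hbase hadd δ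
  have hprod := fun i => mfderivWithin_mul_momentumFlow P (hσ₁.mdifferentiableAt (by simp))
    (hσ₂.mdifferentiableAt (by simp)) hbase hadd
    (show momentumFlow P (1 / 2) (chartCovector x (L₁ w₀)) = ξ by rw [hw₁, chartCovector_self, hξ])
    (show momentumFlow P (-(1 / 2)) (chartCovector x (L₂ w₀)) = ζ by
      rw [hw₂, chartCovector_self, hζ]) (ha' i) (hb' i)
  simp only [ha', modelDeriv_chartCovector_comp _ hw₁] at e₁
  simp only [hb', modelDeriv_chartCovector_comp _ hw₂] at e₂
  simp only [← hprod, modelDeriv_chartCovector_comp _ hw₃] at e₃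
  refine (congrArg₂ (· + ·) (congrArg₂ (· - ·) e₁ e₃) e₂).trans ?_
  simp only [modelSymplectic_apply_fin, hδ₁, hδ₂, hL₃]
  simp only [hδ, add_apply, hab]
  ring

theorem isMultiplicative_canonicalForm :
    IsMultiplicative 𝓘(ℝ, E) (cotangentGroupoid P : GroupoidMaps (CotangentBundle E M) M)
      canonicalForm := by
  refine isMultiplicative_of_forall_eq (S := modelSymplectic E) canonicalForm_eq ?_
  intro ξ ζ h a b hab
  obtain ⟨x, α, hξ⟩ : ∃ (x : M) (α : E →L[ℝ] ℝ),
      momentumFlow P (1 / 2) (⟨x, α⟩ : CotangentBundle E M) = ξ :=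
    ⟨_, _, momentumFlow_self_neg P (1 / 2) ξ⟩
  obtain ⟨y, β, hζ⟩ : ∃ (y : M) (β : E →L[ℝ] ℝ),
      momentumFlow P (-(1 / 2)) (⟨y, β⟩ : CotangentBundle E M) = ζ :=
    ⟨_, _, momentumFlow_neg_self P (1 / 2) ζ⟩
  obtain rfl : x = y := by
    rw [← hξ, ← hζ, source_momentumFlow_half, target_momentumFlow_neg_half] at h
    exact h
  have hξ' : momentumFlow P (-(1 / 2)) ξ = (⟨x, α⟩ : CotangentBundle E M) := by
    rw [← hξ, momentumFlow_neg_self]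
  have hζ' : momentumFlow P (1 / 2) ζ = (⟨x, β⟩ : CotangentBundle E M) := by
    rw [← hζ, momentumFlow_self_neg]
  have hs : (cotangentGroupoid P).source =
      fun η : CotangentBundle E M => (momentumFlow P (-(1 / 2)) η).1 :=
    funext (cotangentGroupoid_source_eq P)
  have hab' (i) : (modelDeriv (cotangentModel E) (cotangentModel E)
        (momentumFlow P (-(1 / 2))) ξ (a i)).1 =
      (modelDeriv (cotangentModel E) (cotangentModel E) (momentumFlow P (1 / 2)) ζ (b i)).1 := by
    rw [← modelDeriv_momentumFlow_proj, ← modelDeriv_momentumFlow_proj, ← hs]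
    exact hab i
  exact modelSymplectic_multiplicative P hξ hζ hab'
    (fun i => modelDeriv_momentumFlow_momentumFlow P (by norm_num) hξ' (a i))
    (fun i => modelDeriv_momentumFlow_momentumFlow P (by norm_num) hζ' (b i))

end Multiplicativity

/-! ### The target map is a Poisson map -/

section Hamiltonian

variable {E : Type*} [NormedAddCommGroup E] [NormedSpace ℝ E]
  {H : Type*} [TopologicalSpace H] {I : ModelWithCorners ℝ E H}
  {X : Type*} [TopologicalSpace X] [ChartedSpace H X]

/-- `{f, g} = df(X_g)`, where the Hamiltonian vectors exist. -/
theorem exists_symplecticBracket_eq (Ω : DiffForm I 2 X) (f g : X → ℝ) (x : X)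
    (hf : ∃ v : TangentSpace I x, ∀ w : TangentSpace I x, Ω x ![v, w] = differential f x w)
    (hg : ∃ v : TangentSpace I x, ∀ w : TangentSpace I x, Ω x ![v, w] = differential g x w) :
    ∃ v : TangentSpace I x, (∀ w : TangentSpace I x, Ω x ![v, w] = differential g x w) ∧
      symplecticBracket Ω f g x = differential f x v := by
  refine ⟨hamiltonianVectorField Ω g x, ?_, ?_⟩
  · rw [hamiltonianVectorField, dif_pos hg]
    exact hg.choose_spec
  · rw [symplecticBracket]
    have h : ∀ w : TangentSpace I x,
        Ω x ![hamiltonianVectorField Ω f x, w] = differential f x w := by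
      rw [hamiltonianVectorField, dif_pos hf]
      exact hf.choose_spec
    exact h _

/-- Nondegeneracy of the canonical form; finite dimension makes `E` reflexive. -/
theorem exists_modelSymplectic_eq [FiniteDimensional ℝ E] (φ : E × (E →L[ℝ] ℝ) →L[ℝ] ℝ) :
    ∃ v : E × (E →L[ℝ] ℝ), ∀ w, modelSymplectic E ![v, w] = φ w := by
  let ψ : Module.Dual ℝ (Module.Dual ℝ E) :=
    (φ.comp (ContinuousLinearMap.inr ℝ E (E →L[ℝ] ℝ))).toLinearMap ∘ₗ
    (LinearMap.toContinuousLinearMap : (E →ₗ[ℝ] ℝ) ≃ₗ[ℝ] (E →L[ℝ] ℝ)).toLinearMap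
  obtain ⟨e, he⟩ := (Module.evalEquiv ℝ E).surjective ψ
  refine ⟨(e, -φ.comp (ContinuousLinearMap.inl ℝ E (E →L[ℝ] ℝ))), fun w => ?_⟩
  have h1 : w.2 e = φ (0, w.2) := congrArg (fun A => A (w.2 : E →ₗ[ℝ] ℝ)) he
  have h2 : φ w = φ (0, w.2) + φ (w.1, 0) := by rw [← map_add]; simp
  rw [modelSymplectic_apply, h2, ← h1]
  simp

end Hamiltonian

section CoalgebraVelocity

variable {E : Type*} [NormedAddCommGroup E] [NormedSpace ℝ E]
  {F : Type*} [NormedAddCommGroup F] [NormedSpace ℝ F] [FiniteDimensional ℝ F]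
  {M : Type*} [TopologicalSpace M] [ChartedSpace E M] [IsManifold 𝓘(ℝ, E) ∞ M]
  {T : Type*} [TopologicalSpace T] [ChartedSpace F T] [CommGroup T] [LieGroup 𝓘(ℝ, F) ∞ T]
  [T2Space T]
  [MulAction T M] [ContMDiffSMul 𝓘(ℝ, F) 𝓘(ℝ, E) ∞ T M]
  (P : ⋀[ℝ]^2 (GroupLieAlgebra 𝓘(ℝ, F) T))
  {W : Type*} [NormedAddCommGroup W] [NormedSpace ℝ W]

theorem fderiv_momentum_chartCovector {x : M} {α : E →L[ℝ] ℝ} (L : W →L[ℝ] E × (E →L[ℝ] ℝ))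
    {w : W} (hL : L w = (extChartAt 𝓘(ℝ, E) x x, α)) (δ : W) :
    fderiv ℝ (fun w => momentum (F := F) T (chartCovector x (L w))) w δ =
      modelDeriv (cotangentModel E) 𝓘(ℝ, F →L[ℝ] ℝ) (momentum (F := F) T)
        (⟨x, α⟩ : CotangentBundle E M) (L δ) := by
  have hσ := (contMDiffAt_chartCovector_comp L hL).mdifferentiableAt (by simp)
  rw [← modelDeriv_eq_fderiv, modelDeriv_comp
    ((contMDiff_momentum E M).mdifferentiable (by simp) _) hσ
    (y := (⟨x, α⟩ : CotangentBundle E M)) (by rw [hL, chartCovector_self]) δ,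
    modelDeriv_chartCovector_comp L hL]

theorem modelDeriv_proj {σ : W → CotangentBundle E M} {w : W}
    (hσ : MDifferentiableAt 𝓘(ℝ, W) (cotangentModel E) σ w) (δ : W) :
    (modelDeriv 𝓘(ℝ, W) (cotangentModel E) σ w δ).1 =
      modelDeriv 𝓘(ℝ, W) 𝓘(ℝ, E) (fun w => (σ w).1) w δ :=
  ((modelDeriv_comp ((contMDiff_cotangent_proj E M).mdifferentiable (by simp) _) hσ rfl δ).trans
    (mfderiv_cotangent_proj _ _)).symm

theorem modelDeriv_coalgebraAction_smul {r : W → F →L[ℝ] ℝ} {c : W → M} {w : W} {x : M}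
    (hr : DifferentiableAt ℝ r w) (hc : MDifferentiableAt 𝓘(ℝ, W) 𝓘(ℝ, E) c w) (h0 : r w = 0)
    (hx : c w = x) (δ : W) :
    modelDeriv 𝓘(ℝ, W) 𝓘(ℝ, E) (fun w => coalgebraAction P (r w) • c w) w δ =
      (show E from infinitesimalAction (T := T) (E := E) x
          (sharpCLM (F := F) P (fderiv ℝ r w δ))) +
        modelDeriv 𝓘(ℝ, W) 𝓘(ℝ, E) c w δ := by
  subst hx
  exact mfderiv_coalgebraAction_smul P hr hc h0 δ

theorem contMDiffAt_covectorTransport_coalgebraAction {r : W → F →L[ℝ] ℝ}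
    {σ : W → CotangentBundle E M} {w : W} (hr : ContDiffAt ℝ ∞ r w)
    (hσ : ContMDiffAt 𝓘(ℝ, W) (cotangentModel E) ∞ σ w) :
    ContMDiffAt 𝓘(ℝ, W) (cotangentModel E) ∞
      (fun w => covectorTransport (coalgebraAction P (r w)) (σ w)) w :=
  (contMDiff_covectorTransport E F M T _).comp w
    ((((contMDiff_coalgebraAction P) (r w)).comp w hr.contMDiffAt).prodMk hσ)

/-- The velocity at `t = 0` of the orbit `t ↦ R_{tr}^* (x, α)`. -/
noncomputable def coalgebraVelocity (x : M) (α : E →L[ℝ] ℝ) (r : F →L[ℝ] ℝ) :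
    E × (E →L[ℝ] ℝ) :=
  modelDeriv 𝓘(ℝ, ℝ × (E × (E →L[ℝ] ℝ))) (cotangentModel E)
    (fun w : ℝ × (E × (E →L[ℝ] ℝ)) =>
      covectorTransport (coalgebraAction P (w.1 • r)) (chartCovector x w.2))
    (0, extChartAt 𝓘(ℝ, E) x x, α) (1, 0)

section Velocity

variable (x : M) (α : E →L[ℝ] ℝ) (r : F →L[ℝ] ℝ)

theorem contMDiffAt_chartCovector_snd :
    ContMDiffAt 𝓘(ℝ, ℝ × (E × (E →L[ℝ] ℝ))) (cotangentModel E) ∞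
      (fun w : ℝ × (E × (E →L[ℝ] ℝ)) => chartCovector x w.2)
      (0, extChartAt 𝓘(ℝ, E) x x, α) :=
  contMDiffAt_chartCovector_comp (α := α) (ContinuousLinearMap.snd ℝ ℝ (E × (E →L[ℝ] ℝ))) rfl

theorem modelDeriv_chartCovector_snd (δ : ℝ × (E × (E →L[ℝ] ℝ))) :
    modelDeriv 𝓘(ℝ, ℝ × (E × (E →L[ℝ] ℝ))) (cotangentModel E)
      (fun w : ℝ × (E × (E →L[ℝ] ℝ)) => chartCovector x w.2)
      (0, extChartAt 𝓘(ℝ, E) x x, α) δ = δ.2 :=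
  modelDeriv_chartCovector_comp (α := α) (ContinuousLinearMap.snd ℝ ℝ (E × (E →L[ℝ] ℝ))) rfl δ

theorem fderiv_momentum_chartCovector_snd (δ : ℝ × (E × (E →L[ℝ] ℝ))) :
    fderiv ℝ (fun w : ℝ × (E × (E →L[ℝ] ℝ)) => momentum (F := F) T (chartCovector x w.2))
      (0, extChartAt 𝓘(ℝ, E) x x, α) δ =
      modelDeriv (cotangentModel E) 𝓘(ℝ, F →L[ℝ] ℝ) (momentum (F := F) T)
        (⟨x, α⟩ : CotangentBundle E M) δ.2 :=
  fderiv_momentum_chartCovector (ContinuousLinearMap.snd ℝ ℝ (E × (E →L[ℝ] ℝ))) rfl δ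

theorem contDiffAt_fst_smul (w : ℝ × (E × (E →L[ℝ] ℝ))) :
    ContDiffAt ℝ ∞ (fun w : ℝ × (E × (E →L[ℝ] ℝ)) => w.1 • r) w :=
  ((ContinuousLinearMap.fst ℝ ℝ (E × (E →L[ℝ] ℝ))).smulRight r).contDiff.contDiffAt

theorem fderiv_fst_smul (w δ : ℝ × (E × (E →L[ℝ] ℝ))) :
    fderiv ℝ (fun w : ℝ × (E × (E →L[ℝ] ℝ)) => w.1 • r) w δ = δ.1 • r :=
  congrArg (fun A => A δ) ((ContinuousLinearMap.fst ℝ ℝ (E × (E →L[ℝ] ℝ))).smulRight r).fderiv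

theorem covectorTransport_coalgebraAction_zero_smul (z : E × (E →L[ℝ] ℝ)) :
    covectorTransport (coalgebraAction P ((0 : ℝ) • r)) (chartCovector x z) =
      (chartCovector x z : CotangentBundle E M) := by
  rw [zero_smul, coalgebraAction_zero, covectorTransport_one F]

theorem coalgebraVelocity_fst :
    (coalgebraVelocity P x α r).1 =
      infinitesimalAction (T := T) (E := E) x (sharpCLM (F := F) P r) := by
  have hσ := contMDiffAt_chartCovector_snd x α
  have hr := contDiffAt_fst_smul r ((0, extChartAt 𝓘(ℝ, E) x x, α) : ℝ × (E × (E →L[ℝ] ℝ)))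
  have h1 := modelDeriv_proj ((contMDiffAt_covectorTransport_coalgebraAction P hr
    hσ).mdifferentiableAt (by simp)) (1, 0)
  have hp : MDifferentiableAt 𝓘(ℝ, ℝ × (E × (E →L[ℝ] ℝ))) 𝓘(ℝ, E)
      (fun w : ℝ × (E × (E →L[ℝ] ℝ)) => (chartCovector x w.2).1)
      (0, extChartAt 𝓘(ℝ, E) x x, α) :=
    ((contMDiff_cotangent_proj E M).contMDiffAt.comp _ hσ).mdifferentiableAt (by simp)
  have h2 := modelDeriv_coalgebraAction_smul P (x := x) (hr.differentiableAt (by simp)) hp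
    (zero_smul ℝ r) (congrArg Bundle.TotalSpace.proj (chartCovector_self x α)) (1, 0)
  have h3 := modelDeriv_proj (hσ.mdifferentiableAt (by simp)) (1, 0)
  rw [modelDeriv_chartCovector_snd] at h3
  rw [fderiv_fst_smul, ← h3, one_smul] at h2
  exact (h1.trans h2).trans (add_zero _)

theorem modelDeriv_momentum_coalgebraVelocity :
    modelDeriv (cotangentModel E) 𝓘(ℝ, F →L[ℝ] ℝ) (momentum (F := F) T)
      (⟨x, α⟩ : CotangentBundle E M) (coalgebraVelocity P x α r) = 0 := by
  have hσ := contMDiffAt_chartCovector_snd x α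
  have hr := contDiffAt_fst_smul r ((0, extChartAt 𝓘(ℝ, E) x x, α) : ℝ × (E × (E →L[ℝ] ℝ)))
  have h1 := modelDeriv_comp ((contMDiff_momentum (F := F) (T := T) E M).mdifferentiable
    (by simp) _) ((contMDiffAt_covectorTransport_coalgebraAction P hr
    hσ).mdifferentiableAt (by simp))
    ((covectorTransport_coalgebraAction_zero_smul P x r _).trans (chartCovector_self x α)) (1, 0)
  refine h1.symm.trans ?_
  simp only [momentum_covectorTransport]
  rw [modelDeriv_eq_fderiv, fderiv_momentum_chartCovector_snd, map_zero]

theorem modelDeriv_covectorTransport_zero (v : E × (E →L[ℝ] ℝ)) :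
    modelDeriv 𝓘(ℝ, ℝ × (E × (E →L[ℝ] ℝ))) (cotangentModel E)
      (fun w : ℝ × (E × (E →L[ℝ] ℝ)) =>
      covectorTransport (coalgebraAction P (w.1 • r)) (chartCovector x w.2))
      (0, extChartAt 𝓘(ℝ, E) x x, α) (0, v) = v := by
  have hσ := contMDiffAt_chartCovector_snd x α
  have hr := contDiffAt_fst_smul r ((0, extChartAt 𝓘(ℝ, E) x x, α) : ℝ × (E × (E →L[ℝ] ℝ)))
  have h1 := modelDeriv_comp (f := fun z : E × (E →L[ℝ] ℝ) => ((0 : ℝ), z))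
    (I₁ := 𝓘(ℝ, E × (E →L[ℝ] ℝ))) (x := (extChartAt 𝓘(ℝ, E) x x, α))
    ((contMDiffAt_covectorTransport_coalgebraAction P hr hσ).mdifferentiableAt (by simp))
    (ContinuousLinearMap.inr ℝ ℝ (E × (E →L[ℝ] ℝ))).differentiableAt.mdifferentiableAt rfl v
  have h2 : modelDeriv 𝓘(ℝ, E × (E →L[ℝ] ℝ)) 𝓘(ℝ, ℝ × (E × (E →L[ℝ] ℝ)))
      (fun z : E × (E →L[ℝ] ℝ) => ((0 : ℝ), z)) (extChartAt 𝓘(ℝ, E) x x, α) v = (0, v) := by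
    rw [modelDeriv_eq_fderiv]
    exact congrArg (fun A => A v) (ContinuousLinearMap.inr ℝ ℝ (E × (E →L[ℝ] ℝ))).fderiv
  rw [h2] at h1
  refine h1.symm.trans ?_
  simp only [covectorTransport_coalgebraAction_zero_smul]
  exact modelDeriv_chartCovector_comp (α := α) (ContinuousLinearMap.id ℝ (E × (E →L[ℝ] ℝ))) rfl v

/-- The momentum map generates the action: the velocity of the orbits of `t ↦ R_{tr}` is the
Hamiltonian vector of the function `ζ ↦ ⟨ρ*ζ, #r⟩`. -/
theorem modelSymplectic_coalgebraVelocity (v : E × (E →L[ℝ] ℝ)) :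
    modelSymplectic E ![coalgebraVelocity P x α r, v] =
      modelDeriv (cotangentModel E) 𝓘(ℝ, F →L[ℝ] ℝ) (momentum (F := F) T)
        (⟨x, α⟩ : CotangentBundle E M) v (sharpCLM (F := F) P r) := by
  have hσ := contMDiffAt_chartCovector_snd x α
  have hr := contDiffAt_fst_smul r ((0, extChartAt 𝓘(ℝ, E) x x, α) : ℝ × (E × (E →L[ℝ] ℝ)))
  have h := modelSymplectic_covectorTransport P hr hσ ![(1, 0), (0, v)]
  rw [modelSymplectic_apply_fin, modelSymplectic_apply_fin] at h
  simp only [Matrix.cons_val_zero, Matrix.cons_val_one, modelDeriv_covectorTransport_zero,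
    modelDeriv_chartCovector_snd, fderiv_momentum_chartCovector_snd, fderiv_fst_smul, one_smul,
    zero_smul, map_zero, Prod.fst_zero, Prod.snd_zero, zero_apply, sub_zero,
    zero_add] at h
  rw [modelSymplectic_apply_fin]
  exact h

end Velocity

section TargetDerivative

variable [FiniteDimensional ℝ E]

/-- A vector `Y` which is Hamiltonian for `k ∘ pr₁` with respect to the form `ω - Π(u, u)`, where
each `Z r` is a vector in the kernel of `u` over `ρ(#r)` and Hamiltonian for `⟨u, #r⟩`. -/
theorem apply_fst_of_forall_modelSymplectic {P : ⋀[ℝ]^2 F}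
    {u : E × (E →L[ℝ] ℝ) →L[ℝ] F →L[ℝ] ℝ} {ρ : F →L[ℝ] E} {Z : (F →L[ℝ] ℝ) → E × (E →L[ℝ] ℝ)}
    (hZ : ∀ r, (Z r).1 = ρ (sharpCLM P r)) (h0 : ∀ r, u (Z r) = 0)
    (hS : ∀ r v, modelSymplectic E ![Z r, v] = u v (sharpCLM P r)) {Y : E × (E →L[ℝ] ℝ)}
    {k : E →L[ℝ] ℝ} (hY : ∀ w, modelSymplectic E ![Y, w] = k w.1 + u w (sharpCLM P (u Y)))
    (l : E →L[ℝ] ℝ) : l Y.1 = (k.comp ρ) (sharpCLM P (l.comp ρ)) := by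
  -- testing `hY` on the vertical vectors `(0, p)` determines the horizontal part of `Y`
  have h1 : Y.1 = ρ (sharpCLM P (u Y)) := by
    refine (SeparatingDual.eq_iff_forall_dual_eq (R := ℝ)).2 fun p => ?_
    have h2 := hY (0, p)
    rw [← hS, modelSymplectic_apply, modelSymplectic_apply, hZ] at h2
    simpa using h2
  have h3 : modelSymplectic E ![Y, Z (l.comp ρ)] = -modelSymplectic E ![Z (l.comp ρ), Y] := by
    rw [modelSymplectic_apply, modelSymplectic_apply]; ring
  rw [hY, hS, h0, hZ] at h3
  have h4 := apply_sharpCLM_swap P (u Y) (l.comp ρ)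
  rw [h1]
  simp only [ContinuousLinearMap.comp_apply, zero_apply, add_zero] at h3 h4 ⊢
  rw [h3]
  linarith

theorem modelSymplectic_momentumFlow_half {x : M} {α : E →L[ℝ] ℝ} (v w : E × (E →L[ℝ] ℝ)) :
    modelSymplectic E
        ![modelDeriv (cotangentModel E) (cotangentModel E) (momentumFlow P (1 / 2))
            (⟨x, α⟩ : CotangentBundle E M) v,
          modelDeriv (cotangentModel E) (cotangentModel E) (momentumFlow P (1 / 2))
            (⟨x, α⟩ : CotangentBundle E M) w] =
      modelSymplectic E ![v, w] +
        modelDeriv (cotangentModel E) 𝓘(ℝ, F →L[ℝ] ℝ) (momentum (F := F) T)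
          (⟨x, α⟩ : CotangentBundle E M) w (sharpCLM (F := F) P
            (modelDeriv (cotangentModel E) 𝓘(ℝ, F →L[ℝ] ℝ) (momentum (F := F) T)
              (⟨x, α⟩ : CotangentBundle E M) v)) := by
  have hL : ContinuousLinearMap.id ℝ (E × (E →L[ℝ] ℝ)) (extChartAt 𝓘(ℝ, E) x x, α) =
    (extChartAt 𝓘(ℝ, E) x x, α) := rfl
  have h := modelSymplectic_momentumFlow P (1 / 2) (contMDiffAt_chartCovector_comp _ hL) ![v, w]
  simp only [modelSymplectic_apply_fin, Matrix.cons_val_zero, Matrix.cons_val_one,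
    modelDeriv_momentumFlow_chartCovector P _ _ hL, modelDeriv_chartCovector_comp _ hL,
    fderiv_momentum_chartCovector _ hL] at h ⊢
  rw [show (2 : ℝ) * (1 / 2) = 1 by norm_num, one_mul] at h
  exact h

theorem modelDeriv_momentum_momentumFlow (c : ℝ) {ξ η : CotangentBundle E M}
    (h : momentumFlow P c ξ = η) (v : E × (E →L[ℝ] ℝ)) :
    modelDeriv (cotangentModel E) 𝓘(ℝ, F →L[ℝ] ℝ) (momentum (F := F) T) η
        (modelDeriv (cotangentModel E) (cotangentModel E) (momentumFlow P c) ξ v) =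
      modelDeriv (cotangentModel E) 𝓘(ℝ, F →L[ℝ] ℝ) (momentum (F := F) T) ξ v := by
  rw [← modelDeriv_comp ((contMDiff_momentum E M).mdifferentiable (by simp) _)
    ((contMDiff_momentumFlow P c).mdifferentiable (by simp) _) h v]
  simp only [momentum_momentumFlow]

theorem differential_comp_target {ξ : CotangentBundle E M} {g : M → ℝ}
    (hg : ContMDiff 𝓘(ℝ, E) 𝓘(ℝ, ℝ) ∞ g) {x : M} (hx : (momentumFlow P (1 / 2) ξ).1 = x)
    (w : E × (E →L[ℝ] ℝ)) :
    differential (I := cotangentModel E) (g ∘ (cotangentGroupoid P).target) ξ w =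
      modelDeriv 𝓘(ℝ, E) 𝓘(ℝ, ℝ) g x
        (modelDeriv (cotangentModel E) (cotangentModel E) (momentumFlow P (1 / 2)) ξ w).1 := by
  have h := modelDeriv_comp (hg.mdifferentiable (by simp) _)
    (((contMDiff_cotangent_proj E M).comp (contMDiff_momentumFlow P (1 / 2))).mdifferentiable
      (by simp) ξ) hx w
  exact h.trans (congrArg _ (modelDeriv_momentumFlow_proj P (1 / 2) ξ w))

end TargetDerivative

end CoalgebraVelocity

section PoissonMap

variable {E : Type*} [NormedAddCommGroup E] [NormedSpace ℝ E]
  {F : Type*} [NormedAddCommGroup F] [NormedSpace ℝ F] [FiniteDimensional ℝ F]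
  {M : Type*} [TopologicalSpace M] [ChartedSpace E M] [IsManifold 𝓘(ℝ, E) ∞ M]
  {T : Type*} [TopologicalSpace T] [ChartedSpace F T] [CommGroup T] [LieGroup 𝓘(ℝ, F) ∞ T]
  [T2Space T]
  [MulAction T M] [ContMDiffSMul 𝓘(ℝ, F) 𝓘(ℝ, E) ∞ T M]
  (P : ⋀[ℝ]^2 (GroupLieAlgebra 𝓘(ℝ, F) T))
  {W : Type*} [NormedAddCommGroup W] [NormedSpace ℝ W]

/-- The infinitesimal action at `x`, as a map of the model spaces. -/
noncomputable def modelAction (F : Type*) [NormedAddCommGroup F] [NormedSpace ℝ F]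
    (T : Type*) [TopologicalSpace T] [ChartedSpace F T] [Group T] [MulAction T M] (x : M) :
    F →L[ℝ] E :=
  infinitesimalAction (F := F) (T := T) (E := E) x

theorem bivectorPairing_map_eq_apply_sharp {V W : Type*} [AddCommGroup V] [Module ℝ V]
    [FiniteDimensional ℝ V] [AddCommGroup W] [Module ℝ W] (P : ⋀[ℝ]^2 V) (ρ : V →ₗ[ℝ] W)
    (α β : Module.Dual ℝ W) :
    bivectorPairing (exteriorPower.map 2 ρ P) α β = β (ρ (sharp P (α ∘ₗ ρ))) := by
  rw [bivectorPairing_map, ← apply_sharp]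
  rfl

theorem bivectorBracket_abelianBivector_eq_differential (g h : M → ℝ) (x : M) :
    bivectorBracket (I := 𝓘(ℝ, E)) (abelianBivector P) g h x =
      differential (I := 𝓘(ℝ, E)) h x (infinitesimalAction (F := F) (T := T) (E := E) x (sharp P
        ((differential (I := 𝓘(ℝ, E)) g x : TangentSpace 𝓘(ℝ, E) x →ₗ[ℝ] ℝ) ∘ₗ
          (infinitesimalAction (F := F) (T := T) (E := E) x).toLinearMap))) := by
  unfold bivectorBracket abelianBivector
  exact bivectorPairing_map_eq_apply_sharp _ _ _ _

theorem sharp_comp_infinitesimalAction (g : M → ℝ) (x : M) :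
    sharp P ((differential (I := 𝓘(ℝ, E)) g x : TangentSpace 𝓘(ℝ, E) x →ₗ[ℝ] ℝ) ∘ₗ
        (infinitesimalAction (F := F) (T := T) (E := E) x).toLinearMap) =
      sharpCLM (F := F) P ((modelDeriv 𝓘(ℝ, E) 𝓘(ℝ, ℝ) g x).comp (modelAction F T x)) := rfl

theorem bivectorBracket_abelianBivector (g h : M → ℝ) (x : M) :
    bivectorBracket (I := 𝓘(ℝ, E)) (abelianBivector P) g h x =
      ((modelDeriv 𝓘(ℝ, E) 𝓘(ℝ, ℝ) h x).comp (modelAction F T x))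
        (sharpCLM (F := F) P ((modelDeriv 𝓘(ℝ, E) 𝓘(ℝ, ℝ) g x).comp (modelAction F T x))) := by
  rw [bivectorBracket_abelianBivector_eq_differential]
  exact congrArg (fun v : F => modelDeriv 𝓘(ℝ, E) 𝓘(ℝ, ℝ) h x (modelAction F T x v))
    (sharp_comp_infinitesimalAction P g x)

section FiniteDimensional

variable [FiniteDimensional ℝ E]

theorem isPoissonMap_target :
    IsPoissonMap (canonicalForm : DiffForm (cotangentModel E) 2 (CotangentBundle E M))
      (abelianBivector P : BivectorField 𝓘(ℝ, E) M) (cotangentGroupoid P).target := by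
  intro g h hg hh ξ
  obtain ⟨x, α, hη⟩ : ∃ (x : M) (α : E →L[ℝ] ℝ), momentumFlow P (1 / 2) ξ = ⟨x, α⟩ :=
    ⟨_, _, rfl⟩
  have hx : (momentumFlow P (1 / 2) ξ).1 = x := congrArg Bundle.TotalSpace.proj hη
  have hex : ∀ f : CotangentBundle E M → ℝ, ∃ v : TangentSpace (cotangentModel E) ξ,
      ∀ w : TangentSpace (cotangentModel E) ξ,
        canonicalForm ξ ![v, w] = differential (I := cotangentModel E) f ξ w := fun f => by
    obtain ⟨v, hv⟩ := exists_modelSymplectic_eq (differential (I := cotangentModel E) f ξ)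
    exact ⟨v, fun w => (canonicalForm_eq ξ ![v, w]).trans (hv w)⟩
  obtain ⟨A, hA⟩ : ∃ A, A = modelDeriv (cotangentModel E) (cotangentModel E)
    (momentumFlow P (1 / 2)) ξ := ⟨_, rfl⟩
  obtain ⟨X, hX, hgX⟩ : ∃ X : E × (E →L[ℝ] ℝ),
      (∀ w : E × (E →L[ℝ] ℝ), modelSymplectic E ![X, w] =
        modelDeriv 𝓘(ℝ, E) 𝓘(ℝ, ℝ) h x (A w).1) ∧
      symplecticBracket canonicalForm (g ∘ (cotangentGroupoid P).target)
        (h ∘ (cotangentGroupoid P).target) ξ = modelDeriv 𝓘(ℝ, E) 𝓘(ℝ, ℝ) g x (A X).1 := by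
    obtain ⟨X, hX, hgX⟩ := exists_symplecticBracket_eq canonicalForm
      (g ∘ (cotangentGroupoid P).target) (h ∘ (cotangentGroupoid P).target) ξ (hex _) (hex _)
    subst hA
    exact ⟨X, fun w => (canonicalForm_eq ξ ![X, w]).symm.trans
      ((hX w).trans (differential_comp_target P hh hx w)),
      hgX.trans (differential_comp_target P hg hx X)⟩
  have hY : ∀ w, modelSymplectic E ![A X, w] = modelDeriv 𝓘(ℝ, E) 𝓘(ℝ, ℝ) h x w.1 +
        modelDeriv (cotangentModel E) 𝓘(ℝ, F →L[ℝ] ℝ) (momentum (F := F) T)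
          (⟨x, α⟩ : CotangentBundle E M) w (sharpCLM (F := F) P
            (modelDeriv (cotangentModel E) 𝓘(ℝ, F →L[ℝ] ℝ) (momentum (F := F) T)
              (⟨x, α⟩ : CotangentBundle E M) (A X))) := by
    intro w
    obtain ⟨w', rfl⟩ : ∃ w', A w' = w := by
      rw [hA]
      exact ⟨_, modelDeriv_momentumFlow_momentumFlow P (c := 1 / 2) (d := -(1 / 2)) (by norm_num)
        (ξ := ⟨x, α⟩) (by rw [← hη, momentumFlow_neg_self]) w⟩
    rw [← hX]
    subst hA
    rw [modelDeriv_momentum_momentumFlow P _ hη, modelDeriv_momentum_momentumFlow P _ hη]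
    exact modelSymplectic_momentumFlow_half P X w'
  refine hgX.trans ((apply_fst_of_forall_modelSymplectic
    (ρ := modelAction F T x)
    (Z := coalgebraVelocity P x α) (coalgebraVelocity_fst P x α)
    (modelDeriv_momentum_coalgebraVelocity P x α) (modelSymplectic_coalgebraVelocity P x α)
    hY (modelDeriv 𝓘(ℝ, E) 𝓘(ℝ, ℝ) g x)).trans ?_)
  rw [show (cotangentGroupoid P).target ξ = x from hx]
  exact (bivectorBracket_abelianBivector P g h x).symm

end FiniteDimensional

end PoissonMap

/-! ### Abelian bivectors are Poisson structures -/

section ConstantBivector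

variable {F : Type*} [NormedAddCommGroup F] [NormedSpace ℝ F] [FiniteDimensional ℝ F]

/-- The Jacobi identity for the bracket `{g, h} = dh(#dg)` of a constant bivector on a vector
space: the second derivatives cancel in pairs, by their symmetry and the antisymmetry of `#`. -/
theorem fderiv_sharpCLM_jacobi (P : ⋀[ℝ]^2 F) {f g h : F → ℝ} (hf : ContDiff ℝ ∞ f)
    (hg : ContDiff ℝ ∞ g) (hh : ContDiff ℝ ∞ h) (v : F) :
    fderiv ℝ (fun v => fderiv ℝ h v (sharpCLM P (fderiv ℝ g v))) v (sharpCLM P (fderiv ℝ f v)) +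
      fderiv ℝ (fun v => fderiv ℝ f v (sharpCLM P (fderiv ℝ h v))) v (sharpCLM P (fderiv ℝ g v)) +
      fderiv ℝ (fun v => fderiv ℝ g v (sharpCLM P (fderiv ℝ f v))) v (sharpCLM P (fderiv ℝ h v)) =
      0 := by
  have hd : ∀ {k : F → ℝ}, ContDiff ℝ ∞ k → DifferentiableAt ℝ (fderiv ℝ k) v := fun hk =>
    (hk.fderiv_right (m := ∞) (by simp)).differentiable (by simp) v
  have hb : ∀ {k l : F → ℝ}, ContDiff ℝ ∞ k → ContDiff ℝ ∞ l → ∀ w,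
      fderiv ℝ (fun v => fderiv ℝ l v (sharpCLM P (fderiv ℝ k v))) v w =
        fderiv ℝ (fderiv ℝ l) v w (sharpCLM P (fderiv ℝ k v)) -
          fderiv ℝ (fderiv ℝ k) v w (sharpCLM P (fderiv ℝ l v)) := fun {k l} hk hl w => by
    have h1 : HasFDerivAt (fun v => sharpCLM P (fderiv ℝ k v))
        ((sharpCLM P).comp (fderiv ℝ (fderiv ℝ k) v)) v :=
      (sharpCLM P).hasFDerivAt.comp v (hd hk).hasFDerivAt
    rw [((hd hl).hasFDerivAt.clm_apply h1).fderiv]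
    simp only [add_apply, ContinuousLinearMap.comp_apply, ContinuousLinearMap.flip_apply]
    rw [apply_sharpCLM_swap P (fderiv ℝ (fderiv ℝ k) v w)]
    ring
  have hs : ∀ {k : F → ℝ}, ContDiff ℝ ∞ k → ∀ a b,
      fderiv ℝ (fderiv ℝ k) v a b = fderiv ℝ (fderiv ℝ k) v b a := fun hk a b =>
    (hk.contDiffAt.isSymmSndFDerivAt (by simpa using ENat.LEInfty.out)) a b
  rw [hb hg hh, hb hh hf, hb hf hg, hs hh (sharpCLM P (fderiv ℝ g v)),
    hs hg (sharpCLM P (fderiv ℝ h v)), hs hf (sharpCLM P (fderiv ℝ h v))]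
  ring

end ConstantBivector

section PoissonStructure

variable {E : Type*} [NormedAddCommGroup E] [NormedSpace ℝ E]
  {F : Type*} [NormedAddCommGroup F] [NormedSpace ℝ F] [FiniteDimensional ℝ F]
  {M : Type*} [TopologicalSpace M] [ChartedSpace E M] [IsManifold 𝓘(ℝ, E) ∞ M]
  {T : Type*} [TopologicalSpace T] [ChartedSpace F T] [CommGroup T] [LieGroup 𝓘(ℝ, F) ∞ T]
  [T2Space T]
  [MulAction T M] [ContMDiffSMul 𝓘(ℝ, F) 𝓘(ℝ, E) ∞ T M]
  (P : ⋀[ℝ]^2 (GroupLieAlgebra 𝓘(ℝ, F) T))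

variable (T) in
/-- The function `v ↦ g(exp(v) x)` on the Lie algebra, that is, on the model space. -/
noncomputable def orbitPullback (g : M → ℝ) (x : M) (v : F) : ℝ :=
  g (lieExp (F := F) (T := T) v • x)

theorem contMDiff_orbitPullback {g : M → ℝ} (hg : ContMDiff 𝓘(ℝ, E) 𝓘(ℝ, ℝ) ∞ g) :
    ContMDiff (𝓘(ℝ, E).prod 𝓘(ℝ, F)) 𝓘(ℝ, ℝ) ∞
      (fun z : M × F => orbitPullback T g z.1 z.2) := by
  have h1 : ContMDiff (𝓘(ℝ, E).prod 𝓘(ℝ, F)) 𝓘(ℝ, F) ∞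
      (fun z : M × F => lieExp (F := F) (T := T) z.2) := (contMDiff_lieExp F T).comp contMDiff_snd
  exact hg.comp ((contMDiff_action E F M T).comp (h1.prodMk contMDiff_fst))

theorem contDiff_orbitPullback {g : M → ℝ} (hg : ContMDiff 𝓘(ℝ, E) 𝓘(ℝ, ℝ) ∞ g) (x : M) :
    ContDiff ℝ ∞ (orbitPullback (F := F) T g x) :=
  ((contMDiff_orbitPullback hg).comp (contMDiff_const.prodMk contMDiff_id)).contDiff

theorem orbitPullback_smul (g : M → ℝ) (x : M) (v w : F) :
    orbitPullback T g (lieExp (F := F) (T := T) v • x) w = orbitPullback T g x (w + v) := by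
  have := FiniteDimensional.complete ℝ F
  rw [orbitPullback, orbitPullback, smul_smul]
  exact congrArg (fun a : T => g (a • x)) (lieExp_add (T := T) w v).symm

theorem fderiv_orbitPullback_smul (g : M → ℝ) (x : M) (v : F) :
    fderiv ℝ (orbitPullback (F := F) T g (lieExp (F := F) (T := T) v • x)) 0 =
      fderiv ℝ (orbitPullback (F := F) T g x) v := by
  rw [show orbitPullback (F := F) T g (lieExp (F := F) (T := T) v • x) =
    fun w => orbitPullback T g x (w + v) from funext (orbitPullback_smul g x v),
    fderiv_comp_add_right, zero_add]

theorem fderiv_orbitPullback_zero {g : M → ℝ} (hg : ContMDiff 𝓘(ℝ, E) 𝓘(ℝ, ℝ) ∞ g) (x : M) :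
    fderiv ℝ (orbitPullback (F := F) T g x) 0 =
      (modelDeriv 𝓘(ℝ, E) 𝓘(ℝ, ℝ) g x).comp (modelAction F T x) := by
  have := FiniteDimensional.complete ℝ F
  have hexp : MDifferentiableAt 𝓘(ℝ, F) 𝓘(ℝ, F) (fun v : F => lieExp (F := F) (T := T) v) 0 :=
    (contMDiff_lieExp F T).mdifferentiable (by simp) 0
  have hact : MDifferentiable 𝓘(ℝ, F) 𝓘(ℝ, E) (fun a : T => a • x) :=
    (contMDiff_action_right E F T x).mdifferentiable (by simp)
  have h1 : lieExp (F := F) (T := T) (0 : F) = 1 := lieExp_zero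
  have h2 : lieExp (F := F) (T := T) (0 : F) • x = x := by rw [h1, one_smul]
  refine ContinuousLinearMap.ext fun v => ?_
  have h3 := modelDeriv_comp (hg.mdifferentiable (by simp) x)
    (f := fun v : F => lieExp (F := F) (T := T) v • x) ((hact _).comp 0 hexp) h2 v
  have h4 := modelDeriv_comp (hact 1) hexp h1 v
  have h5 : modelDeriv 𝓘(ℝ, F) 𝓘(ℝ, F) (fun v : F => lieExp (F := F) (T := T) v) 0 v = v :=
    mfderiv_lieExp_zero v
  rw [h5] at h4
  rw [h4, modelDeriv_eq_fderiv] at h3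
  exact h3.trans (congrArg _ (infinitesimalAction_apply x v).symm)

theorem bivectorBracket_eq_fderiv {g h : M → ℝ} (hg : ContMDiff 𝓘(ℝ, E) 𝓘(ℝ, ℝ) ∞ g)
    (hh : ContMDiff 𝓘(ℝ, E) 𝓘(ℝ, ℝ) ∞ h) (x : M) :
    bivectorBracket (I := 𝓘(ℝ, E)) (abelianBivector P) g h x =
      fderiv ℝ (orbitPullback (F := F) T h x) 0
        (sharpCLM (F := F) P (fderiv ℝ (orbitPullback (F := F) T g x) 0)) := by
  rw [bivectorBracket_abelianBivector, fderiv_orbitPullback_zero hg, fderiv_orbitPullback_zero hh]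

theorem orbitPullback_bivectorBracket {g h : M → ℝ} (hg : ContMDiff 𝓘(ℝ, E) 𝓘(ℝ, ℝ) ∞ g)
    (hh : ContMDiff 𝓘(ℝ, E) 𝓘(ℝ, ℝ) ∞ h) (x : M) :
    orbitPullback (F := F) T (bivectorBracket (I := 𝓘(ℝ, E)) (abelianBivector P) g h) x =
      fun v => fderiv ℝ (orbitPullback (F := F) T h x) v
        (sharpCLM (F := F) P (fderiv ℝ (orbitPullback (F := F) T g x) v)) := by
  funext v
  rw [orbitPullback, bivectorBracket_eq_fderiv P hg hh, fderiv_orbitPullback_smul,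
    fderiv_orbitPullback_smul]

theorem contMDiff_fderiv_orbitPullback {g : M → ℝ} (hg : ContMDiff 𝓘(ℝ, E) 𝓘(ℝ, ℝ) ∞ g) :
    ContMDiff 𝓘(ℝ, E) 𝓘(ℝ, F →L[ℝ] ℝ) ∞
      (fun x => fderiv ℝ (orbitPullback (F := F) T g x) 0) := by
  intro x
  have h := ContMDiffAt.mfderiv (I := 𝓘(ℝ, F)) (I' := 𝓘(ℝ, ℝ)) (J := 𝓘(ℝ, E)) (m := ∞) (n := ∞)
    (fun x => orbitPullback (F := F) T g x) (fun _ : M => (0 : F)) (x₀ := x)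
    (contMDiff_orbitPullback hg).contMDiffAt contMDiffAt_const (by simp)
  have e := inTangentCoordinates_model_space (I := 𝓘(ℝ, F)) (I' := 𝓘(ℝ, ℝ))
    (fun _ : M => (0 : F)) (fun x : M => orbitPullback (F := F) T g x 0)
    (fun x : M => mfderiv 𝓘(ℝ, F) 𝓘(ℝ, ℝ) (orbitPullback (F := F) T g x) 0) x
  exact (h.congr_of_eventuallyEq (.of_eq e.symm)).congr_of_eventuallyEq
    (.of_eq (funext fun _ => mfderiv_eq_fderiv.symm))

theorem contMDiff_bivectorBracket_abelianBivector {g h : M → ℝ}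
    (hg : ContMDiff 𝓘(ℝ, E) 𝓘(ℝ, ℝ) ∞ g) (hh : ContMDiff 𝓘(ℝ, E) 𝓘(ℝ, ℝ) ∞ h) :
    ContMDiff 𝓘(ℝ, E) 𝓘(ℝ, ℝ) ∞ (bivectorBracket (I := 𝓘(ℝ, E)) (abelianBivector P) g h) := by
  rw [funext (bivectorBracket_eq_fderiv P hg hh)]
  exact (contMDiff_fderiv_orbitPullback hh).clm_apply
    ((sharpCLM (F := F) P).contMDiff.comp (contMDiff_fderiv_orbitPullback hg))

theorem isPoissonStructure_abelianBivector :
    IsPoissonStructure (abelianBivector P : BivectorField 𝓘(ℝ, E) M) where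
  smooth _ _ hf hg := contMDiff_bivectorBracket_abelianBivector P hf hg
  jacobi f g h hf hg hh x := by
    rw [bivectorBracket_eq_fderiv P hf (contMDiff_bivectorBracket_abelianBivector P hg hh),
      bivectorBracket_eq_fderiv P hg (contMDiff_bivectorBracket_abelianBivector P hh hf),
      bivectorBracket_eq_fderiv P hh (contMDiff_bivectorBracket_abelianBivector P hf hg),
      orbitPullback_bivectorBracket P hg hh, orbitPullback_bivectorBracket P hh hf,
      orbitPullback_bivectorBracket P hf hg]
    exact fderiv_sharpCLM_jacobi (F := F) P (contDiff_orbitPullback hf x)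
      (contDiff_orbitPullback hg x) (contDiff_orbitPullback hh x) 0

end PoissonStructure

end AbelianPoisson

theorem mainTheorem6
    {E : Type*} [NormedAddCommGroup E] [NormedSpace ℝ E] [FiniteDimensional ℝ E]
    {F : Type*} [NormedAddCommGroup F] [NormedSpace ℝ F] [FiniteDimensional ℝ F]
    {M : Type*} [TopologicalSpace M] [ChartedSpace E M] [IsManifold 𝓘(ℝ, E) ∞ M]
    [T2Space M] [SecondCountableTopology M]
    {T : Type*} [TopologicalSpace T] [ChartedSpace F T] [CommGroup T] [LieGroup 𝓘(ℝ, F) ∞ T]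
    [T2Space T] [ConnectedSpace T]
    [MulAction T M] [ContMDiffSMul 𝓘(ℝ, F) 𝓘(ℝ, E) ∞ T M] [FaithfulSMul T M]
    (P : ⋀[ℝ]^2 (GroupLieAlgebra 𝓘(ℝ, F) T)) :
    IsSymplecticGroupoidIntegrating (cotangentGroupoid P)
      (canonicalForm : DiffForm (cotangentModel E) 2 (CotangentBundle E M))
      (abelianBivector P : BivectorField 𝓘(ℝ, E) M) ∧
    IsLieGroupoidHom (cotangentModel E) 𝓘(ℝ, E) (𝓘(ℝ, F →L[ℝ] ℝ).prod 𝓘(ℝ, E)) 𝓘(ℝ, E)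
      (cotangentGroupoid P : GroupoidMaps (CotangentBundle E M) M) (actionGroupoid P)
      (momentumProj T) id :=
  ⟨⟨⟨isLieGroupoid_cotangentGroupoid P, isSymplecticForm_canonicalForm,
      isMultiplicative_canonicalForm P⟩,
    isPoissonStructure_abelianBivector P, isPoissonMap_target P, isConnected_source_fibre P⟩,
    isLieGroupoidHom_momentumProj P⟩
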